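/- Let $\mathcal{O}_K$ be a discrete valuation ring with uniformizer $\pi$. For an $\mathcal{O}_K$-scheme $\mathcal{Y}$ and $n\ge 0$ put $\mathcal{O}_{K,n}=\mathcal{O}_K/\pi^{n+1}\mathcal{O}_K$ and $\mathcal{Y}_n=\mathcal{Y}\times_{\mathcal{O}_K}\operatorname{Spec}\mathcal{O}_{K,n}$. Let $\mathcal{Y}$ be a flat $\mathcal{O}_K$-scheme of finite type and let $q$ be a closed point of $\mathcal{Y}$ contained in the closed fiber. Suppose that some open neighborhood of $q$ in $\mathcal{Y}$ is, over $\mathcal{O}_K$, a hypersurface (an effective Cartier divisor) in a regular $\mathcal{O}_K$-scheme $\mathcal{Z}$ of finite type. Let $\mu_q(\mathcal{Y})$ be the multiplicity of $\mathcal{Y}$ at $q$, that is, the largest $m$ such that a local equation of $\mathcal{Y}$ in $\mathcal{Z}$ at $q$ lies in $\mathfrak m_{\mathcal{Z},q}^m$. Let $r_E\ge 1$ be the multiplicity at $q$ of the special fiber of $\mathcal{Z}$, that is, the largest $r$ with $\pi\in\mathfrak m_{\mathcal{Z},q}^r$ (this is also the multiplicity of the exceptional divisor $E$ in the special fiber of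 the blowing-up of $\mathcal{Z}$ along $q$). Put $c=\lceil \mu_q(\mathcal{Y})/r_E\rceil$. Let $\widetilde{\mathcal{Y}}\to\mathcal{Y}$ be the blowing-up along $q$, and let $\ell\ge c$ be an integer. Then, for all $N\ge 0$, $\mathcal{Y}_{N+\ell}$ determines $(\widetilde{\mathcal{Y}})_N$, in the following sense. Let $\mathcal{O}_{K_o}$ be a discrete valuation ring and let $\mathcal{Y}_o$, $q_o$, $\mathcal{Z}_o$, $c_o$ and $\widetilde{\mathcal{Y}}_o\to\mathcal{Y}_o$ be as above over $\mathcal{O}_{K_o}$, with $c_o\le \ell$. Suppose that there are an isomorphism of rings $\phi_{N+\ell}:\mathcal{O}_{K,N+\ell}\to\mathcal{O}_{K_o,N+\ell}$ and an isomorphism of schemes $\mathcal{Y}_{N+\ell}\simeq\mathcal{Y}_{o,N+\ell}$ which is compatible with $\phi_{N+\ell}$ and maps $q$ to $q_o$. Then there is an isomorphism $(\widetilde{\mathcal{Y}})_N\simeq(\widetilde{\mathcal{Y}}_o)_N$ compatible with the isomorphism $\mathcal{O}_{K,N}\simeq\mathcal{O}_{K_o,N}$ induced by $\phi_{N+\ell}$.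 -/

import Mathlib

open CategoryTheory CategoryTheory.Limits AlgebraicGeometry IsLocalRing TopologicalSpace

universe u

noncomputable section

namespace InfinitesimalFiber

/-- An ideal sheaf is that of an effective Cartier divisor: locally it is generated by one
nonzerodivisor. -/
def IsEffectiveCartier {X : Scheme.{u}} (I : X.IdealSheafData) : Prop :=
  ∀ x : X, ∃ V : X.affineOpens, x ∈ V.1 ∧
    ∃ s ∈ nonZeroDivisors Γ(X, V.1), I.ideal V = Ideal.span {s}

/-- `p : X' ⟶ X` is the blowing-up of `X` along the closed subscheme with ideal sheaf `I`:
the inverse image ideal sheaf is that of an effective Cartier divisor, and `p` is universal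
(terminal) among the morphisms to `X` with this property. -/
structure IsBlowUp {X' X : Scheme.{u}} (p : X' ⟶ X) (I : X.IdealSheafData) : Prop where
  isEffectiveCartier : IsEffectiveCartier (I.comap p)
  existsUnique_lift : ∀ (T : Scheme.{u}) (t : T ⟶ X), IsEffectiveCartier (I.comap t) →
    ∃! t' : T ⟶ X', t' ≫ p = t

/-- `p : X' ⟶ X` is the blowing-up of `X` along the closed point `q` (with its reduced
structure). -/
def IsBlowUpAt {X' X : Scheme.{u}} (p : X' ⟶ X) (q : X) (hq : IsClosed ({q} : Set X)) : Prop :=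
  IsBlowUp p (Scheme.IdealSheafData.vanishingIdeal ⟨{q}, hq⟩)

/-- A scheme is regular if all its local rings are regular. -/
def IsRegularScheme (X : Scheme.{u}) : Prop :=
  ∀ x : X, IsRegularLocalRing (X.presheaf.stalk x)

/-- The multiplicity at `x` of the closed subscheme with ideal sheaf `I`: the largest `n` such that
the stalk of `I` at `x` is contained in the `n`-th power of the maximal ideal of the local ring.
It is used for nonzero locally principal ideal sheaves on regular schemes, where the
supremum is a maximum. -/
def multiplicityAt {X : Scheme.{u}} (I : X.IdealSheafData) (x : X) : ℕ :=
  sSup {n : ℕ | ∀ (V : X.affineOpens) (hx : x ∈ V.1), ∀ s ∈ I.ideal V,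
    X.presheaf.germ V.1 x hx s ∈ maximalIdeal (X.presheaf.stalk x) ^ n}

section Fibers

variable (R : Type u) [CommRing R] [IsLocalRing R]

/-- `R / 𝔪 ^ (n + 1)`; this is `R / π ^ (n + 1) R` for a discrete valuation ring `R` with
uniformizer `π`. -/
abbrev Trunc (n : ℕ) : Type u := R ⧸ maximalIdeal R ^ (n + 1)

/-- The projection `R / 𝔪 ^ (m + 1) → R / 𝔪 ^ (n + 1)` for `n ≤ m`. -/
def Trunc.proj {n m : ℕ} (h : n ≤ m) : Trunc R m →+* Trunc R n :=
  Ideal.Quotient.factor (Ideal.pow_le_pow_right (Nat.add_le_add_right h 1))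

variable {R} {X : Scheme.{u}} (f : X ⟶ Spec (CommRingCat.of R)) (n : ℕ)

/-- The infinitesimal fiber `X_n = X ×_R R / 𝔪 ^ (n + 1)`. -/
abbrev fiber : Scheme.{u} :=
  pullback f (Spec.map (CommRingCat.ofHom (Ideal.Quotient.mk (maximalIdeal R ^ (n + 1)))))

/-- The closed immersion `X_n ⟶ X`. -/
abbrev fiberι : fiber f n ⟶ X := pullback.fst _ _

/-- The structure morphism of `X_n`. -/
abbrev fiberStr : fiber f n ⟶ Spec (CommRingCat.of (Trunc R n)) := pullback.snd _ _

end Fibers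

/-- A presentation of the `R`-scheme `Y` locally at the point `q` as a hypersurface (an effective
Cartier divisor) in a regular `R`-scheme `Z` of finite type. -/
structure HypersurfaceAt {R : Type u} [CommRing R] {Y : Scheme.{u}}
    (f : Y ⟶ Spec (CommRingCat.of R)) (q : Y) where
  /-- an open neighbourhood of `q` in `Y` -/
  U : Y.Opens
  mem : q ∈ U
  /-- the ambient regular scheme -/
  Z : Scheme.{u}
  /-- the structure morphism of the ambient scheme -/
  g : Z ⟶ Spec (CommRingCat.of R)
  locallyOfFiniteType : LocallyOfFiniteType g
  quasiCompact : QuasiCompact g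
  regular : IsRegularScheme Z
  /-- the embedding of the neighbourhood -/
  i : U.toScheme ⟶ Z
  isClosedImmersion : IsClosedImmersion i
  comp_eq : i ≫ g = U.ι ≫ f
  isEffectiveCartier : IsEffectiveCartier i.ker

namespace HypersurfaceAt

variable {R : Type u} [CommRing R] [IsLocalRing R] {Y : Scheme.{u}}
  {f : Y ⟶ Spec (CommRingCat.of R)} {q : Y} (H : HypersurfaceAt f q)

/-- The point `q` in the ambient scheme `Z`. -/
def point : H.Z := H.i ⟨q, H.mem⟩

/-- The multiplicity `μ_q(Y)`. -/
def mu : ℕ := multiplicityAt H.i.ker H.point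

/-- The multiplicity at `q` of the special fiber of `Z`, which is also the multiplicity `r_E` of the
exceptional divisor in the special fiber of the blowing-up of `Z` along `q`. -/
def rE : ℕ := multiplicityAt (fiberι H.g 0).ker H.point

/-- The constant `c = ⌈μ_q(Y) / r_E⌉`. -/
def c : ℕ := ⌈(H.mu : ℚ) / (H.rE : ℚ)⌉₊

end HypersurfaceAt

end InfinitesimalFiber

end

/-! Over an affine neighbourhood `Spec A` of `q`, with `m` the maximal ideal of `q` generated by
elements `x j`, the blowing-up is covered by the spectra of the algebras `A[m/f]`, `f ∈ m`. Such an
algebra is `A[T]` modulo the relations `x j = f T j` and then modulo `f`-power torsion. A truncation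
of `A` sees the relations, but not obviously the torsion. Two facts remedy this.

Bounded torsion: if `A` is at `q` a hypersurface of multiplicity `μ`, the torsion is killed by `f ^
μ` (`IsHypersurfaceOfOrder.C_pow_mul_mem_ratioIdeal`). This is computed in the ambient regular local
ring, where orders of elements add under multiplication (`mem_pow_of_mul_mem_pow`) and the maximal
ideal is of linear type (`mem_ratioIdeal_of_eval_eq_zero`).

Bounded loss of precision: `π` lies in the `r_E`-th power of the maximal ideal and `μ ≤ l r_E`, so
`π ^ l ∈ m ^ μ`, and `f ^ μ` divides `π ^ l` in `A[m/f]`. If `f ^ μ z` is divisible by `π ^ (N + 1 +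
l)`, cancelling `f ^ μ` shows that `z` is divisible by `π ^ (N + 1)`. Hence `A[m/f] / π ^ (N + 1)`
is the quotient of `(A / π ^ (N + 1 + l))[T]` by `π ^ (N + 1)` and by the polynomials that `f ^ μ`
multiplies into the relations (`exists_chartIdeal_quotient_equiv`).

The gluing of the charts is also expressed by equations between the coordinates
(`comp_chart_eq_comp_chart_iff`), so it too is read off from the truncation (`exists_isTruncAtlas`).
Away from `q` the center is empty, and the universal property of the blowing-up identifies the
remaining parts of the two fibers; `exists_iso_of_isTruncAtlas` glues everything. -/

noncomputable section

namespace InfinitesimalFiber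

/-! ### Parameters of a regular local ring are quasi-regular; orders add. -/

section QuasiRegular

open MvPolynomial

lemma IsHomogeneous.eval_mul_const {S ι : Type*} [CommRing S] {n : ℕ} {F : MvPolynomial ι S}
    (hF : F.IsHomogeneous n) (c : ι → S) (t : S) :
    eval (fun j ↦ t * c j) F = t ^ n * eval c F := by
  rw [eval_eq, eval_eq, Finset.mul_sum]
  refine Finset.sum_congr rfl fun d hd ↦ ?_
  simp only [mul_pow]
  rw [Finset.prod_mul_distrib, Finset.prod_pow_eq_pow_sum]
  have := hF.degree_eq_sum_deg_support hd
  rw [this]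
  ring

variable {B ι : Type*} [CommRing B] [IsLocalRing B] [IsNoetherianRing B] [Fintype ι]

/-- A homogeneous relation between parameters has no unit coefficient (infinite residue field). -/
lemma coeff_mem_maximalIdeal_of_infinite [Infinite (ResidueField B)] (x : ι → B)
    (hx : Ideal.span (Set.range x) = maximalIdeal B)
    (hd : (Fintype.card ι : ℕ∞) ≤ (maximalIdeal B).height) {n : ℕ} {F : MvPolynomial ι B}
    (hF : F.IsHomogeneous n) (h0 : eval x F = 0) (d : ι →₀ ℕ) : coeff d F ∈ maximalIdeal B := by
  classical
  by_contra hcon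
  have hF' : MvPolynomial.map (residue B) F ≠ 0 := by
    intro h
    apply hcon
    have := congr(coeff d $h)
    rwa [coeff_map, coeff_zero, residue_eq_zero_iff] at this
  -- A nonzero form over an infinite field has a nonzero value; lifted to `B`, that value becomes a
  -- unit.
  obtain ⟨a, ha⟩ : ∃ a, eval a (MvPolynomial.map (residue B) F) ≠ 0 := by
    by_contra! h
    exact hF' ((hF.map _).eq_zero_of_forall_eval_eq_zero h)
  choose b hb using fun i ↦ residue_surjective (R := B) (a i)
  have hab : a = fun i ↦ residue B (b i) := funext fun i ↦ (hb i).symm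
  have hu : IsUnit (eval b F) := by
    by_contra h
    apply ha
    rw [MvPolynomial.eval_map, hab]
    have : eval₂ (residue B) (fun i ↦ residue B (b i)) F = residue B (eval b F) := by
      rw [← MvPolynomial.eval₂_id, eval₂_comp_left]
      rfl
    rw [this, residue_eq_zero_iff]
    exact h
  by_cases hall : ∀ i, b i ∈ maximalIdeal B
  · rcases Nat.eq_zero_or_pos n with rfl | hn
    · obtain ⟨c, rfl⟩ : ∃ c, F = C c := ⟨_,
        totalDegree_eq_zero_iff_eq_C.mp (Nat.le_zero.mp hF.totalDegree_le)⟩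
      simp only [eval_C] at h0 hu
      subst h0
      exact not_isUnit_zero hu
    · have : eval b F ∈ maximalIdeal B ^ n := by
        have h1 := (Ideal.mem_span_pow_iff_exists_isHomogeneous (n := n) b (eval b F)).mpr
          ⟨F, hF, rfl⟩
        refine Ideal.pow_right_mono (Ideal.span_le.mpr ?_) n h1
        rintro _ ⟨i, rfl⟩
        exact hall i
      exact (Ideal.pow_le_self hn.ne' this) hu
  · push Not at hall
    obtain ⟨i, hi⟩ := hall
    have hbi : IsUnit (b i) := by simpa using hi
    obtain ⟨v, hv⟩ := hbi
    let c : ι → B := fun j ↦ (↑v⁻¹ : B) * b j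
    have hci : c i = 1 := by simp [c, ← hv]
    have hcu : IsUnit (eval c F) := by
      rw [show c = fun j ↦ (↑v⁻¹ : B) * b j from rfl, IsHomogeneous.eval_mul_const hF]
      exact (v⁻¹.isUnit.pow n).mul hu
    -- Modulo `s` every `x j` equals `c j * x i`, so the relation `F(x) = 0` becomes `x i ^ n * F(c)
    -- = 0` with `F(c)` a unit. The maximal ideal is then minimal over an ideal with fewer than
    -- `card ι` generators, against Krull's height theorem.
    let s : Set B := (fun j ↦ x j - c j * x i) '' {j | j ≠ i}
    have hs : s.Finite := Set.toFinite _
    have hxj (j : ι) : x j - x i * c j ∈ Ideal.span s := by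
      by_cases hj : j = i
      · subst hj; simp [hci]
      · exact Ideal.subset_span ⟨j, hj, by ring⟩
    have hpow : x i ^ n ∈ Ideal.span s := by
      have h1 : Ideal.Quotient.mk (Ideal.span s) (eval x F) =
          Ideal.Quotient.mk (Ideal.span s) (eval (fun j ↦ x i * c j) F) := by
        have key (y : ι → B) : Ideal.Quotient.mk (Ideal.span s) (eval y F) =
            eval₂ (Ideal.Quotient.mk (Ideal.span s))
              (fun j ↦ Ideal.Quotient.mk (Ideal.span s) (y j)) F := by
          rw [← MvPolynomial.eval₂_id, eval₂_comp_left]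
          rfl
        rw [key, key]
        congr 1
        funext j
        exact Ideal.Quotient.eq.mpr (hxj j)
      rw [h0, map_zero, IsHomogeneous.eval_mul_const hF, eq_comm,
        Ideal.Quotient.eq_zero_iff_mem] at h1
      exact (Ideal.mul_unit_mem_iff_mem _ hcu).mp h1
    have hsm : Ideal.span s ≤ maximalIdeal B := by
      rw [Ideal.span_le]
      rintro _ ⟨j, -, rfl⟩
      have hm (k : ι) : x k ∈ maximalIdeal B := hx ▸ Ideal.subset_span ⟨k, rfl⟩
      exact sub_mem (hm j) (Ideal.mul_mem_left _ _ (hm i))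
    have hmin : maximalIdeal B ∈ (Ideal.span s).minimalPrimes := by
      refine ⟨⟨inferInstance, hsm⟩, fun P ⟨hP, hsP⟩ _ ↦ ?_⟩
      rw [← hx, Ideal.span_le]
      have hxi : x i ∈ P := hP.mem_of_pow_mem _ (hsP hpow)
      rintro _ ⟨j, rfl⟩
      have := add_mem (hsP (hxj j)) (Ideal.mul_mem_right (c j) _ hxi)
      simpa using this
    have h1 := Ideal.height_le_card_of_mem_minimalPrimes_span hs hmin
    have h2 : s.ncard < Fintype.card ι := by
      refine (Set.ncard_image_le (Set.toFinite _)).trans_lt ?_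
      rw [← Nat.card_eq_fintype_card, ← Set.ncard_univ]
      exact Set.ncard_lt_ncard ⟨Set.subset_univ _, fun h ↦ h (Set.mem_univ i) rfl⟩
    have := hd.trans h1
    exact absurd h2 (not_lt.mpr (by exact_mod_cast this))

/-- A homogeneous relation between parameters has no unit coefficient. -/
lemma coeff_mem_maximalIdeal (x : ι → B)
    (hx : Ideal.span (Set.range x) = maximalIdeal B)
    (hd : (Fintype.card ι : ℕ∞) ≤ (maximalIdeal B).height) {n : ℕ} {F : MvPolynomial ι B}
    (hF : F.IsHomogeneous n) (h0 : eval x F = 0) (d : ι →₀ ℕ) : coeff d F ∈ maximalIdeal B := by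
  -- Localizing `B[X]` at `𝔪 B[X]` keeps the parameters and the height and makes the residue field
  -- infinite: the powers of `X` stay distinct in it.
  let P : Ideal (Polynomial B) := (maximalIdeal B).map Polynomial.C
  have hP : P.IsPrime := Ideal.isPrime_map_C_of_isPrime
  let B' := Localization.AtPrime P
  let g : B →+* B' := (algebraMap (Polynomial B) B').comp Polynomial.C
  have hmap : (maximalIdeal B).map g = maximalIdeal B' := by
    rw [← Ideal.map_map, Localization.AtPrime.map_eq_maximalIdeal]
  have hcomap : (maximalIdeal B').comap g = maximalIdeal B := by
    refine ((maximalIdeal.isMaximal B).eq_of_le ?_ ?_).symm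
    · exact Ideal.comap_ne_top _ (maximalIdeal.isMaximal B').ne_top
    · rw [← Ideal.map_le_iff_le_comap, hmap]
  have hinf : Infinite (ResidueField B') := by
    let φ : Polynomial B →+* ResidueField B' := (residue B').comp (algebraMap _ _)
    have hker (p : Polynomial B) : φ p = 0 ↔ p ∈ P := by
      change residue B' (algebraMap _ _ p) = 0 ↔ _
      rw [residue_eq_zero_iff, IsLocalization.AtPrime.to_map_mem_maximal_iff B' P]
    refine Infinite.of_injective (fun k : ℕ ↦ φ (Polynomial.X ^ k)) fun k l hkl ↦ ?_
    by_contra hne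
    have h1 : φ (Polynomial.X ^ k - Polynomial.X ^ l) = 0 := by
      rw [map_sub, sub_eq_zero]; exact hkl
    rw [hker, Ideal.mem_map_C_iff] at h1
    have h2 := h1 k
    rw [Polynomial.coeff_sub, Polynomial.coeff_X_pow_self, Polynomial.coeff_X_pow,
      if_neg hne, sub_zero] at h2
    exact (Ideal.ne_top_iff_one _).mp (maximalIdeal.isMaximal B).ne_top h2
  have hht : (maximalIdeal B').height = (maximalIdeal B).height := by
    have h1 := IsLocalization.AtPrime.ringKrullDim_eq_height P B'
    rw [← maximalIdeal_height_eq_ringKrullDim] at h1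
    rw [WithBot.coe_inj.mp h1, Polynomial.height_map_C]
  have key := coeff_mem_maximalIdeal_of_infinite (B := B') (fun i ↦ g (x i)) (by
      rw [← hmap, ← hx, Ideal.map_span, ← Set.range_comp]; rfl) (by rwa [hht]) (hF.map g) (by
      rw [MvPolynomial.eval_map, ← map_zero g, ← h0, ← MvPolynomial.eval₂_id,
        eval₂_comp_left]
      rfl) d
  rwa [coeff_map, ← Ideal.mem_comap, hcomap] at key

/-- The value `F(x)`, being in `𝔪 * 𝔪 ^ n`, is also the value of a form `G` of degree `n` with
coefficients in `𝔪`; then `F - G` is a genuine relation. -/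
lemma coeff_mem_maximalIdeal_of_eval_mem_pow (x : ι → B)
    (hx : Ideal.span (Set.range x) = maximalIdeal B)
    (hd : (Fintype.card ι : ℕ∞) ≤ (maximalIdeal B).height) {n : ℕ} {F : MvPolynomial ι B}
    (hF : F.IsHomogeneous n) (h0 : eval x F ∈ maximalIdeal B ^ (n + 1)) (d : ι →₀ ℕ) :
    coeff d F ∈ maximalIdeal B := by
  have h1 : eval x F ∈ maximalIdeal B * Ideal.span (Set.range x) ^ n := by
    rwa [hx, ← pow_succ']
  obtain ⟨G, hG, hGc, hGx⟩ : ∃ G : MvPolynomial ι B, G.IsHomogeneous n ∧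
      (∀ d, coeff d G ∈ maximalIdeal B) ∧ eval x G = eval x F := by
    generalize eval x F = y at h1
    induction h1 using Submodule.mul_induction_on' with
    | mem_mul_mem c hc z hz =>
      obtain ⟨G, hG, rfl⟩ := (Ideal.mem_span_pow_iff_exists_isHomogeneous x z).mp hz
      exact ⟨C c * G, hG.C_mul c, fun d ↦ by
        rw [coeff_C_mul]; exact Ideal.mul_mem_right _ _ hc, by simp⟩
    | add y _ z _ hy hz =>
      obtain ⟨G, hG, hGc, rfl⟩ := hy
      obtain ⟨H, hH, hHc, rfl⟩ := hz
      exact ⟨G + H, hG.add hH, fun d ↦ by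
        rw [coeff_add]; exact add_mem (hGc d) (hHc d), by simp⟩
  have := coeff_mem_maximalIdeal x hx hd (hF.sub hG) (by simp [hGx]) d
  rw [coeff_sub] at this
  simpa using add_mem this (hGc d)

/-- Multiplication by an element of exact order `μ` raises the order by exactly `μ`. -/
lemma mem_pow_of_mul_mem_pow (x : ι → B)
    (hx : Ideal.span (Set.range x) = maximalIdeal B)
    (hd : (Fintype.card ι : ℕ∞) ≤ (maximalIdeal B).height) {μ j : ℕ} {h u : B}
    (h1 : h ∈ maximalIdeal B ^ μ) (h2 : h ∉ maximalIdeal B ^ (μ + 1))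
    (hu : h * u ∈ maximalIdeal B ^ (μ + j)) : u ∈ maximalIdeal B ^ j := by
  induction j with
  | zero => simp
  | succ j ih =>
    have hj := ih (Ideal.pow_le_pow_right (by omega) hu)
    by_contra hcon
    obtain ⟨H, hH, rfl⟩ := (Ideal.mem_span_pow_iff_exists_isHomogeneous x h).mp (by rwa [hx])
    obtain ⟨U, hU, rfl⟩ := (Ideal.mem_span_pow_iff_exists_isHomogeneous x u).mp (by rwa [hx])
    have hnz {n : ℕ} {F : MvPolynomial ι B} (hF : F.IsHomogeneous n)
        (hFx : eval x F ∉ maximalIdeal B ^ (n + 1)) : MvPolynomial.map (residue B) F ≠ 0 := by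
      intro h0
      apply hFx
      rw [eval_eq, ← hx]
      refine Ideal.sum_mem _ fun d hd ↦ ?_
      rw [pow_succ', hx]
      refine Ideal.mul_mem_mul ?_ ?_
      · rw [← residue_eq_zero_iff, ← coeff_map, h0, coeff_zero]
      · rw [← hx]
        refine (Ideal.mem_span_pow_iff_exists_isHomogeneous x _).mpr
          ⟨monomial d 1, isHomogeneous_monomial 1 ?_, by simp [eval_monomial, Finsupp.prod]⟩
        exact (hF.degree_eq_sum_deg_support hd).symm
    -- The initial forms of `h` and `u` would have product zero over the residue field, where
    -- polynomials form a domain.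
    have h3 := coeff_mem_maximalIdeal_of_eval_mem_pow x hx hd (hH.mul hU)
      (by rw [map_mul]; exact hu)
    refine mul_ne_zero (hnz hH h2) (hnz hU hcon) ?_
    rw [← map_mul]
    ext d
    rw [coeff_map, coeff_zero, residue_eq_zero_iff]
    exact h3 d

end QuasiRegular

/-! ### Torsion in the algebra of the relations `x j = f T j`. -/

section Torsion

open MvPolynomial

/-- The ideal of relations `x j = f T j` in the polynomial ring with variables `T j`. -/
def ratioIdeal {J A : Type*} [CommRing A] (x : J → A) (f : A) : Ideal (MvPolynomial J A) :=
  Ideal.span (Set.range fun j ↦ C (x j) - C f * X j)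

lemma ratioIdeal_sub_mem {J A : Type*} [CommRing A] (x : J → A) (f : A) (j : J) :
    C (x j) - C f * X j ∈ ratioIdeal x f := Ideal.subset_span ⟨j, rfl⟩

lemma map_ratioIdeal {J A A' : Type*} [CommRing A] [CommRing A'] (x : J → A) (f : A)
    (g : A →+* A') :
    (ratioIdeal x f).map (MvPolynomial.map g) = ratioIdeal (fun j ↦ g (x j)) (g f) := by
  rw [ratioIdeal, Ideal.map_span, ← Set.range_comp, ratioIdeal]
  congr 2
  funext j
  simp

/-- By homogeneity `f ^ n G(T) = G(f T)`, and `f T` is `x` modulo the relations. -/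
lemma C_pow_mul_sub_mem_ratioIdeal {ι B : Type*} [CommRing B] (x : ι → B) (f : B) {n : ℕ}
    {G : MvPolynomial ι B} (hG : G.IsHomogeneous n) :
    C f ^ n * G - C (eval x G) ∈ ratioIdeal x f := by
  rw [← Ideal.Quotient.eq_zero_iff_mem, map_sub, sub_eq_zero]
  have h1 : C f ^ n * G = aeval (fun i ↦ C f * X i) G := by
    have := IsHomogeneous.eval_mul_const (hG.map C) (fun i : ι ↦ (X i : MvPolynomial ι B)) (C f)
    rw [MvPolynomial.eval_map, MvPolynomial.eval_map, eval₂_eta] at this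
    rw [← this]
    rfl
  have h2 : (C (eval x G) : MvPolynomial ι B) = aeval (fun i ↦ C (x i)) G := by
    rw [← MvPolynomial.eval₂_id, eval₂_comp_left]
    rfl
  have key (y : ι → MvPolynomial ι B) : Ideal.Quotient.mk (ratioIdeal x f) (aeval y G) =
      eval₂ ((Ideal.Quotient.mk (ratioIdeal x f)).comp C)
        (fun j ↦ Ideal.Quotient.mk (ratioIdeal x f) (y j)) G := by
    change Ideal.Quotient.mk (ratioIdeal x f) (eval₂ C y G) = _
    rw [eval₂_comp_left]
    rfl
  rw [h1, h2, key, key]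
  congr 1
  funext j
  exact (Ideal.Quotient.eq.mpr (ratioIdeal_sub_mem x f j)).symm

/-- In each coefficient, written as a combination of the `x k`, one replaces `x k` by `f T k`. The
factor `f` comes out and the degree goes up by one, while the value at `x` does not change. -/
lemma exists_sub_C_mul_mem_ratioIdeal {ι B : Type*} [CommRing B] [Fintype ι] (x : ι → B) (f : B)
    {n : ℕ} {G : MvPolynomial ι B} (hG : G.IsHomogeneous n)
    (hc : ∀ d, coeff d G ∈ Ideal.span (Set.range x)) :
    ∃ G' : MvPolynomial ι B, G'.IsHomogeneous (n + 1) ∧ eval x G' = eval x G ∧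
      G - C f * G' ∈ ratioIdeal x f := by
  choose a ha using fun d ↦ Ideal.mem_span_range_iff_exists_fun.mp (hc d)
  refine ⟨∑ d ∈ G.support, ∑ k, C (a d k) * X k * monomial d 1, ?_, ?_, ?_⟩
  · refine IsHomogeneous.sum _ _ _ fun d hd ↦ IsHomogeneous.sum _ _ _ fun k _ ↦ ?_
    rw [add_comm]
    exact (isHomogeneous_C_mul_X _ _).mul
      (isHomogeneous_monomial _ (hG.degree_eq_sum_deg_support hd).symm)
  · conv_rhs => rw [eval_eq]
    rw [map_sum]
    refine Finset.sum_congr rfl fun d _ ↦ ?_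
    rw [map_sum, ← ha d, Finset.sum_mul]
    refine Finset.sum_congr rfl fun k _ ↦ ?_
    simp [eval_monomial, Finsupp.prod]
  · have h2 := support_sum_monomial_coeff G
    rw [Finset.mul_sum]
    nth_rw 1 [← h2]
    rw [← Finset.sum_sub_distrib]
    refine Ideal.sum_mem _ fun d _ ↦ ?_
    have : monomial d (coeff d G) - C f * ∑ k, C (a d k) * X k * monomial d 1 =
        ∑ k, (C (a d k) * monomial d 1) * (C (x k) - C f * X k) := by
      have h1 : monomial d (coeff d G) = C (coeff d G) * monomial d (1 : B) := by
        rw [C_mul_monomial, mul_one]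
      rw [h1, ← ha d, map_sum, Finset.sum_mul, Finset.mul_sum, ← Finset.sum_sub_distrib]
      refine Finset.sum_congr rfl fun k _ ↦ ?_
      rw [C_mul]
      ring
    rw [this]
    exact Ideal.sum_mem _ fun k _ ↦ Ideal.mul_mem_left _ _ (ratioIdeal_sub_mem x f k)

variable {B ι : Type*} [CommRing B] [IsLocalRing B] [IsNoetherianRing B] [Fintype ι]

/-- The maximal ideal of a regular local ring is of linear type. -/
lemma mem_ratioIdeal_of_eval_eq_zero (x : ι → B)
    (hx : Ideal.span (Set.range x) = maximalIdeal B)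
    (hd : (Fintype.card ι : ℕ∞) ≤ (maximalIdeal B).height) (f : B) {n : ℕ} {G : MvPolynomial ι B}
    (hG : G.IsHomogeneous n) (h0 : eval x G = 0) : G ∈ ratioIdeal x f := by
  have hstep (i : ℕ) : ∃ G' : MvPolynomial ι B, G'.IsHomogeneous (n + i) ∧ eval x G' = 0 ∧
      G - C f ^ i * G' ∈ ratioIdeal x f := by
    induction i with
    | zero => exact ⟨G, hG, h0, by simp⟩
    | succ i ih =>
      obtain ⟨G', hG', h0', hm⟩ := ih
      obtain ⟨G'', hG'', h0'', hm'⟩ := exists_sub_C_mul_mem_ratioIdeal x f hG'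
        (fun d ↦ by rw [hx]; exact coeff_mem_maximalIdeal x hx hd hG' h0' d)
      refine ⟨G'', hG'', h0''.trans h0', ?_⟩
      convert add_mem hm (Ideal.mul_mem_left _ (C f ^ i) hm') using 1
      ring
  -- By `hstep`, `G` is congruent to `f ^ i G'` for every `i`, where `G'` vanishes at `x` and is
  -- therefore killed by a power of `f`. The ideals of elements killed by `f ^ k` modulo the
  -- relations stabilize at some `c`; then `f ^ c` already kills the `G'` of step `c`, and `G` is
  -- zero.
  let I : ℕ →o Ideal (MvPolynomial ι B) :=
    ⟨fun k ↦ Submodule.comap (LinearMap.mulLeft (MvPolynomial ι B) (C f ^ k)) (ratioIdeal x f), by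
      intro k l hkl F hF
      simp only [Submodule.mem_comap, LinearMap.mulLeft_apply] at hF ⊢
      obtain ⟨m, rfl⟩ := Nat.exists_eq_add_of_le hkl
      rw [pow_add, mul_right_comm]
      exact Ideal.mul_mem_right _ _ hF⟩
  obtain ⟨c, hc⟩ := monotone_stabilizes_iff_noetherian.mpr
    (inferInstanceAs (IsNoetherian (MvPolynomial ι B) (MvPolynomial ι B))) I
  obtain ⟨G', hG', h0', hm⟩ := hstep c
  have h1 : G' ∈ I (n + c + c) := by
    have := C_pow_mul_sub_mem_ratioIdeal x f hG'
    rw [h0', C_0, sub_zero] at this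
    change C f ^ (n + c + c) * G' ∈ ratioIdeal x f
    rw [pow_add, mul_right_comm]
    exact Ideal.mul_mem_right _ _ this
  rw [← hc (n + c + c) (by omega)] at h1
  have h2 : C f ^ c * G' ∈ ratioIdeal x f := h1
  simpa using add_mem hm h2

/-- In a hypersurface of multiplicity `μ`, the `f`-power torsion of the algebra of the relations
`y j = f T j` is killed by `f ^ μ`. -/
lemma C_pow_mul_mem_ratioIdeal_of_surjective (x : ι → B)
    (hx : Ideal.span (Set.range x) = maximalIdeal B)
    (hd : (Fintype.card ι : ℕ∞) ≤ (maximalIdeal B).height)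
    {A J : Type*} [CommRing A] (θ : B →+* A) (hθ : Function.Surjective θ) {h : B}
    (hker : RingHom.ker θ = Ideal.span {h}) {μ : ℕ} (hμ : μ ≠ 0)
    (h1 : h ∈ maximalIdeal B ^ μ) (h2 : h ∉ maximalIdeal B ^ (μ + 1))
    (y : J → A) (hy : Ideal.span (Set.range y) = (maximalIdeal B).map θ) {f : A}
    (hf : f ∈ (maximalIdeal B).map θ) {k : ℕ} {F : MvPolynomial J A}
    (hF : C f ^ k * F ∈ ratioIdeal y f) : C f ^ μ * F ∈ ratioIdeal y f := by
  obtain ⟨f, hfm, rfl⟩ := (Ideal.mem_map_iff_of_surjective θ hθ).mp hf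
  let mk := Ideal.Quotient.mk (ratioIdeal y (θ f))
  let φ : B →+* MvPolynomial J A ⧸ ratioIdeal y (θ f) := (mk.comp C).comp θ
  have hX (j : J) : mk (C (y j)) = mk (C (θ f)) * mk (X j) := by
    rw [← map_mul]
    exact Ideal.Quotient.eq.mpr (ratioIdeal_sub_mem y (θ f) j)
  have ht (i : ι) : ∃ t, φ f * t = φ (x i) := by
    have hxi : θ (x i) ∈ Ideal.span (Set.range y) := by
      rw [hy]
      exact Ideal.mem_map_of_mem _ (hx ▸ Ideal.subset_span ⟨i, rfl⟩)
    suffices ∀ z ∈ Ideal.span (Set.range y), mk (C (θ f)) ∣ mk (C z) by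
      obtain ⟨t, ht⟩ := this _ hxi
      exact ⟨t, ht.symm⟩
    intro z hz
    have hle : Ideal.span (Set.range y) ≤
        (Ideal.span {mk (C (θ f))}).comap (mk.comp C) := by
      rw [Ideal.span_le]
      rintro _ ⟨j, rfl⟩
      exact Ideal.mem_span_singleton.mpr ⟨_, hX j⟩
    exact Ideal.mem_span_singleton.mp (hle hz)
  choose t ht using ht
  -- The `y j` and the images of the parameters generate the same ideal, so `x i / f` has some
  -- representative `t i` in the quotient; its choice is immaterial after multiplication by `f`.
  let β : MvPolynomial ι B →+* MvPolynomial J A ⧸ ratioIdeal y (θ f) := eval₂Hom φ t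
  have hβC (b : B) : β (C b) = φ b := eval₂Hom_C _ _ _
  have hβ {G : MvPolynomial ι B} (hG : G ∈ ratioIdeal x f) : β G = 0 := by
    suffices ratioIdeal x f ≤ RingHom.ker β from this hG
    rw [ratioIdeal, Ideal.span_le]
    rintro _ ⟨i, rfl⟩
    simp [β, RingHom.mem_ker, ht]
  have hβh {n : ℕ} {G : MvPolynomial ι B} (hG : G.IsHomogeneous n) :
      φ f ^ n * β G = φ (eval x G) := by
    have := hβ (C_pow_mul_sub_mem_ratioIdeal x f hG)
    rwa [map_sub, sub_eq_zero, map_mul, map_pow, hβC, hβC] at this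
  -- A linear form with value `f` at `x`: its image acts as `1` on multiples of `f`. Powers of `L`
  -- thus raise degrees at no cost, which is what lets `hrep` represent any `F` by a form.
  obtain ⟨L, hL, hLf⟩ := (Ideal.mem_span_iff_exists_isHomogeneous x f).mp (by rwa [hx])
  have hL1 (i : ℕ) : φ f * β L ^ i = φ f := by
    induction i with
    | zero => simp
    | succ i ih =>
      have := hβh hL
      rw [pow_one, hLf] at this
      rw [pow_succ', ← mul_assoc, this, ih]
  have hrep (F : MvPolynomial J A) : ∃ (n : ℕ) (G : MvPolynomial ι B), G.IsHomogeneous n ∧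
      φ f * mk F = φ f * β G := by
    induction F using MvPolynomial.induction_on with
    | C a =>
      obtain ⟨b, rfl⟩ := hθ a
      exact ⟨0, C b, isHomogeneous_C _ _, by rw [hβC]; rfl⟩
    | add F₁ F₂ ih₁ ih₂ =>
      obtain ⟨n₁, G₁, hG₁, e₁⟩ := ih₁
      obtain ⟨n₂, G₂, hG₂, e₂⟩ := ih₂
      refine ⟨n₁ + n₂, G₁ * L ^ n₂ + G₂ * L ^ n₁, ?_, ?_⟩
      · refine IsHomogeneous.add ?_ ?_
        · simpa using hG₁.mul (hL.pow n₂)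
        · rw [add_comm]; simpa using hG₂.mul (hL.pow n₁)
      · rw [map_add, mul_add, e₁, e₂, map_add, map_mul, map_mul, map_pow, map_pow,
          mul_add, mul_left_comm, mul_left_comm (φ f) (β G₂), hL1, hL1]
        ring
    | mul_X F j ih =>
      obtain ⟨n, G, hG, e⟩ := ih
      have hyj : y j ∈ (maximalIdeal B).map θ := hy ▸ Ideal.subset_span ⟨j, rfl⟩
      obtain ⟨b, hb, hbj⟩ := (Ideal.mem_map_iff_of_surjective θ hθ).mp hyj
      obtain ⟨S, hS, hSb⟩ := (Ideal.mem_span_iff_exists_isHomogeneous x b).mp (by rwa [hx])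
      refine ⟨n + 1, G * S, hG.mul hS, ?_⟩
      have h3 : φ f * β S = φ f * mk (X j) := by
        have := hβh hS
        rw [pow_one, hSb] at this
        rw [this]
        change mk (C (θ b)) = _
        rw [hbj, hX]
        rfl
      rw [map_mul, map_mul, ← mul_assoc, e, mul_left_comm, h3]
      ring
  obtain ⟨n, G, hG, hFG⟩ := hrep F
  have hFpow (i : ℕ) (hi : i ≠ 0) : φ f ^ i * mk F = φ f ^ i * β G := by
    obtain ⟨i, rfl⟩ := Nat.exists_eq_succ_of_ne_zero hi
    rw [Nat.succ_eq_add_one, pow_succ, mul_assoc, hFG, mul_assoc]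
  have hφf : mk (C (θ f)) = φ f := rfl
  have hFk : φ f ^ k * mk F = 0 := by
    rw [← hφf, ← map_pow, ← map_mul]
    exact Ideal.Quotient.eq_zero_iff_mem.mpr hF
  -- compare with the localization away from `f`
  obtain ⟨s, hs⟩ : ∃ s : ℕ, θ (f ^ s * eval x G) = 0 := by
    let E := Localization.Away (θ f)
    let ev : MvPolynomial J A →+* E :=
      eval₂Hom (algebraMap A E) fun j ↦ algebraMap A E (y j) * IsLocalization.Away.invSelf (θ f)
    have hinv : algebraMap A E (θ f) * IsLocalization.Away.invSelf (θ f) = 1 :=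
      IsLocalization.Away.mul_invSelf (θ f)
    have hev : ∀ F ∈ ratioIdeal y (θ f), ev F = 0 := by
      suffices ratioIdeal y (θ f) ≤ RingHom.ker ev from fun F hF ↦ this hF
      rw [ratioIdeal, Ideal.span_le]
      rintro _ ⟨j, rfl⟩
      simp only [SetLike.mem_coe, RingHom.mem_ker, map_sub, map_mul, ev, eval₂Hom_C,
        coe_eval₂Hom, eval₂_X]
      rw [mul_left_comm, hinv, mul_one, sub_self]
    have h4 : φ (f ^ (k + 1) * eval x G) = 0 := by
      rw [map_mul, ← hβh hG, map_pow, mul_left_comm, ← hFpow _ (by omega), pow_succ', mul_assoc,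
        hFk, mul_zero, mul_zero]
    have h5 := hev _ (Ideal.Quotient.eq_zero_iff_mem.mp h4)
    rw [eval₂Hom_C] at h5
    obtain ⟨⟨_, i, rfl⟩, hc⟩ := (IsLocalization.map_eq_zero_iff (Submonoid.powers (θ f)) E _).mp h5
    refine ⟨i + (k + 1), ?_⟩
    rw [pow_add, mul_assoc, map_mul, map_pow]
    exact hc
  -- The additional factor `f ^ μ` makes the order of this element at least `μ + (s + n)`, so its
  -- cofactor `u` with respect to `h` has order at least `s + n`, with no case distinction on `s + n
  -- < μ`.
  have hs' : θ (f ^ (s + μ) * eval x G) = 0 := by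
    rw [add_comm, pow_add, mul_assoc, map_mul, hs, mul_zero]
  obtain ⟨u, hu⟩ := Ideal.mem_span_singleton.mp (hker ▸ (RingHom.mem_ker.mpr hs'))
  have hum : u ∈ maximalIdeal B ^ (s + n) := by
    refine mem_pow_of_mul_mem_pow x hx hd h1 h2 ?_
    rw [← hu, show μ + (s + n) = (s + μ) + n by ring, pow_add]
    refine Ideal.mul_mem_mul (Ideal.pow_mem_pow hfm _) ?_
    rw [← hx]
    exact (Ideal.mem_span_pow_iff_exists_isHomogeneous x _).mpr ⟨G, hG, rfl⟩
  obtain ⟨H, hH, hHh⟩ := (Ideal.mem_span_pow_iff_exists_isHomogeneous x h).mp (by rwa [hx])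
  obtain ⟨U, hU, hUu⟩ := (Ideal.mem_span_pow_iff_exists_isHomogeneous x u).mp (by rwa [hx])
  -- Both products have degree `s + μ + n` and the same value at `x`, so linear type makes them
  -- congruent. Then `f ^ μ G` becomes `f ^ μ H U = h U`, and `h` is zero in `A`.
  have h6 : L ^ (s + μ) * G - H * U ∈ ratioIdeal x f := by
    refine mem_ratioIdeal_of_eval_eq_zero x hx hd f (n := (s + μ) + n) (IsHomogeneous.sub ?_ ?_) ?_
    · simpa using (hL.pow (s + μ)).mul hG
    · convert hH.mul hU using 1
      ring
    · rw [map_sub, map_mul, map_mul, map_pow, hLf, hu, hHh, hUu, sub_self]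
  have h7 := hβ h6
  rw [map_sub, sub_eq_zero, map_mul, map_mul, map_pow] at h7
  rw [← Ideal.Quotient.eq_zero_iff_mem]
  change mk (C (θ f) ^ μ * F) = 0
  rw [map_mul, map_pow, hφf, hFpow μ hμ]
  obtain ⟨ν, rfl⟩ := Nat.exists_eq_succ_of_ne_zero hμ
  have h8 : φ h = 0 := by
    have : θ h = 0 := RingHom.mem_ker.mp (hker ▸ Ideal.mem_span_singleton_self h)
    change mk (C (θ h)) = 0
    rw [this, map_zero, map_zero]
  calc φ f ^ (ν + 1) * β G = φ f ^ ν * (φ f * β L ^ (s + (ν + 1))) * β G := by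
        rw [hL1, pow_succ]
    _ = φ f ^ (ν + 1) * (β L ^ (s + (ν + 1)) * β G) := by ring
    _ = φ f ^ (ν + 1) * β H * β U := by rw [h7, mul_assoc]
    _ = 0 := by rw [hβh hH, hHh, h8, zero_mul]

lemma exists_parameters (B : Type u) [CommRing B] [IsRegularLocalRing B] :
    ∃ (ι : Type u) (_ : Fintype ι) (x : ι → B), Ideal.span (Set.range x) = maximalIdeal B ∧
      (Fintype.card ι : ℕ∞) ≤ (maximalIdeal B).height := by
  have hfg := (maximalIdeal B).fg_of_isNoetherianRing
  have := (Submodule.FG.finite_generators hfg).fintype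
  refine ⟨(maximalIdeal B).generators, this, Subtype.val, ?_, ?_⟩
  · rw [Subtype.range_coe]
    exact (maximalIdeal B).span_generators
  · have h1 := Submodule.FG.generators_ncard hfg
    rw [Set.ncard_eq_toFinset_card', Set.toFinset_card] at h1
    have h2 := IsRegularLocalRing.spanFinrank_maximalIdeal (R := B)
    rw [← h1, ← maximalIdeal_height_eq_ringKrullDim] at h2
    exact (WithBot.coe_inj.mp h2).le

/-- A local ring that is the quotient of a regular local ring by an element of order `μ ≥ 1`. -/
structure IsHypersurfaceOfOrder (A : Type u) [CommRing A] [IsLocalRing A] (μ : ℕ) : Prop where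
  ne_zero : μ ≠ 0
  exists_presentation : ∃ (B : Type u) (_ : CommRing B) (_ : IsRegularLocalRing B) (θ : B →+* A)
    (h : B), Function.Surjective θ ∧ RingHom.ker θ = Ideal.span {h} ∧
      h ∈ maximalIdeal B ^ μ ∧ h ∉ maximalIdeal B ^ (μ + 1)

/-- An element outside the maximal ideal `m` is a unit modulo `m ^ j`. This is how statements about
the local ring at `q` are brought back to an affine neighbourhood. -/
lemma exists_mul_add_eq_one {A : Type*} [CommRing A] {m : Ideal A} [hm : m.IsMaximal]
    {s : A} (hs : s ∉ m) (j : ℕ) : ∃ d, ∃ c ∈ m ^ j, d * s + c = 1 := by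
  obtain ⟨t, z, hz, htz⟩ := hm.exists_inv hs
  have h1 : Ideal.span {s} ⊔ m = ⊤ := by
    rw [Ideal.eq_top_iff_one, ← htz]
    exact add_mem (Ideal.mem_sup_left (Ideal.mul_mem_left _ _ (Ideal.mem_span_singleton_self s)))
      (Ideal.mem_sup_right hz)
  have h2 : Ideal.span {s} ⊔ m ^ j = ⊤ := Ideal.sup_pow_eq_top h1
  obtain ⟨b, hb, c, hc, hbc⟩ := Submodule.mem_sup.mp ((Ideal.eq_top_iff_one _).mp h2)
  obtain ⟨d, rfl⟩ := Ideal.mem_span_singleton'.mp hb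
  exact ⟨d, c, hc, hbc⟩

lemma mem_pow_of_mul_mem_pow_of_isMaximal {A : Type*} [CommRing A] {m : Ideal A} [m.IsMaximal]
    {s a : A} (hs : s ∉ m) {j : ℕ} (h : s * a ∈ m ^ j) : a ∈ m ^ j := by
  obtain ⟨d, c, hc, hbc⟩ := exists_mul_add_eq_one hs j
  have : a = d * (s * a) + c * a := by linear_combination (-a) * hbc
  rw [this]
  exact add_mem (Ideal.mul_mem_left _ _ h) (Ideal.mul_mem_right _ _ hc)

/-- The local computation holds up to a denominator `s ∉ m`. It is removed by `d s + c = 1` with `c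
∈ m ^ (1 + k)`: modulo the relations `m` lies in `(f)`, so `c` is a multiple of `f ^ k`, which kills
`F`. -/
lemma IsHypersurfaceOfOrder.C_pow_mul_mem_ratioIdeal {A : Type u} [CommRing A] (m : Ideal A)
    [m.IsMaximal] (Am : Type u) [CommRing Am] [IsLocalRing Am] [Algebra A Am]
    [IsLocalization.AtPrime Am m] {μ : ℕ} (H : IsHypersurfaceOfOrder Am μ) {J : Type*} (y : J → A)
    (hy : Ideal.span (Set.range y) = m) {f : A} (hf : f ∈ m) {k : ℕ} {F : MvPolynomial J A}
    (hF : C f ^ k * F ∈ ratioIdeal y f) : C f ^ μ * F ∈ ratioIdeal y f := by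
  obtain ⟨hμ, B, _, _, θ, h, hθ, hker, h1, h2⟩ := H
  obtain ⟨ι, _, x, hx, hd⟩ := exists_parameters B
  have hmap : (maximalIdeal B).map θ = maximalIdeal Am := by
    rcases Ideal.map_eq_top_or_isMaximal_of_surjective θ hθ (maximalIdeal.isMaximal B) with h3 | h3
    · exfalso
      obtain ⟨b, hb, hb1⟩ :=
        (Ideal.mem_map_iff_of_surjective θ hθ).mp ((Ideal.eq_top_iff_one _).mp h3)
      have h4 : 1 - b ∈ Ideal.span {h} := by
        rw [← hker, RingHom.mem_ker, map_sub, hb1, map_one, sub_self]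
      have h5 : Ideal.span {h} ≤ maximalIdeal B := by
        rw [Ideal.span_singleton_le_iff_mem]
        exact Ideal.pow_le_self hμ h1
      have h6 := add_mem (h5 h4) hb
      rw [sub_add_cancel] at h6
      exact (Ideal.ne_top_iff_one _).mp (maximalIdeal.isMaximal B).ne_top h6
    · exact IsLocalRing.eq_maximalIdeal h3
  have hmAm : m.map (algebraMap A Am) = maximalIdeal Am :=
    IsLocalization.AtPrime.map_eq_maximalIdeal m Am
  have hloc := C_pow_mul_mem_ratioIdeal_of_surjective x hx hd θ hθ hker hμ h1 h2
    (fun j ↦ algebraMap A Am (y j))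
    (by rw [hmap, ← hmAm, ← hy, Ideal.map_span, ← Set.range_comp]; rfl)
    (f := algebraMap A Am f) (by rw [hmap, ← hmAm]; exact Ideal.mem_map_of_mem _ hf) (k := k)
    (F := MvPolynomial.map (algebraMap A Am) F) (by
      have := Ideal.mem_map_of_mem (MvPolynomial.map (algebraMap A Am)) hF
      rwa [map_ratioIdeal, map_mul, map_pow, map_C] at this)
  -- clear denominators
  obtain ⟨s, hs, hsF⟩ : ∃ s ∉ m, C s * (C f ^ μ * F) ∈ ratioIdeal y f := by
    let _ : Algebra (MvPolynomial J A) (MvPolynomial J Am) := algebraMvPolynomial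
    have h3 : algebraMap (MvPolynomial J A) (MvPolynomial J Am) (C f ^ μ * F) ∈
        (ratioIdeal y f).map (algebraMap (MvPolynomial J A) (MvPolynomial J Am)) := by
      rw [MvPolynomial.algebraMap_def, map_ratioIdeal, map_mul, map_pow, map_C]
      exact hloc
    have := MvPolynomial.isLocalization (σ := J) m.primeCompl Am
    rw [IsLocalization.algebraMap_mem_map_algebraMap_iff (m.primeCompl.map C)] at h3
    obtain ⟨_, ⟨s, hs, rfl⟩, h4⟩ := h3
    exact ⟨s, hs, h4⟩
  -- The exponent `1 + k` fits the inclusion of `(I + J) ^ (1 + k)` in `I + J ^ k`, with `I` the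
  -- ideal of relations and `J = (f)`.
  obtain ⟨d, c, hc, hdc⟩ := exists_mul_add_eq_one hs (1 + k)
  have h3 : (C c : MvPolynomial J A) ∈ ratioIdeal y f ⊔ Ideal.span {C f} ^ k := by
    have h4 : m.map C ≤ ratioIdeal y f ⊔ Ideal.span {C f} := by
      rw [← hy, Ideal.map_span, Ideal.span_le]
      rintro _ ⟨_, ⟨j, rfl⟩, rfl⟩
      have : (C (y j) : MvPolynomial J A) = (C (y j) - C f * X j) + C f * X j := by ring
      rw [this]
      exact add_mem (Ideal.mem_sup_left (ratioIdeal_sub_mem _ _ _)) (Ideal.mem_sup_right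
        (Ideal.mul_mem_right _ _ (Ideal.mem_span_singleton_self _)))
    have h5 := Ideal.pow_right_mono h4 (1 + k)
      (Ideal.map_pow (C : A →+* MvPolynomial J A) m (1 + k) ▸ Ideal.mem_map_of_mem C hc)
    simpa using Ideal.sup_pow_add_le_pow_sup_pow h5
  rw [Ideal.span_singleton_pow] at h3
  obtain ⟨b, hb, c', hc', hbc⟩ := Submodule.mem_sup.mp h3
  obtain ⟨e, rfl⟩ := Ideal.mem_span_singleton.mp hc'
  have h6 : C f ^ μ * F = C d * (C s * (C f ^ μ * F)) + b * (C f ^ μ * F) +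
      (e * C f ^ μ) * (C f ^ k * F) := by
    have h7 : (C d * C s + C c : MvPolynomial J A) = 1 := by
      rw [← C_mul, ← C_add, hdc, C_1]
    rw [← hbc] at h7
    linear_combination (-(C f ^ μ * F)) * h7
  rw [h6]
  exact add_mem (add_mem (Ideal.mul_mem_left _ _ hsF) (Ideal.mul_mem_right _ _ hb))
    (Ideal.mul_mem_left _ _ hF)

end Torsion

/-! ### Affine blow-up algebras and their truncations. -/

section Chart

variable {A : Type u} [CommRing A] (m : Ideal A) (f : A)

/-- The affine blow-up algebra `A[m / f]`, as a subalgebra of `A[1 / f]`. -/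
def blowUpAlgebra : Subalgebra A (Localization.Away f) :=
  Algebra.adjoin A {z | ∃ a ∈ m, algebraMap A (Localization.Away f) f * z = algebraMap A _ a}

namespace blowUpAlgebra

variable {m}

lemma exists_frac {a : A} (ha : a ∈ m) :
    ∃ z : blowUpAlgebra m f, algebraMap A _ f * z = algebraMap A _ a := by
  let E := Localization.Away f
  have h1 : algebraMap A E f * (algebraMap A E a * IsLocalization.Away.invSelf f) =
      algebraMap A E a := by
    rw [mul_left_comm, IsLocalization.Away.mul_invSelf, mul_one]
  exact ⟨⟨algebraMap A E a * IsLocalization.Away.invSelf f,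
    Algebra.subset_adjoin ⟨a, ha, h1⟩⟩, Subtype.ext h1⟩

/-- The element `a / f` of `A[m / f]`, for `a ∈ m`. -/
def frac {a : A} (ha : a ∈ m) : blowUpAlgebra m f := (exists_frac f ha).choose

lemma mul_frac {a : A} (ha : a ∈ m) :
    algebraMap A (blowUpAlgebra m f) f * frac f ha = algebraMap A _ a :=
  (exists_frac f ha).choose_spec

lemma algebraMap_mem_nonZeroDivisors :
    algebraMap A (blowUpAlgebra m f) f ∈ nonZeroDivisors (blowUpAlgebra m f) := by
  rw [mem_nonZeroDivisors_iff_right]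
  intro z hz
  have h1 : (z : Localization.Away f) * algebraMap A _ f = 0 := congr_arg Subtype.val hz
  refine Subtype.ext ?_
  exact (IsLocalization.Away.algebraMap_isUnit (S := Localization.Away f) f).mul_left_eq_zero.mp h1

lemma isUnit_algebraMap_mul_cancel {z w : blowUpAlgebra m f}
    (h : algebraMap A (blowUpAlgebra m f) f * z = algebraMap A _ f * w) : z = w :=
  (mul_cancel_left_mem_nonZeroDivisors (algebraMap_mem_nonZeroDivisors f)).mp h

lemma map_eq_span (hf : f ∈ m) :
    m.map (algebraMap A (blowUpAlgebra m f)) = Ideal.span {algebraMap A _ f} := by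
  refine le_antisymm ?_ ?_
  · rw [Ideal.map_le_iff_le_comap]
    intro a ha
    exact Ideal.mem_span_singleton.mpr ⟨_, (mul_frac f ha).symm⟩
  · rw [Ideal.span_singleton_le_iff_mem]
    exact Ideal.mem_map_of_mem _ hf

lemma induction {P : blowUpAlgebra m f → Prop} (halg : ∀ a, P (algebraMap A _ a))
    (hfrac : ∀ a (ha : a ∈ m), P (frac f ha)) (hadd : ∀ z w, P z → P w → P (z + w))
    (hmul : ∀ z w, P z → P w → P (z * w)) (z : blowUpAlgebra m f) : P z := by
  obtain ⟨z, hz⟩ := z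
  induction hz using Algebra.adjoin_induction with
  | mem z hz =>
    obtain ⟨a, ha, haz⟩ := hz
    convert hfrac a ha using 1
    refine isUnit_algebraMap_mul_cancel f ?_
    rw [mul_frac]
    exact Subtype.ext haz
  | algebraMap a => exact halg a
  | add z w _ _ hz hw => exact hadd _ _ hz hw
  | mul z w _ _ hz hw => exact hmul _ _ hz hw

lemma hom_ext {D : Type*} [CommRing D] {φ ψ : blowUpAlgebra m f →+* D}
    (h : ∀ a, φ (algebraMap A _ a) = ψ (algebraMap A _ a))
    (h' : ∀ a (ha : a ∈ m), φ (frac f ha) = ψ (frac f ha)) : φ = ψ := by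
  ext z
  induction z using induction with
  | halg a => exact h a
  | hfrac a ha => exact h' a ha
  | hadd z w hz hw => rw [map_add, map_add, hz, hw]
  | hmul z w hz hw => rw [map_mul, map_mul, hz, hw]

/-- The universal property of `A[m / f]`. -/
lemma exists_lift {D : Type*} [CommRing D] (g : A →+* D) (hg : g f ∈ nonZeroDivisors D)
    (hm : ∀ a ∈ m, g f ∣ g a) :
    ∃ φ : blowUpAlgebra m f →+* D, ∀ a, φ (algebraMap A _ a) = g a := by
  let E := Localization.Away (g f)
  have hinj : Function.Injective (algebraMap D E) :=
    IsLocalization.injective E (Submonoid.powers_le.mpr hg)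
  let ψ : Localization.Away f →+* E := IsLocalization.Away.map (Localization.Away f) E g f
  have hψ (a : A) : ψ (algebraMap A _ a) = algebraMap D E (g a) := by
    simp [ψ, IsLocalization.Away.map]
  let χ : blowUpAlgebra m f →+* E := ψ.comp (blowUpAlgebra m f).val.toRingHom
  have hχ (a : A) : χ (algebraMap A _ a) = algebraMap D E (g a) := hψ a
  have hran (z) : χ z ∈ (algebraMap D E).range := by
    induction z using induction with
    | halg a => exact ⟨g a, (hχ a).symm⟩
    | hfrac a ha =>
      obtain ⟨d, hd⟩ := hm a ha
      refine ⟨d, ?_⟩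
      refine (IsLocalization.Away.algebraMap_isUnit (S := E) (g f)).mul_left_cancel ?_
      rw [← map_mul, ← hd, ← hχ, ← hχ, ← map_mul, mul_frac]
    | hadd z w hz hw => rw [map_add]; exact add_mem hz hw
    | hmul z w hz hw => rw [map_mul]; exact mul_mem hz hw
  choose φ hφ using hran
  refine ⟨{ toFun := φ, map_one' := ?_, map_zero' := ?_, map_add' := ?_, map_mul' := ?_ }, ?_⟩
  · exact hinj (by rw [hφ, map_one, map_one])
  · intro z w; exact hinj (by rw [hφ, map_mul, map_mul, hφ, hφ])
  · exact hinj (by rw [hφ, map_zero, map_zero])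
  · intro z w; exact hinj (by rw [hφ, map_add, map_add, hφ, hφ])
  · intro a; exact hinj ((hφ _).trans (hχ a))

end blowUpAlgebra

open MvPolynomial

variable {m} {J : Type*} (x : J → A)

/-- The ideal presenting the truncation of an affine blow-up algebra. -/
def chartIdeal (𝔞 : Ideal A) (j : ℕ) : Ideal (MvPolynomial J A) :=
  Submodule.comap (LinearMap.mulLeft (MvPolynomial J A) (C f ^ j)) (ratioIdeal x f) ⊔ 𝔞.map C

/-- The evaluation `T j ↦ x j / f`. -/
def ratioEval (hx : ∀ j, x j ∈ m) : MvPolynomial J A →ₐ[A] blowUpAlgebra m f :=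
  aeval fun j ↦ blowUpAlgebra.frac f (hx j)

lemma ratioEval_eq_zero (hx : ∀ j, x j ∈ m) {F : MvPolynomial J A} (hF : F ∈ ratioIdeal x f) :
    ratioEval f x hx F = 0 := by
  suffices ratioIdeal x f ≤ RingHom.ker (ratioEval f x hx) from this hF
  rw [ratioIdeal, Ideal.span_le]
  rintro _ ⟨j, rfl⟩
  simp [ratioEval, RingHom.mem_ker, blowUpAlgebra.mul_frac, algHom_C]

lemma ratioEval_surjective (hx : Ideal.span (Set.range x) = m) (hx' : ∀ j, x j ∈ m) :
    Function.Surjective (ratioEval f x hx') := by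
  intro z
  induction z using blowUpAlgebra.induction with
  | halg a => exact ⟨C a, algHom_C _ _⟩
  | hfrac a ha =>
    have h1 : ∀ a ∈ m, ∃ F, algebraMap A (blowUpAlgebra m f) f * ratioEval f x hx' F =
        algebraMap A _ a := by
      intro a ha
      rw [← hx] at ha
      induction ha using Submodule.span_induction with
      | mem _ h =>
        obtain ⟨j, rfl⟩ := h
        exact ⟨X j, by rw [ratioEval, aeval_X, blowUpAlgebra.mul_frac]⟩
      | zero => exact ⟨0, by simp⟩
      | add a b _ _ ha hb =>
        obtain ⟨F, hF⟩ := ha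
        obtain ⟨G, hG⟩ := hb
        exact ⟨F + G, by rw [map_add, map_add, mul_add, hF, hG]⟩
      | smul c a _ ha =>
        obtain ⟨F, hF⟩ := ha
        exact ⟨C c * F, by rw [map_mul, algHom_C, mul_left_comm, hF, smul_eq_mul, map_mul]⟩
    obtain ⟨F, hF⟩ := h1 a ha
    exact ⟨F, blowUpAlgebra.isUnit_algebraMap_mul_cancel f (by rw [hF, blowUpAlgebra.mul_frac])⟩
  | hadd z w hz hw =>
    obtain ⟨F, rfl⟩ := hz
    obtain ⟨G, rfl⟩ := hw
    exact ⟨F + G, map_add _ _ _⟩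
  | hmul z w hz hw =>
    obtain ⟨F, rfl⟩ := hz
    obtain ⟨G, rfl⟩ := hw
    exact ⟨F * G, map_mul _ _ _⟩

lemma exists_C_pow_mul_sub_C_mem_ratioIdeal (F : MvPolynomial J A) :
    ∃ (n : ℕ) (a : A), C f ^ n * F - C a ∈ ratioIdeal x f := by
  induction F using MvPolynomial.induction_on with
  | C a => exact ⟨0, a, by simp⟩
  | add F G hF hG =>
    obtain ⟨n, a, hF⟩ := hF
    obtain ⟨k, b, hG⟩ := hG
    refine ⟨n + k, f ^ k * a + f ^ n * b, ?_⟩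
    convert add_mem (Ideal.mul_mem_left _ (C f ^ k) hF) (Ideal.mul_mem_left _ (C f ^ n) hG) using 1
    simp only [map_add, map_mul, map_pow]
    ring
  | mul_X F j hF =>
    obtain ⟨n, a, hF⟩ := hF
    refine ⟨n + 1, a * x j, ?_⟩
    convert sub_mem (Ideal.mul_mem_left _ (C f * X j) hF)
      (Ideal.mul_mem_left _ (C a) (ratioIdeal_sub_mem x f j)) using 1
    simp only [map_mul]
    ring

/-- Clearing denominators makes `f ^ n F` congruent to a constant; the constant dies in `A[1/f]`, so
a power of `f` kills it. With `ratioEval_eq_zero` this identifies the kernel of `T j ↦ x j / f` with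
the `f`-power torsion modulo the relations. -/
lemma exists_C_pow_mul_mem_ratioIdeal (hx : ∀ j, x j ∈ m) {F : MvPolynomial J A}
    (hF : ratioEval f x hx F = 0) : ∃ k : ℕ, C f ^ k * F ∈ ratioIdeal x f := by
  obtain ⟨n, a, ha⟩ := exists_C_pow_mul_sub_C_mem_ratioIdeal f x F
  have h1 := ratioEval_eq_zero f x hx ha
  rw [map_sub, map_mul, hF, mul_zero, zero_sub, neg_eq_zero, algHom_C] at h1
  have h2 : algebraMap A (Localization.Away f) a = 0 := congr_arg Subtype.val h1
  obtain ⟨⟨_, i, rfl⟩, hc⟩ := (IsLocalization.map_eq_zero_iff (Submonoid.powers f) _ _).mp h2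
  refine ⟨i + n, ?_⟩
  convert Ideal.mul_mem_left _ (C f ^ i) ha using 1
  have h3 : (C f ^ i * C a : MvPolynomial J A) = 0 := by
    rw [← C_pow, ← C_mul]
    rw [show f ^ i * a = 0 from hc, C_0]
  rw [mul_sub, h3, pow_add, mul_assoc, sub_zero]

/-- The truncation of an affine blow-up algebra depends only on a truncation of `A`. -/
lemma exists_chartIdeal_quotient_equiv {C' : Type*} [CommRing C'] (κ : A →+* C')
    (hκ : Function.Surjective κ) (hx : Ideal.span (Set.range x) = m) (hx' : ∀ j, x j ∈ m)
    {π : A} {n l j : ℕ} (hker : RingHom.ker κ = Ideal.span {π ^ (n + l)}) (hπ : π ^ l ∈ m ^ j)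
    (htors : ∀ (F : MvPolynomial J A) (k : ℕ), C f ^ k * F ∈ ratioIdeal x f →
      C f ^ j * F ∈ ratioIdeal x f)
    (hf : f ∈ m) {𝔞 : Ideal C'} (h𝔞 : 𝔞 = Ideal.span {κ (π ^ n)}) :
    ∃ e : (MvPolynomial J C' ⧸ chartIdeal (κ f) (fun i ↦ κ (x i)) 𝔞 j) ≃+*
        (blowUpAlgebra m f ⧸ Ideal.span {algebraMap A (blowUpAlgebra m f) (π ^ n)}),
      ∀ F, e (Ideal.Quotient.mk _ (MvPolynomial.map κ F)) =
        Ideal.Quotient.mk _ (ratioEval f x hx' F) := by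
  let ev : MvPolynomial J A →+* blowUpAlgebra m f := (ratioEval f x hx').toRingHom
  have hevC (a : A) : ev (C a) = algebraMap A _ a := algHom_C _ _
  have hevs : Function.Surjective ev := ratioEval_surjective f x hx hx'
  have hev0 {F} (hF : F ∈ ratioIdeal x f) : ev F = 0 := ratioEval_eq_zero f x hx' hF
  let ψ₁ : MvPolynomial J A →+* _ := (Ideal.Quotient.mk
    (chartIdeal (κ f) (fun i ↦ κ (x i)) 𝔞 j)).comp (MvPolynomial.map κ)
  let ψ₂ : MvPolynomial J A →+* _ := (Ideal.Quotient.mk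
    (Ideal.span {algebraMap A (blowUpAlgebra m f) (π ^ n)})).comp ev
  have hmaps : Function.Surjective (MvPolynomial.map (σ := J) κ) := map_surjective κ hκ
  have hψ₁ : Function.Surjective ψ₁ := Ideal.Quotient.mk_surjective.comp hmaps
  have hψ₂ : Function.Surjective ψ₂ := Ideal.Quotient.mk_surjective.comp hevs
  have hkermap : RingHom.ker (MvPolynomial.map (σ := J) κ) = Ideal.span {C (π ^ (n + l))} := by
    rw [MvPolynomial.ker_map, hker, Ideal.map_span, Set.image_singleton]
  have hkk : RingHom.ker ψ₁ = RingHom.ker ψ₂ := by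
    ext F
    rw [RingHom.mem_ker, RingHom.mem_ker]
    change Ideal.Quotient.mk _ (MvPolynomial.map κ F) = 0 ↔ Ideal.Quotient.mk _ (ev F) = 0
    rw [Ideal.Quotient.eq_zero_iff_mem, Ideal.Quotient.eq_zero_iff_mem, Ideal.mem_span_singleton,
      chartIdeal, Submodule.mem_sup]
    constructor
    · rintro ⟨F₁, hF₁, G, hG, hFG⟩
      obtain ⟨F₁, rfl⟩ := hmaps F₁
      have hG' : ∃ G', MvPolynomial.map κ (C (π ^ n) * G') = G := by
        rw [h𝔞, Ideal.map_span, Set.image_singleton, Ideal.mem_span_singleton] at hG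
        obtain ⟨G', rfl⟩ := hG
        obtain ⟨G', rfl⟩ := hmaps G'
        exact ⟨G', by rw [map_mul, map_C]⟩
      obtain ⟨G, rfl⟩ := hG'
      have h1 : F - F₁ - C (π ^ n) * G ∈ RingHom.ker (MvPolynomial.map (σ := J) κ) := by
        rw [RingHom.mem_ker, map_sub, map_sub, ← hFG]
        ring
      rw [hkermap, Ideal.mem_span_singleton] at h1
      obtain ⟨E, hE⟩ := h1
      have h2 : C f ^ j * F₁ ∈ ratioIdeal x f ⊔ Ideal.span {C (π ^ (n + l))} := by
        rw [← hkermap, RingHom.ker_eq_comap_bot, ← Ideal.comap_map_of_surjective _ hmaps,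
          Ideal.mem_comap, map_ratioIdeal,
          map_mul, map_pow, map_C]
        exact hF₁
      obtain ⟨b, hb, c, hc, hbc⟩ := Submodule.mem_sup.mp h2
      obtain ⟨d, rfl⟩ := Ideal.mem_span_singleton.mp hc
      have h3 := congr_arg ev hbc
      rw [map_add, hev0 hb, zero_add, map_mul, map_mul, hevC, map_pow ev, hevC] at h3
      -- In the chart `m` becomes principal, generated by `f`, so `π ^ l ∈ m ^ j` turns into
      -- divisibility by `f ^ j`.
      have h4 : algebraMap A (blowUpAlgebra m f) f ^ j ∣ algebraMap A _ (π ^ l) := by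
        have := Ideal.mem_map_of_mem (algebraMap A (blowUpAlgebra m f)) hπ
        rw [Ideal.map_pow, blowUpAlgebra.map_eq_span f hf, Ideal.span_singleton_pow,
          Ideal.mem_span_singleton] at this
        exact this
      obtain ⟨w, hw⟩ := h4
      -- The loss of precision: `f ^ j` is cancelled against `π ^ l`, leaving `π ^ n` out of `π ^ (n
      -- + l)`.
      have h5 : ev F₁ = algebraMap A _ (π ^ n) * (w * ev d) := by
        refine (mul_cancel_left_mem_nonZeroDivisors
          (pow_mem (blowUpAlgebra.algebraMap_mem_nonZeroDivisors (m := m) f) j)).mp ?_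
        rw [← h3, pow_add, map_mul, hw]
        ring
      have h6 : ev F = ev F₁ + algebraMap A _ (π ^ n) * ev G +
          algebraMap A _ (π ^ (n + l)) * ev E := by
        have := congr_arg ev hE
        rw [map_sub, map_sub, map_mul, map_mul, hevC, hevC] at this
        linear_combination this
      rw [h6, h5, pow_add, map_mul]
      exact ⟨w * ev d + ev G + algebraMap A _ (π ^ l) * ev E, by ring⟩
    · rintro ⟨z, hz⟩
      obtain ⟨G, rfl⟩ := hevs z
      refine ⟨MvPolynomial.map κ (F - C (π ^ n) * G), ?_, MvPolynomial.map κ (C (π ^ n) * G),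
        ?_, ?_⟩
      -- Here `k` depends on `F`; `htors` replaces it by the uniform exponent `j`, which makes the
      -- condition visible after truncation.
      · obtain ⟨k, hk⟩ := exists_C_pow_mul_mem_ratioIdeal f x hx' (F := F - C (π ^ n) * G) (by
          change ev _ = 0
          rw [map_sub, map_mul, hevC, hz, sub_self])
        have := Ideal.mem_map_of_mem (MvPolynomial.map κ) (htors _ _ hk)
        rwa [map_ratioIdeal, map_mul, map_pow, map_C] at this
      · rw [map_mul, map_C, h𝔞]
        exact Ideal.mul_mem_right _ _ (Ideal.mem_map_of_mem _ (Ideal.mem_span_singleton_self _))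
      · rw [← map_add, sub_add_cancel]
  let e := (RingHom.quotientKerEquivOfSurjective hψ₁).symm.trans
    ((Ideal.quotEquivOfEq hkk).trans (RingHom.quotientKerEquivOfSurjective hψ₂))
  refine ⟨e, fun F ↦ ?_⟩
  have h1 : (RingHom.quotientKerEquivOfSurjective hψ₁).symm (ψ₁ F) = Ideal.Quotient.mk _ F := by
    rw [RingEquiv.symm_apply_eq]; rfl
  change (RingHom.quotientKerEquivOfSurjective hψ₂) (Ideal.quotEquivOfEq hkk
    ((RingHom.quotientKerEquivOfSurjective hψ₁).symm (ψ₁ F))) = _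
  rw [h1]
  rfl

end Chart

/-! ### Inverse images of ideal sheaves, Cartier divisors and morphisms to affine schemes. -/

/-- `comap` of ideal sheaves is left adjoint to `map`, and between affine schemes `map` is
contraction of ideals; extension of ideals is the other left adjoint. -/
theorem ideal_top_comap {X Y : Scheme.{u}} [IsAffine X] [IsAffine Y] (I : Y.IdealSheafData)
    (f : X ⟶ Y) :
    (I.comap f).ideal ⟨⊤, isAffineOpen_top X⟩ =
      (I.ideal ⟨⊤, isAffineOpen_top Y⟩).map f.appTop.hom := by
  have hmap (K : X.IdealSheafData) : (K.map f).ideal ⟨⊤, isAffineOpen_top Y⟩ =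
      (K.ideal ⟨⊤, isAffineOpen_top X⟩).comap f.appTop.hom :=
    Scheme.IdealSheafData.ideal_map K f ⟨⊤, isAffineOpen_top Y⟩ (isAffineOpen_top X)
  apply le_antisymm
  · have h : I.comap f ≤ .ofIdealTop
        ((I.ideal ⟨⊤, isAffineOpen_top Y⟩).map f.appTop.hom) := by
      rw [← Scheme.IdealSheafData.le_map_iff_comap_le]
      apply Scheme.IdealSheafData.le_of_isAffine
      rw [hmap, ← Ideal.map_le_iff_le_comap]
      simp
    simpa using h ⟨⊤, isAffineOpen_top X⟩
  · rw [Ideal.map_le_iff_le_comap, ← hmap]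
    exact Scheme.IdealSheafData.le_map_comap I f _

theorem ideal_top_comap_ι {Y : Scheme.{u}} (I : Y.IdealSheafData) (V : Y.affineOpens)
    (hV : IsAffineOpen (⊤ : V.1.toScheme.Opens)) :
    (I.comap V.1.ι).ideal ⟨⊤, hV⟩ = (I.ideal V).map V.1.topIso.inv.hom := by
  rw [Scheme.IdealSheafData.ideal_comap_of_isOpenImmersion, Scheme.Opens.ι_appIso,
    Scheme.Opens.topIso_inv]
  have h := I.map_ideal' (U := ⟨V.1.ι ''ᵁ ⊤, hV.image_of_isOpenImmersion V.1.ι⟩) (V := V)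
    (eqToHom V.1.ι_image_top).op
  exact (Ideal.comap_id (I.ideal ⟨V.1.ι ''ᵁ ⊤, hV.image_of_isOpenImmersion V.1.ι⟩)).trans h.symm

theorem ideal_comap {X Y : Scheme.{u}} (I : Y.IdealSheafData) (f : X ⟶ Y) (V : Y.affineOpens)
    (W : X.affineOpens) (h : W.1 ≤ f ⁻¹ᵁ V.1) :
    (I.comap f).ideal W = (I.ideal V).map (f.appLE V.1 W.1 h).hom := by
  have : IsAffine W.1.toScheme := W.2
  have : IsAffine V.1.toScheme := V.2
  have h1 := ideal_top_comap_ι (I.comap f) W (isAffineOpen_top _)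
  rw [← Scheme.IdealSheafData.comap_comp, ← Scheme.Hom.resLE_comp_ι f h,
    Scheme.IdealSheafData.comap_comp, ideal_top_comap, ideal_top_comap_ι, Ideal.map_map,
    ← CommRingCat.hom_comp] at h1
  have h2 : V.1.topIso.inv ≫ (f.resLE V.1 W.1 h).appTop = f.appLE V.1 W.1 h ≫ W.1.topIso.inv := by
    rw [Scheme.Hom.appTop, Scheme.Hom.resLE_app_top, Iso.inv_hom_id_assoc]
  rw [h2, CommRingCat.hom_comp, ← Ideal.map_map] at h1
  have h3 := congrArg (Ideal.map W.1.topIso.hom.hom) h1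
  rw [Ideal.map_map (f := W.1.topIso.inv.hom), Ideal.map_map (f := W.1.topIso.inv.hom),
    ← CommRingCat.hom_comp, Iso.inv_hom_id, CommRingCat.hom_id, Ideal.map_id, Ideal.map_id] at h3
  exact h3.symm

theorem isEffectiveCartier_of_ideal_eq {T Y : Scheme.{u}} [IsAffine T] (t : T ⟶ Y)
    (I : Y.IdealSheafData) (V : Y.affineOpens) (h : ⊤ ≤ t ⁻¹ᵁ V.1) (s : Γ(T, ⊤))
    (hs : s ∈ nonZeroDivisors Γ(T, ⊤))
    (hI : (I.ideal V).map (t.appLE V.1 ⊤ h).hom = Ideal.span {s}) :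
    IsEffectiveCartier (I.comap t) := fun _ ↦
  ⟨⟨⊤, isAffineOpen_top T⟩, trivial, s, hs, by rw [← hI]; exact ideal_comap _ _ _ _ h⟩

theorem isEffectiveCartier_top {T : Scheme.{u}} : IsEffectiveCartier (⊤ : T.IdealSheafData) := by
  intro x
  obtain ⟨W, hW, hx, -⟩ := exists_isAffineOpen_mem_and_subset (x := x) (U := ⊤) trivial
  exact ⟨⟨W, hW⟩, hx, 1, one_mem _, by simp⟩

theorem comap_eq_top {T Y : Scheme.{u}} (t : T ⟶ Y) (I : Y.IdealSheafData)
    (h : ∀ x, t x ∉ I.support) : I.comap t = ⊤ := by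
  rw [← Scheme.IdealSheafData.support_eq_bot_iff, Scheme.IdealSheafData.support_comap]
  ext x
  simpa using h x

theorem _root_.RingHom.Flat.map_mem_nonZeroDivisors {S T : Type*} [CommRing S] [CommRing T]
    {φ : S →+* T} (hφ : φ.Flat) {g : S} (hg : g ∈ nonZeroDivisors S) :
    φ g ∈ nonZeroDivisors T := by
  algebraize [φ]
  rw [mem_nonZeroDivisors_iff_left]
  intro a ha
  have h := Module.Flat.isSMulRegular_of_nonZeroDivisors (M := T) hg
  refine h ?_
  simp only [Algebra.smul_def, mul_zero]
  exact ha

/-- The pullback of a nonzerodivisor along a flat morphism is a nonzerodivisor. -/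
theorem appTop_mem_nonZeroDivisors {S T : Scheme.{u}} [IsAffine S] (i : T ⟶ S) [Flat i]
    {g : Γ(S, ⊤)} (hg : g ∈ nonZeroDivisors Γ(S, ⊤)) :
    i.appTop.hom g ∈ nonZeroDivisors Γ(T, ⊤) := by
  rw [mem_nonZeroDivisors_iff_left]
  intro a ha
  refine Scheme.OpenCover.ext_elem a 0 T.affineCover fun k ↦ ?_
  have hfl : Flat (T.affineCover.f k ≫ i) := inferInstance
  have h := (T.affineCover.f k ≫ i).flat_appTop.map_mem_nonZeroDivisors hg
  rw [mem_nonZeroDivisors_iff_left] at h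
  have h2 := congrArg (T.affineCover.f k).appTop.hom ha
  rw [map_mul, map_zero] at h2
  rw [map_zero]
  refine h _ ?_
  rw [Scheme.Hom.comp_appTop]
  exact h2

theorem ΓSpecIso_inv_mem_nonZeroDivisors {S : CommRingCat.{u}} {g : S}
    (hg : g ∈ nonZeroDivisors S) :
    (Scheme.ΓSpecIso S).inv.hom g ∈ nonZeroDivisors Γ(Spec S, ⊤) :=
  (RingHom.Flat.of_bijective
    (Scheme.ΓSpecIso S).symm.commRingCatIsoToRingEquiv.bijective).map_mem_nonZeroDivisors hg

section Global

variable {T T' : Scheme.{u}} {A B : CommRingCat.{u}}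

/-- The ring homomorphism on global sections of a morphism to an affine scheme. -/
def toΓ (t : T ⟶ Spec A) : A →+* Γ(T, ⊤) := ((Scheme.ΓSpecIso A).inv ≫ t.appTop).hom

lemma toΓ_comp (s : T' ⟶ T) (t : T ⟶ Spec A) (a : A) :
    toΓ (s ≫ t) a = s.appTop.hom (toΓ t a) := by
  rw [toΓ, toΓ, Scheme.Hom.comp_appTop]
  rfl

lemma toΓ_comp_SpecMap (t : T ⟶ Spec B) (g : A ⟶ B) (a : A) :
    toΓ (t ≫ Spec.map g) a = toΓ t (g.hom a) := by
  rw [toΓ, toΓ, Scheme.Hom.comp_appTop, ← Scheme.ΓSpecIso_inv_naturality_assoc]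
  rfl

lemma toΓ_ext {s t : T ⟶ Spec A} (h : toΓ s = toΓ t) : s = t :=
  ext_to_Spec (R := A) (CommRingCat.hom_ext h)

lemma exists_toΓ_eq (g : A →+* Γ(T, ⊤)) : ∃ t : T ⟶ Spec A, toΓ t = g :=
  ⟨ΓSpec.adjunction.homEquiv T (.op A) (CommRingCat.ofHom g).op, congrArg CommRingCat.Hom.hom
    (ΓSpecIso_inv_ΓSpec_adjunction_homEquiv (CommRingCat.ofHom g))⟩

lemma toΓ_mem_nonZeroDivisors (t : T ⟶ Spec A) [Flat t] {a : A} (ha : a ∈ nonZeroDivisors A) :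
    toΓ t a ∈ nonZeroDivisors Γ(T, ⊤) :=
  appTop_mem_nonZeroDivisors t (ΓSpecIso_inv_mem_nonZeroDivisors ha)

lemma SpecMap_comp_fromSpec_appLE {Y : Scheme.{u}} {V : Y.Opens} (hV : IsAffineOpen V)
    (g : Γ(Y, V) ⟶ B) (h : ⊤ ≤ (Spec.map g ≫ hV.fromSpec) ⁻¹ᵁ V) :
    (Spec.map g ≫ hV.fromSpec).appLE V ⊤ h = g ≫ (Scheme.ΓSpecIso B).inv := by
  have h1 : ⊤ ≤ hV.fromSpec ⁻¹ᵁ V := hV.fromSpec_preimage_self.ge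
  have h2 : hV.fromSpec.appLE V ⊤ h1 = (Scheme.ΓSpecIso _).inv := by
    rw [Scheme.Hom.appLE, IsAffineOpen.fromSpec_app_self, Category.assoc, ← Functor.map_comp]
    exact (congrArg _ (CategoryTheory.Functor.map_id _ _)).trans (Category.comp_id _)
  have h3 := Scheme.Hom.appLE_comp_appLE (Spec.map g) hV.fromSpec V ⊤ ⊤ h1 le_rfl
  rw [← h3, h2, Scheme.ΓSpecIso_inv_naturality, Scheme.Hom.appTop, ← Scheme.Hom.appLE_eq_app]
  rfl

lemma isEffectiveCartier_comap_SpecMap_fromSpec {Y : Scheme.{u}} (I : Y.IdealSheafData)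
    {V : Y.Opens} (hV : IsAffineOpen V) (g : Γ(Y, V) ⟶ B) {s : B} (hs : s ∈ nonZeroDivisors B)
    (h : (I.ideal ⟨V, hV⟩).map g.hom = Ideal.span {s}) :
    IsEffectiveCartier (I.comap (Spec.map g ≫ hV.fromSpec)) := by
  have hV' : ⊤ ≤ (Spec.map g ≫ hV.fromSpec) ⁻¹ᵁ V := by
    rw [Scheme.Hom.comp_preimage, hV.fromSpec_preimage_self]; rfl
  refine isEffectiveCartier_of_ideal_eq _ I ⟨V, hV⟩ hV' _ (ΓSpecIso_inv_mem_nonZeroDivisors hs) ?_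
  rw [SpecMap_comp_fromSpec_appLE, CommRingCat.hom_comp, ← Ideal.map_map, h, Ideal.map_span,
    Set.image_singleton]

end Global

/-! ### Charts of a blowing-up, derived from its universal property. -/

/-- An open affine piece of `Y'` lying over `V` on which the inverse image of the ideal sheaf `I`
is generated by the nonzerodivisor `s`. -/
structure LocalGenerator {Y' Y : Scheme.{u}} (p : Y' ⟶ Y) (I : Y.IdealSheafData) {V : Y.Opens}
    (hV : IsAffineOpen V) where
  /-- the coordinate ring -/
  B : CommRingCat.{u}
  /-- the open immersion -/
  w : Spec B ⟶ Y'
  isOpenImmersion : IsOpenImmersion w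
  /-- the ring homomorphism -/
  g : Γ(Y, V) ⟶ B
  comp_eq : w ≫ p = Spec.map g ≫ hV.fromSpec
  /-- the generator -/
  s : B
  mem_nonZeroDivisors : s ∈ nonZeroDivisors B
  map_eq : (I.ideal ⟨V, hV⟩).map g.hom = Ideal.span {s}

attribute [instance] LocalGenerator.isOpenImmersion

section Chart

variable {Y' Y : Scheme.{u}} {p : Y' ⟶ Y} {I : Y.IdealSheafData} {V : Y.Opens}
    {hV : IsAffineOpen V}

/-- The local generator `s * d` on the open subset where `d` is invertible. -/
def LocalGenerator.away (L : LocalGenerator p I hV) (d : L.B) : LocalGenerator p I hV where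
  B := .of (Localization.Away d)
  w := Spec.map (CommRingCat.ofHom (algebraMap L.B (Localization.Away d))) ≫ L.w
  isOpenImmersion := inferInstance
  g := L.g ≫ CommRingCat.ofHom (algebraMap L.B (Localization.Away d))
  comp_eq := by rw [Category.assoc, L.comp_eq, Spec.map_comp_assoc]
  s := algebraMap L.B (Localization.Away d) (L.s * d)
  mem_nonZeroDivisors := by
    rw [map_mul]
    exact mul_mem (IsLocalization.map_nonZeroDivisors_le (.powers d) _
      ⟨_, L.mem_nonZeroDivisors, rfl⟩) (IsLocalization.Away.algebraMap_isUnit d).mem_nonZeroDivisors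
  map_eq := by
    rw [CommRingCat.hom_comp, ← Ideal.map_map, L.map_eq, Ideal.map_span, Set.image_singleton,
      map_mul, Ideal.span_singleton_mul_right_unit (IsLocalization.Away.algebraMap_isUnit d)]
    rfl

lemma LocalGenerator.mem_range_away (L : LocalGenerator p I hV) {d : L.B} {b : Spec L.B}
    (hb : b ∈ PrimeSpectrum.basicOpen d) : L.w b ∈ Set.range (L.away d).w := by
  rw [← Scheme.Hom.opensRange_localizationAway] at hb
  obtain ⟨b', hb'⟩ := hb
  refine ⟨b', ?_⟩
  rw [← hb']
  exact Scheme.Hom.comp_apply _ _ _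

lemma exists_localGenerator (h : IsEffectiveCartier (I.comap p)) (hV : IsAffineOpen V)
    (y : Y') (hy : p y ∈ V) : ∃ L : LocalGenerator p I hV, y ∈ Set.range L.w := by
  obtain ⟨W, hyW, s, hs, hI⟩ := h y
  obtain ⟨r, hr, hyr⟩ := W.2.exists_basicOpen_le (V := p ⁻¹ᵁ V) ⟨y, hy⟩ hyW
  have haff := W.2.basicOpen r
  have hle : Y'.basicOpen r ≤ W.1 := Y'.basicOpen_le r
  refine ⟨⟨Γ(Y', Y'.basicOpen r), haff.fromSpec, inferInstance, p.appLE V _ hr,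
    (IsAffineOpen.SpecMap_appLE_fromSpec p hV haff hr).symm,
    (Y'.presheaf.map (homOfLE hle).op).hom s, ?_, ?_⟩, ?_⟩
  · have := W.2.isLocalization_basicOpen r
    exact IsLocalization.map_nonZeroDivisors_le (.powers r) _ ⟨_, hs, rfl⟩
  · rw [← ideal_comap I p ⟨V, hV⟩ ⟨_, haff⟩ hr, ← (I.comap p).map_ideal (V := W) hle, hI,
      Ideal.map_span, Set.image_singleton]
    rfl
  · rw [IsAffineOpen.range_fromSpec]
    exact hyr

variable (hp : IsBlowUp p I) (hV : IsAffineOpen V) {f : Γ(Y, V)} (hf : f ∈ I.ideal ⟨V, hV⟩)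

/-- The coordinate ring of the chart of the blowing-up given by `f`. -/
abbrev chartRing (hV : IsAffineOpen V) (I : Y.IdealSheafData) (f : Γ(Y, V)) : CommRingCat.{u} :=
  .of (blowUpAlgebra (I.ideal ⟨V, hV⟩) f)

/-- The structure homomorphism of the coordinate ring of a chart. -/
abbrev chartRingHom (hV : IsAffineOpen V) (I : Y.IdealSheafData) (f : Γ(Y, V)) :
    Γ(Y, V) ⟶ chartRing hV I f :=
  CommRingCat.ofHom (algebraMap Γ(Y, V) (blowUpAlgebra (I.ideal ⟨V, hV⟩) f))

include hp hf in
lemma exists_chart : ∃ j : Spec (chartRing hV I f) ⟶ Y',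
    j ≫ p = Spec.map (chartRingHom hV I f) ≫ hV.fromSpec :=
  (hp.existsUnique_lift _ _ (isEffectiveCartier_comap_SpecMap_fromSpec I hV
    (chartRingHom hV I f) (blowUpAlgebra.algebraMap_mem_nonZeroDivisors f)
    (blowUpAlgebra.map_eq_span f hf))).exists

/-- The chart of the blowing-up given by `f`. -/
def chart : Spec (chartRing hV I f) ⟶ Y' := (exists_chart hp hV hf).choose

lemma chart_comp : chart hp hV hf ≫ p = Spec.map (chartRingHom hV I f) ≫ hV.fromSpec :=
  (exists_chart hp hV hf).choose_spec

lemma chart_unique {B : CommRingCat.{u}} {s : B} (hs : s ∈ nonZeroDivisors B) {g : Γ(Y, V) ⟶ B}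
    (hg : (I.ideal ⟨V, hV⟩).map g.hom = Ideal.span {s}) (hp : IsBlowUp p I) {a b : Spec B ⟶ Y'}
    (ha : a ≫ p = Spec.map g ≫ hV.fromSpec) (hb : b ≫ p = Spec.map g ≫ hV.fromSpec) : a = b :=
  (hp.existsUnique_lift _ _ (isEffectiveCartier_comap_SpecMap_fromSpec I hV g hs hg)).unique ha hb

lemma toΓ_chart_eq {T : Scheme.{u}} {B : CommRingCat.{u}} {g : Γ(Y, V) ⟶ B} {w : Spec B ⟶ Y'}
    (hw : w ≫ p = Spec.map g ≫ hV.fromSpec) {a : T ⟶ Spec (chartRing hV I f)} {b : T ⟶ Spec B}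
    (h : a ≫ chart hp hV hf = b ≫ w) (z : Γ(Y, V)) :
    toΓ a (algebraMap _ _ z) = toΓ b (g.hom z) := by
  have h1 : a ≫ Spec.map (chartRingHom hV I f) = b ≫ Spec.map g := by
    rw [← cancel_mono hV.fromSpec, Category.assoc, Category.assoc, ← hw, ← chart_comp hp hV hf,
      reassoc_of% h]
  exact (toΓ_comp_SpecMap a (chartRingHom hV I f) z).symm.trans
    ((congrArg (toΓ · z) h1).trans (toΓ_comp_SpecMap b g z))

/-- Near an image point of the chart, the inverse image ideal has some generator `s`, and `f = s d`.
On the fiber product with the chart `f` generates it as well, so `d` becomes a unit there; hence `d`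
does not vanish at the point, and localizing at `d` makes `f` itself the generator. -/
lemma exists_good (u : Spec (chartRing hV I f)) :
    ∃ L : LocalGenerator p I hV, chart hp hV hf u ∈ Set.range L.w ∧ L.s = L.g.hom f := by
  have hu : p (chart hp hV hf u) ∈ V := by
    rw [← Scheme.Hom.comp_apply, chart_comp, Scheme.Hom.comp_apply, ← SetLike.mem_coe,
      ← hV.range_fromSpec]
    exact ⟨_, rfl⟩
  obtain ⟨L, b, hb⟩ := exists_localGenerator hp.isEffectiveCartier hV _ hu
  obtain ⟨d, hd⟩ : L.s ∣ L.g.hom f := by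
    rw [← Ideal.mem_span_singleton, ← L.map_eq]
    exact Ideal.mem_map_of_mem _ hf
  obtain ⟨t, htu, htb⟩ := Scheme.Pullback.exists_preimage_pullback u b hb.symm
  have hz := toΓ_chart_eq hp hV hf L.comp_eq (pullback.condition (f := chart hp hV hf) (g := L.w))
  have hfz : toΓ (pullback.fst (chart hp hV hf) L.w) (algebraMap _ _ f) ∈ nonZeroDivisors _ :=
    toΓ_mem_nonZeroDivisors _ (blowUpAlgebra.algebraMap_mem_nonZeroDivisors f)
  have hs : toΓ (pullback.snd (chart hp hV hf) L.w) L.s ∈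
      Ideal.span {toΓ (pullback.fst (chart hp hV hf) L.w) (algebraMap _ _ f)} := by
    have h1 : L.s ∈ (I.ideal ⟨V, hV⟩).map L.g.hom := by
      rw [L.map_eq]; exact Ideal.mem_span_singleton_self _
    have h2 := Ideal.mem_map_of_mem (toΓ (pullback.snd (chart hp hV hf) L.w)) h1
    refine (?_ : Ideal.map _ _ ≤ _) h2
    rw [Ideal.map_map, Ideal.map_le_iff_le_comap]
    intro z hzI
    rw [Ideal.mem_comap, RingHom.comp_apply, ← hz, ← blowUpAlgebra.mul_frac f hzI, map_mul]
    exact Ideal.mul_mem_right _ _ (Ideal.mem_span_singleton_self _)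
  obtain ⟨c, hc⟩ := Ideal.mem_span_singleton.mp hs
  have hunit : IsUnit (toΓ (pullback.snd (chart hp hV hf) L.w) d) := by
    refine IsUnit.of_mul_eq_one c ((mul_cancel_left_mem_nonZeroDivisors hfz).mp ?_)
    rw [mul_comm _ c, ← mul_assoc, ← hc, ← map_mul, ← hd, hz, mul_one]
  refine ⟨L.away d, ?_, ?_⟩
  · have hbd : b ∈ PrimeSpectrum.basicOpen d := by
      rw [← htb, ← basicOpen_eq_of_affine]
      have : t ∈ pullback.snd (chart hp hV hf) L.w ⁻¹ᵁ
          (Spec L.B).basicOpen ((Scheme.ΓSpecIso L.B).inv d) := by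
        rw [Scheme.preimage_basicOpen_top]
        exact (Scheme.basicOpen_of_isUnit _ hunit).ge trivial
      exact this
    exact hb ▸ L.mem_range_away hbd
  · exact congrArg (algebraMap L.B (Localization.Away d)) hd.symm

/-- Where `f` generates, the universal property of `A[m/f]` gives a map to the chart, and uniqueness
for the blowing-up shows that it lifts the inclusion. -/
lemma exists_section (L : LocalGenerator p I hV) (hL : L.s = L.g.hom f) :
    ∃ φ : chartRing hV I f ⟶ L.B, chartRingHom hV I f ≫ φ = L.g ∧
      Spec.map φ ≫ chart hp hV hf = L.w := by
  have hnz : L.g.hom f ∈ nonZeroDivisors L.B := hL ▸ L.mem_nonZeroDivisors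
  obtain ⟨φ, hφ⟩ := blowUpAlgebra.exists_lift (m := I.ideal ⟨V, hV⟩) f L.g.hom hnz fun a ha ↦ by
    rw [← Ideal.mem_span_singleton, ← hL, ← L.map_eq]
    exact Ideal.mem_map_of_mem _ ha
  have h1 : chartRingHom hV I f ≫ CommRingCat.ofHom φ = L.g :=
    CommRingCat.hom_ext (RingHom.ext hφ)
  refine ⟨CommRingCat.ofHom φ, h1, chart_unique hV L.mem_nonZeroDivisors L.map_eq hp ?_ L.comp_eq⟩
  rw [Category.assoc, chart_comp, ← Spec.map_comp_assoc, h1]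

lemma chart_hom_ext {T : Scheme.{u}} {a b : T ⟶ Spec (chartRing hV I f)}
    (hnz : toΓ a (algebraMap _ _ f) ∈ nonZeroDivisors Γ(T, ⊤))
    (h : a ≫ Spec.map (chartRingHom hV I f) = b ≫ Spec.map (chartRingHom hV I f)) : a = b := by
  have h1 (z : Γ(Y, V)) : toΓ a (algebraMap _ _ z) = toΓ b (algebraMap _ _ z) :=
    (toΓ_comp_SpecMap a (chartRingHom hV I f) z).symm.trans
      ((congrArg (toΓ · z) h).trans (toΓ_comp_SpecMap b (chartRingHom hV I f) z))
  refine toΓ_ext (blowUpAlgebra.hom_ext f h1 fun z hz ↦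
    (mul_cancel_left_mem_nonZeroDivisors hnz).mp ?_)
  rw [← map_mul, blowUpAlgebra.mul_frac f hz, h1, h1, ← map_mul, blowUpAlgebra.mul_frac f hz]

lemma pullback_fst_chart (L : LocalGenerator p I hV) {φ : chartRing hV I f ⟶ L.B}
    (hφ : chartRingHom hV I f ≫ φ = L.g) :
    pullback.fst (chart hp hV hf) L.w = pullback.snd (chart hp hV hf) L.w ≫ Spec.map φ := by
  refine chart_hom_ext hV (toΓ_mem_nonZeroDivisors _
    (blowUpAlgebra.algebraMap_mem_nonZeroDivisors f)) ?_
  rw [← cancel_mono hV.fromSpec, Category.assoc, Category.assoc, Category.assoc,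
    ← Spec.map_comp_assoc, hφ, ← L.comp_eq, ← chart_comp hp hV hf, pullback.condition_assoc]

/-- Over an open piece of `Y'` where `f` generates, the second projection from the fiber product
with the chart is an isomorphism, with inverse given by the section of `exists_section`. -/
instance isOpenImmersion_chart : IsOpenImmersion (chart hp hV hf) := by
  refine IsOpenImmersion.of_forall_source_exists _ ?_ ?_
  · intro u u' huu
    obtain ⟨L, ⟨b, hb⟩, hL⟩ := exists_good hp hV hf u
    obtain ⟨φ, hφ, hφc⟩ := exists_section hp hV hf L hL
    obtain ⟨t, htu, htb⟩ := Scheme.Pullback.exists_preimage_pullback u b hb.symm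
    obtain ⟨t', htu', htb'⟩ := Scheme.Pullback.exists_preimage_pullback u' b (hb.trans huu).symm
    rw [← htu, ← htu', pullback_fst_chart hp hV hf L hφ, Scheme.Hom.comp_apply,
      Scheme.Hom.comp_apply, htb, htb']
  · intro u
    obtain ⟨L, ⟨b, hb⟩, hL⟩ := exists_good hp hV hf u
    obtain ⟨φ, hφ, hφc⟩ := exists_section hp hV hf L hL
    have hsec : pullback.lift (Spec.map φ) (𝟙 _) (by rw [hφc, Category.id_comp]) ≫
        pullback.snd (chart hp hV hf) L.w = 𝟙 _ := pullback.lift_snd _ _ _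
    have hiso : IsIso (pullback.snd (chart hp hV hf) L.w) := by
      refine ⟨_, ?_, hsec⟩
      apply pullback.hom_ext
      · rw [Category.assoc, pullback.lift_fst, Category.id_comp, pullback_fst_chart hp hV hf L hφ]
      · rw [Category.assoc, hsec, Category.comp_id, Category.id_comp]
    refine ⟨_, pullback.fst (chart hp hV hf) L.w, inferInstance, ?_, ?_⟩
    · obtain ⟨t, htu, -⟩ := Scheme.Pullback.exists_preimage_pullback u b hb.symm
      exact ⟨t, htu⟩
    · rw [pullback.condition]
      infer_instance

/-- Some `f` in the ideal generates near `y`. Otherwise every element of the ideal would be `s`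
times a function vanishing at `y`; applied to `s` itself and cancelling `s`, this puts `1` in the
prime of `y`. -/
lemma exists_chart_mem (y : Y') (hy : p y ∈ V) :
    ∃ (f : Γ(Y, V)) (hf : f ∈ I.ideal ⟨V, hV⟩), y ∈ Set.range (chart hp hV hf) := by
  obtain ⟨L, b, hb⟩ := exists_localGenerator hp.isEffectiveCartier hV _ hy
  obtain ⟨f, hf, d, hd, hbd⟩ : ∃ f ∈ I.ideal ⟨V, hV⟩, ∃ d, L.g.hom f = L.s * d ∧
      b ∈ PrimeSpectrum.basicOpen d := by
    by_contra! hcon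
    have h1 : L.s ∈ Ideal.span {L.s} * b.asIdeal := by
      have : L.s ∈ (I.ideal ⟨V, hV⟩).map L.g.hom := by
        rw [L.map_eq]; exact Ideal.mem_span_singleton_self _
      refine (?_ : Ideal.map _ _ ≤ _) this
      rw [Ideal.map_le_iff_le_comap]
      intro z hz
      obtain ⟨d, hd⟩ : L.s ∣ L.g.hom z := by
        rw [← Ideal.mem_span_singleton, ← L.map_eq]
        exact Ideal.mem_map_of_mem _ hz
      rw [Ideal.mem_comap, hd]
      refine Ideal.mul_mem_mul (Ideal.mem_span_singleton_self _) ?_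
      have := hcon z hz d hd
      by_contra h
      exact this h
    obtain ⟨c, hc, hc'⟩ := Ideal.mem_span_singleton_mul.mp h1
    have : c = 1 := (mul_cancel_left_mem_nonZeroDivisors L.mem_nonZeroDivisors).mp
      (hc'.trans (mul_one _).symm)
    exact b.2.ne_top ((Ideal.eq_top_iff_one _).mpr (this ▸ hc))
  obtain ⟨φ, -, hφ⟩ := exists_section hp hV hf (L.away d)
    (congrArg (algebraMap L.B (Localization.Away d)) hd.symm)
  obtain ⟨b', hb'⟩ := L.mem_range_away hbd
  refine ⟨f, hf, Spec.map φ b', ?_⟩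
  rw [← Scheme.Hom.comp_apply, hφ, hb', hb]

end Chart

/-! ### Overlaps of charts, tested on arbitrary schemes. -/

/-- The overlap of two charts of a blowing-up: it is `A[m / f]` localized at `g / f`. -/
lemma blowUpAlgebra.exists_overlap {A : Type u} [CommRing A] {m : Ideal A} {f g : A} (hf : f ∈ m)
    (hg : g ∈ m) : ∃ (S : Type u) (_ : CommRing S) (ι : blowUpAlgebra m f →+* S)
      (κ : blowUpAlgebra m g →+* S), ι (algebraMap A _ f) ∈ nonZeroDivisors S ∧
      (∀ z : A, κ (algebraMap A _ z) = ι (algebraMap A _ z)) ∧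
      ∀ (D : Type u) (_ : CommRing D) (α : blowUpAlgebra m f →+* D) (β : blowUpAlgebra m g →+* D),
        (∀ z : A, α (algebraMap A _ z) = β (algebraMap A _ z)) →
        (∀ z (hz : z ∈ m), α (frac f hz) = β (frac g hz) * α (frac f hg)) →
        ∃ γ : S →+* D, γ.comp ι = α ∧ γ.comp κ = β := by
  obtain ⟨S, _, ι, hfS, hu, hlift⟩ : ∃ (S : Type u) (_ : CommRing S) (ι : blowUpAlgebra m f →+* S),
      ι (algebraMap A _ f) ∈ nonZeroDivisors S ∧ IsUnit (ι (frac f hg)) ∧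
      ∀ (D : Type u) [CommRing D] (α : blowUpAlgebra m f →+* D), IsUnit (α (frac f hg)) →
        ∃ γ : S →+* D, γ.comp ι = α :=
    ⟨Localization.Away (frac f hg), inferInstance, algebraMap _ _,
      IsLocalization.map_nonZeroDivisors_le (.powers (frac f hg)) _
        ⟨_, algebraMap_mem_nonZeroDivisors f, rfl⟩, IsLocalization.Away.algebraMap_isUnit _,
      fun D _ α h ↦ ⟨IsLocalization.Away.lift _ h, IsLocalization.Away.lift_comp _ h⟩⟩
  have hz {z} (hz : z ∈ m) : ι (algebraMap A _ z) = ι (algebraMap A _ f) * ι (frac f hz) := by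
    rw [← map_mul, blowUpAlgebra.mul_frac]
  have hgS : ι (algebraMap A _ g) ∈ nonZeroDivisors S := by
    rw [hz hg]
    exact mul_mem hfS hu.mem_nonZeroDivisors
  obtain ⟨κ, hκ⟩ := blowUpAlgebra.exists_lift (m := m) g (ι.comp (algebraMap A _)) hgS
    fun z hzI ↦ by
      obtain ⟨v, hv⟩ := hu.exists_right_inv
      refine ⟨v * ι (frac f hzI), ?_⟩
      rw [RingHom.comp_apply, RingHom.comp_apply, hz hg, hz hzI, mul_assoc, ← mul_assoc _ v, hv,
        one_mul]
  have hκ' {z} (hzI : z ∈ m) : κ (frac g hzI) * ι (frac f hg) = ι (frac f hzI) := by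
    refine (mul_cancel_left_mem_nonZeroDivisors hfS).mp ?_
    rw [← hz hzI, mul_left_comm, ← hz hg, mul_comm]
    refine (congrArg (· * _) (hκ g).symm).trans ?_
    rw [← map_mul, blowUpAlgebra.mul_frac, hκ, RingHom.comp_apply]
  refine ⟨S, _, ι, κ, hfS, hκ, fun D _ α β h1 h2 ↦ ?_⟩
  -- The relation for `z = f`, where `f / f = 1`: it forces `g / f` to be invertible.
  have hfrac : β (frac g hf) * α (frac f hg) = 1 := by
    rw [← h2, ← map_one α]
    congr 1
    exact blowUpAlgebra.isUnit_algebraMap_mul_cancel f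
      ((blowUpAlgebra.mul_frac f hf).trans (mul_one _).symm)
  have hu' : IsUnit (α (frac f hg)) := IsUnit.of_mul_eq_one_right _ hfrac
  obtain ⟨γ, hγ⟩ := hlift D α hu'
  refine ⟨γ, hγ, blowUpAlgebra.hom_ext g (fun z ↦ ?_) fun z hz ↦ hu'.mul_right_cancel ?_⟩
  · rw [RingHom.comp_apply, hκ, RingHom.comp_apply, ← RingHom.comp_apply γ, hγ, h1]
  · rw [← h2, ← hγ, RingHom.comp_apply, RingHom.comp_apply, RingHom.comp_apply, ← map_mul,
      hκ' hz]

section Relation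

variable {Y' Y : Scheme.{u}} {p : Y' ⟶ Y} {I : Y.IdealSheafData} {V : Y.Opens}
  (hp : IsBlowUp p I) (hV : IsAffineOpen V) {f g : Γ(Y, V)} (hf : f ∈ I.ideal ⟨V, hV⟩)
  (hg : g ∈ I.ideal ⟨V, hV⟩)

/-- The gluing relation of the charts of a blowing-up. -/
theorem comp_chart_eq_comp_chart_iff {T : Scheme.{u}} (a : T ⟶ Spec (chartRing hV I f))
    (b : T ⟶ Spec (chartRing hV I g)) :
    a ≫ chart hp hV hf = b ≫ chart hp hV hg ↔
      (∀ z : Γ(Y, V), toΓ a (algebraMap _ _ z) = toΓ b (algebraMap _ _ z)) ∧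
      ∀ z (hz : z ∈ I.ideal ⟨V, hV⟩), toΓ a (blowUpAlgebra.frac f hz) =
        toΓ b (blowUpAlgebra.frac g hz) * toΓ a (blowUpAlgebra.frac f hg) := by
  constructor
  · intro h
    -- The equations are proved on the universal overlap, which is flat over the chart, so that `f`
    -- can be cancelled. They are then pulled back to `T`, where `f` may be a zero divisor; the
    -- truncated charts need such `T`.
    let c := pullback.fst (chart hp hV hf) (chart hp hV hg)
    let d := pullback.snd (chart hp hV hf) (chart hp hV hg)
    have hA : ∀ z : Γ(Y, V), toΓ c (algebraMap _ _ z) = toΓ d (algebraMap _ _ z) :=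
      toΓ_chart_eq hp hV hf (chart_comp hp hV hg)
        (pullback.condition (f := chart hp hV hf) (g := chart hp hV hg))
    have hnz : toΓ c (algebraMap _ _ f) ∈ nonZeroDivisors _ :=
      toΓ_mem_nonZeroDivisors _ (blowUpAlgebra.algebraMap_mem_nonZeroDivisors f)
    have key {z} (hz : z ∈ I.ideal ⟨V, hV⟩) : toΓ c (blowUpAlgebra.frac f hz) =
        toΓ d (blowUpAlgebra.frac g hz) * toΓ c (blowUpAlgebra.frac f hg) := by
      refine (mul_cancel_left_mem_nonZeroDivisors hnz).mp ?_
      rw [← map_mul, blowUpAlgebra.mul_frac, mul_left_comm, ← map_mul, blowUpAlgebra.mul_frac,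
        hA, hA, mul_comm, ← map_mul, blowUpAlgebra.mul_frac]
    refine ⟨toΓ_chart_eq hp hV hf (chart_comp hp hV hg) h, fun z hz ↦ ?_⟩
    have h2 := congrArg (pullback.lift a b h).appTop.hom (key hz)
    rw [map_mul, ← toΓ_comp, ← toΓ_comp, ← toΓ_comp, pullback.lift_fst, pullback.lift_snd] at h2
    exact h2
  · rintro ⟨h1, h2⟩
    obtain ⟨S, _, ι, κ, hfS, hικ, hS⟩ := blowUpAlgebra.exists_overlap hf hg
    obtain ⟨γ, hγι, hγκ⟩ := hS _ _ (toΓ a) (toΓ b) h1 h2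
    have hι : Spec.map (CommRingCat.ofHom ι) ≫ chart hp hV hf =
        Spec.map (CommRingCat.ofHom κ) ≫ chart hp hV hg := by
      refine chart_unique (B := .of S) (g := chartRingHom hV I f ≫ CommRingCat.ofHom ι) hV hfS ?_
        hp ?_ ?_
      · rw [CommRingCat.hom_comp, ← Ideal.map_map, CommRingCat.hom_ofHom, CommRingCat.hom_ofHom,
          blowUpAlgebra.map_eq_span f hf, Ideal.map_span, Set.image_singleton]
      · rw [Category.assoc, chart_comp, ← Spec.map_comp_assoc]
      · rw [Category.assoc, chart_comp, ← Spec.map_comp_assoc]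
        congr 2
        exact CommRingCat.hom_ext (RingHom.ext hικ)
    obtain ⟨c, hc⟩ := exists_toΓ_eq (A := .of S) γ
    have hca : c ≫ Spec.map (CommRingCat.ofHom ι) = a := by
      refine toΓ_ext (RingHom.ext fun z ↦ ?_)
      rw [toΓ_comp_SpecMap, hc, ← hγι]
      rfl
    have hcb : c ≫ Spec.map (CommRingCat.ofHom κ) = b := by
      refine toΓ_ext (RingHom.ext fun z ↦ ?_)
      rw [toΓ_comp_SpecMap, hc, ← hγκ]
      rfl
    rw [← hca, ← hcb, Category.assoc, Category.assoc, hι]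

end Relation

/-! ### Infinitesimal fibers of the charts. -/

instance isClosedImmersion_SpecMap_mk {R : Type u} [CommRing R] (𝔟 : Ideal R) :
    IsClosedImmersion (Spec.map (CommRingCat.ofHom (Ideal.Quotient.mk 𝔟))) :=
  IsClosedImmersion.spec_of_surjective _ Ideal.Quotient.mk_surjective

lemma isPushout_quotient {R A Q : CommRingCat.{u}} (ρ : R ⟶ A) (θ : A ⟶ Q)
    (hθ : Function.Surjective θ.hom) (𝔟 : Ideal R) (hker : RingHom.ker θ.hom = 𝔟.map ρ.hom)
    (χ : CommRingCat.of (R ⧸ 𝔟) ⟶ Q)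
    (h : CommRingCat.ofHom (Ideal.Quotient.mk 𝔟) ≫ χ = ρ ≫ θ) :
    IsPushout ρ (CommRingCat.ofHom (Ideal.Quotient.mk 𝔟)) θ χ := by
  have hex (s : PushoutCocone ρ (CommRingCat.ofHom (Ideal.Quotient.mk 𝔟))) :
      RingHom.ker θ.hom ≤ RingHom.ker s.inl.hom := by
    rw [hker, Ideal.map_le_iff_le_comap]
    intro r hr
    have h1 := congr($(s.condition).hom r)
    simp only [CommRingCat.hom_comp, RingHom.comp_apply, CommRingCat.hom_ofHom] at h1
    rw [Ideal.mem_comap, RingHom.mem_ker, h1, Ideal.Quotient.eq_zero_iff_mem.mpr hr, map_zero]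
  refine ⟨⟨h.symm⟩, ⟨PushoutCocone.IsColimit.mk h.symm
    (fun s ↦ CommRingCat.ofHom (RingHom.liftOfSurjective θ.hom hθ ⟨s.inl.hom, hex s⟩))
    (fun s ↦ ?_) (fun s ↦ ?_) (fun s k hk _ ↦ ?_)⟩⟩
  · exact CommRingCat.hom_ext (RingHom.liftOfRightInverse_comp _ _ _ ⟨s.inl.hom, hex s⟩)
  · have : Epi (CommRingCat.ofHom (Ideal.Quotient.mk 𝔟)) :=
      ConcreteCategory.epi_of_surjective _ Ideal.Quotient.mk_surjective
    rw [← cancel_epi (CommRingCat.ofHom (Ideal.Quotient.mk 𝔟)), reassoc_of% h, ← s.condition]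
    congr 1
    exact CommRingCat.hom_ext (RingHom.liftOfRightInverse_comp _ _ _ ⟨s.inl.hom, hex s⟩)
  · have : Epi θ := ConcreteCategory.epi_of_surjective _ hθ
    rw [← cancel_epi θ, hk]
    exact CommRingCat.hom_ext (RingHom.liftOfRightInverse_comp _ _ _ ⟨s.inl.hom, hex s⟩).symm

lemma range_eq_preimage_range_of_isPullback {P X Y Z : Scheme.{u}} {fst : P ⟶ X} {snd : P ⟶ Y}
    {f : X ⟶ Z} {g : Y ⟶ Z} (h : IsPullback fst snd f g) :
    Set.range fst = f ⁻¹' Set.range g := by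
  rw [← Scheme.Pullback.range_fst, ← h.isoPullback_hom_fst]
  ext x
  constructor
  · rintro ⟨y, rfl⟩
    exact ⟨h.isoPullback.hom y, (Scheme.Hom.comp_apply _ _ _).symm⟩
  · rintro ⟨y, rfl⟩
    refine ⟨h.isoPullback.inv y, ?_⟩
    rw [← Scheme.Hom.comp_apply, Iso.inv_hom_id_assoc]

/-- The base change of an affine open piece to an infinitesimal fiber. -/
lemma exists_isOpenImmersion_fiber {R : Type u} [CommRing R] [IsLocalRing R] {Y : Scheme.{u}}
    (s : Y ⟶ Spec (CommRingCat.of R)) {A Q : CommRingCat.{u}} (j : Spec A ⟶ Y) [IsOpenImmersion j]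
    (ρ : CommRingCat.of R ⟶ A) (hρ : Spec.map ρ = j ≫ s) (θ : A ⟶ Q)
    (hθ : Function.Surjective θ.hom) (n : ℕ)
    (hker : RingHom.ker θ.hom = (maximalIdeal R ^ (n + 1)).map ρ.hom) :
    ∃ k : Spec Q ⟶ fiber s n, IsOpenImmersion k ∧ k ≫ fiberι s n = Spec.map θ ≫ j ∧
      Set.range k = fiberι s n ⁻¹' Set.range j := by
  let χ : CommRingCat.of (R ⧸ maximalIdeal R ^ (n + 1)) ⟶ Q :=
    CommRingCat.ofHom (Ideal.Quotient.lift _ (ρ ≫ θ).hom fun r hr ↦ by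
      have : ρ.hom r ∈ RingHom.ker θ.hom := hker ▸ Ideal.mem_map_of_mem _ hr
      exact this)
  have hχ : CommRingCat.ofHom (Ideal.Quotient.mk _) ≫ χ = ρ ≫ θ :=
    CommRingCat.hom_ext (Ideal.Quotient.lift_comp_mk _ _ _)
  have hP := isPullback_SpecMap_of_isPushout _ _ _ _ (isPushout_quotient ρ θ hθ _ hker χ hχ)
  have hw : (Spec.map θ ≫ j) ≫ s = Spec.map χ ≫ Spec.map (CommRingCat.ofHom
      (Ideal.Quotient.mk (maximalIdeal R ^ (n + 1)))) := by
    rw [Category.assoc, ← hρ, ← Spec.map_comp, ← Spec.map_comp, hχ]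
  have hk1 : pullback.lift _ _ hw ≫ fiberι s n = Spec.map θ ≫ j := pullback.lift_fst _ _ _
  have hk2 : pullback.lift _ _ hw ≫ pullback.snd _ _ = Spec.map χ := pullback.lift_snd _ _ _
  have hQ : IsPullback (pullback.lift _ _ hw) (Spec.map θ) (fiberι s n) j := by
    refine IsPullback.of_right (h₁₂ := fiberStr s n) (h₂₂ := s) ?_ hk1
      (IsPullback.of_hasPullback s _).flip
    rw [hk2, ← hρ]
    exact hP.flip
  refine ⟨_, MorphismProperty.of_isPullback hQ.flip inferInstance, hk1,
    range_eq_preimage_range_of_isPullback hQ⟩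

lemma exists_truncation {A C' : Type u} [CommRing A] [CommRing C'] {J : Type u} {m : Ideal A}
    (f : A) (x : J → A) (κ : A →+* C') (hκ : Function.Surjective κ)
    (hx : Ideal.span (Set.range x) = m) (hx' : ∀ j, x j ∈ m)
    {π : A} {n l j : ℕ} (hker : RingHom.ker κ = Ideal.span {π ^ (n + l)}) (hπ : π ^ l ∈ m ^ j)
    (htors : ∀ (F : MvPolynomial J A) (k : ℕ), .C f ^ k * F ∈ ratioIdeal x f →
      .C f ^ j * F ∈ ratioIdeal x f)
    (hf : f ∈ m) {𝔞 : Ideal C'} (h𝔞 : 𝔞 = Ideal.span {κ (π ^ n)}) :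
    ∃ θ : blowUpAlgebra m f →+* MvPolynomial J C' ⧸ chartIdeal (κ f) (fun i ↦ κ (x i)) 𝔞 j,
      Function.Surjective θ ∧ RingHom.ker θ = Ideal.span {algebraMap A _ (π ^ n)} ∧
      (∀ a, θ (algebraMap A _ a) = Ideal.Quotient.mk _ (.C (κ a))) ∧
      ∀ i, θ (blowUpAlgebra.frac f (hx' i)) = Ideal.Quotient.mk _ (.X i) := by
  obtain ⟨e, he⟩ := exists_chartIdeal_quotient_equiv f x κ hκ hx hx' hker hπ htors hf h𝔞
  refine ⟨e.symm.toRingHom.comp (Ideal.Quotient.mk _),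
    e.symm.surjective.comp Ideal.Quotient.mk_surjective, ?_, fun a ↦ ?_, fun i ↦ ?_⟩
  · ext z
    rw [RingHom.mem_ker, RingHom.comp_apply]
    exact (map_eq_zero_iff _ e.symm.injective).trans Ideal.Quotient.eq_zero_iff_mem
  · have := he (.C a)
    rw [MvPolynomial.map_C, ratioEval, MvPolynomial.algHom_C] at this
    exact (e.symm_apply_eq).mpr this.symm
  · have := he (.X i)
    rw [MvPolynomial.map_X, ratioEval, MvPolynomial.aeval_X] at this
    exact (e.symm_apply_eq).mpr this.symm

/-- The coordinate ring of a truncated chart. -/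
abbrev truncChartRing (C : CommRingCat.{u}) {J : Type u} (c : J → C) (𝔞 : Ideal C) (j : ℕ) (i : J) :
    CommRingCat.{u} :=
  .of (MvPolynomial J C ⧸ chartIdeal (c i) c 𝔞 j)

/-- The structure homomorphism of the coordinate ring of a truncated chart. -/
abbrev truncChartRingHom (C : CommRingCat.{u}) {J : Type u} (c : J → C) (𝔞 : Ideal C) (j : ℕ)
    (i : J) : C ⟶ truncChartRing C c 𝔞 j i :=
  CommRingCat.ofHom ((Ideal.Quotient.mk (chartIdeal (c i) c 𝔞 j)).comp MvPolynomial.C)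

/-- The `X`-scheme `F` is over the open piece `w : Spec C ⟶ X` the gluing of the truncated charts
given by `c`, `𝔞` and `j`. -/
structure IsTruncAtlas {C : CommRingCat.{u}} {J : Type u} (c : J → C) (𝔞 : Ideal C) (j : ℕ)
    {F X : Scheme.{u}} (b : F ⟶ X) (w : Spec C ⟶ X)
    (k : ∀ i, Spec (truncChartRing C c 𝔞 j i) ⟶ F) : Prop where
  isOpenImmersion : ∀ i, IsOpenImmersion (k i)
  comp_eq : ∀ i, k i ≫ b = Spec.map (truncChartRingHom C c 𝔞 j i) ≫ w
  exists_mem_range : ∀ y, b y ∈ Set.range w → ∃ i, y ∈ Set.range (k i)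
  comp_eq_comp_iff : ∀ (T : Scheme.{u}) (i i' : J) (α : T ⟶ Spec (truncChartRing C c 𝔞 j i))
    (β : T ⟶ Spec (truncChartRing C c 𝔞 j i')), α ≫ k i = β ≫ k i' ↔
      (∀ z : C, toΓ α (Ideal.Quotient.mk _ (.C z)) = toΓ β (Ideal.Quotient.mk _ (.C z))) ∧
      ∀ z : J, toΓ α (Ideal.Quotient.mk _ (.X z)) =
        toΓ β (Ideal.Quotient.mk _ (.X z)) * toΓ α (Ideal.Quotient.mk _ (.X i'))

/-- The charts and gluing relation of the atlas involve only `C`, `c`, `𝔞` and `j`, so this makes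
precise that the truncation determines the fiber over a neighbourhood of the center. The family `x`
runs through all elements of the center ideal, because each of them is also the denominator of a
chart. -/
theorem exists_isTruncAtlas {R : Type u} [CommRing R] [IsLocalRing R] {π : R}
    (hπR : maximalIdeal R = Ideal.span {π}) {Y' Y X : Scheme.{u}} (s : Y ⟶ Spec (CommRingCat.of R))
    {p : Y' ⟶ Y} {I : Y.IdealSheafData} (hp : IsBlowUp p I) {V : Y.Opens} (hV : IsAffineOpen V)
    (ρ : CommRingCat.of R ⟶ Γ(Y, V)) (hρ : Spec.map ρ = hV.fromSpec ≫ s)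
    {C : CommRingCat.{u}} (κ : Γ(Y, V) ⟶ C) (hκ : Function.Surjective κ.hom) {N l j : ℕ}
    (hker : RingHom.ker κ.hom = Ideal.span {ρ.hom π ^ (N + 1 + l)})
    {J : Type u} (x : J → Γ(Y, V)) (hx : Set.range x = (I.ideal ⟨V, hV⟩ : Set Γ(Y, V)))
    (hπ : ρ.hom π ^ l ∈ I.ideal ⟨V, hV⟩ ^ j)
    (htors : ∀ f ∈ I.ideal ⟨V, hV⟩, ∀ (F : MvPolynomial J Γ(Y, V)) (k : ℕ),
      .C f ^ k * F ∈ ratioIdeal x f → .C f ^ j * F ∈ ratioIdeal x f)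
    {𝔞 : Ideal C} (h𝔞 : 𝔞 = Ideal.span {κ.hom (ρ.hom π ^ (N + 1))})
    {c : J → C} (hc : ∀ i, κ.hom (x i) = c i)
    (a : X ⟶ Y) [Mono a] (b : fiber (p ≫ s) N ⟶ X) (hb : b ≫ a = fiberι (p ≫ s) N ≫ p)
    (w : Spec C ⟶ X) (hw : w ≫ a = Spec.map κ ≫ hV.fromSpec) :
    ∃ k, IsTruncAtlas c 𝔞 j b w k := by
  obtain rfl : (fun i ↦ κ.hom (x i)) = c := funext hc
  have hxm (i : J) : x i ∈ I.ideal ⟨V, hV⟩ := by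
    rw [← SetLike.mem_coe, ← hx]
    exact ⟨i, rfl⟩
  have hspan : Ideal.span (Set.range x) = I.ideal ⟨V, hV⟩ := by rw [hx, Ideal.span_eq]
  choose θ hθ hθker hθC hθX using fun i ↦ exists_truncation (x i) x κ.hom hκ hspan hxm hker hπ
    (htors _ (hxm i)) (hxm i) h𝔞
  have hopen (i : J) := exists_isOpenImmersion_fiber (p ≫ s) (chart hp hV (hxm i))
    (ρ ≫ chartRingHom hV I (x i)) (by
      rw [Spec.map_comp, hρ, reassoc_of% (chart_comp hp hV (hxm i))])
    (CommRingCat.ofHom (θ i)) (hθ i) N (by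
      rw [hπR, Ideal.span_singleton_pow, Ideal.map_span, Set.image_singleton]
      refine (hθker i).trans ?_
      rw [CommRingCat.hom_comp, RingHom.comp_apply, map_pow ρ.hom]
      rfl)
  choose k hkopen hk hkrange using hopen
  refine ⟨k, hkopen, fun i ↦ ?_, fun y hy ↦ ?_, fun T i i' α β ↦ ?_⟩
  · rw [← cancel_mono a, Category.assoc, Category.assoc, hb, reassoc_of% hk i, chart_comp, hw,
      ← Spec.map_comp_assoc, ← Spec.map_comp_assoc]
    congr 2
    exact CommRingCat.hom_ext (RingHom.ext (hθC i))
  · have hy' : p (fiberι (p ≫ s) N y) ∈ V := by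
      obtain ⟨v, hv⟩ := hy
      rw [← Scheme.Hom.comp_apply, ← hb, Scheme.Hom.comp_apply, ← hv, ← Scheme.Hom.comp_apply, hw,
        Scheme.Hom.comp_apply, ← SetLike.mem_coe, ← hV.range_fromSpec]
      exact ⟨_, rfl⟩
    obtain ⟨f, hf, hmem⟩ := exists_chart_mem hp hV _ hy'
    obtain ⟨i, rfl⟩ : f ∈ Set.range x := hx ▸ hf
    exact ⟨i, by rw [hkrange i]; exact hmem⟩
  · rw [← cancel_mono (fiberι (p ≫ s) N), Category.assoc, Category.assoc, hk, hk, ← Category.assoc,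
      ← Category.assoc, comp_chart_eq_comp_chart_iff hp hV (hxm i) (hxm i')]
    have hC (i : J) (α : T ⟶ _) (z : Γ(Y, V)) :
        toΓ (α ≫ Spec.map (CommRingCat.ofHom (θ i))) (algebraMap _ _ z) =
          toΓ α (Ideal.Quotient.mk _ (.C (κ.hom z))) :=
      (toΓ_comp_SpecMap _ _ _).trans (congrArg (toΓ α) (hθC i z))
    have hX (i : J) (α : T ⟶ _) (z : J) :
        toΓ (α ≫ Spec.map (CommRingCat.ofHom (θ i))) (blowUpAlgebra.frac (x i) (hxm z)) =
          toΓ α (Ideal.Quotient.mk _ (.X z)) :=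
      (toΓ_comp_SpecMap _ _ _).trans (congrArg (toΓ α) (hθX i z))
    refine and_congr ⟨fun h z ↦ ?_, fun h z ↦ ?_⟩ ⟨fun h z ↦ ?_, fun h z hz ↦ ?_⟩
    · obtain ⟨z, rfl⟩ := hκ z
      exact (hC i α z).symm.trans ((h z).trans (hC i' β z))
    · exact (hC i α z).trans ((h _).trans (hC i' β z).symm)
    · have := h (x z) (hxm z)
      rwa [hX, hX, hX] at this
    · obtain ⟨z, rfl⟩ : z ∈ Set.range x := hx ▸ hz
      rw [hX, hX, hX]
      exact h z

/-! ### Gluing isomorphisms. -/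

/-- The open cover given by a jointly surjective family of open immersions. -/
def openCoverOfFamily {ι : Type u} {F : Scheme.{u}} {S : ι → Scheme.{u}} (k : ∀ i, S i ⟶ F)
    (hk : ∀ i, IsOpenImmersion (k i)) (hsurj : ∀ y, ∃ i, y ∈ Set.range (k i)) : F.OpenCover :=
  ⟨⟨ι, S, k⟩, ⟨by simpa using hsurj, by simpa⟩⟩

lemma hom_ext_of_family {ι : Type u} {F G : Scheme.{u}} {S : ι → Scheme.{u}} (k : ∀ i, S i ⟶ F)
    (hk : ∀ i, IsOpenImmersion (k i)) (hsurj : ∀ y, ∃ i, y ∈ Set.range (k i)) {a b : F ⟶ G}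
    (h : ∀ i, k i ≫ a = k i ≫ b) : a = b :=
  Scheme.Cover.hom_ext (openCoverOfFamily k hk hsurj) _ _ h

/-- Two schemes glued from the same pieces along the same gluing relation are isomorphic. -/
theorem exists_iso_of_families {ι : Type u} {F₁ F₂ : Scheme.{u}} {S : ι → Scheme.{u}}
    (k₁ : ∀ i, S i ⟶ F₁) (k₂ : ∀ i, S i ⟶ F₂)
    (h₁ : ∀ i, IsOpenImmersion (k₁ i)) (h₂ : ∀ i, IsOpenImmersion (k₂ i))
    (hsurj₁ : ∀ y, ∃ i, y ∈ Set.range (k₁ i)) (hsurj₂ : ∀ y, ∃ i, y ∈ Set.range (k₂ i))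
    (hrel : ∀ (T : Scheme.{u}) (i i' : ι) (α : T ⟶ S i) (β : T ⟶ S i'),
      α ≫ k₁ i = β ≫ k₁ i' ↔ α ≫ k₂ i = β ≫ k₂ i')
    {X : Scheme.{u}} (b₁ : F₁ ⟶ X) (b₂ : F₂ ⟶ X) (hb : ∀ i, k₁ i ≫ b₁ = k₂ i ≫ b₂) :
    ∃ E : F₁ ≅ F₂, E.hom ≫ b₂ = b₁ := by
  let 𝒰₁ := openCoverOfFamily k₁ h₁ hsurj₁
  let 𝒰₂ := openCoverOfFamily k₂ h₂ hsurj₂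
  obtain ⟨g, hg⟩ : ∃ g : F₁ ⟶ F₂, ∀ i, k₁ i ≫ g = k₂ i :=
    ⟨Scheme.Cover.glueMorphisms 𝒰₁ k₂ fun i i' ↦ (hrel _ i i' _ _).mp pullback.condition,
      fun i ↦ Scheme.Cover.ι_glueMorphisms 𝒰₁ k₂ _ i⟩
  obtain ⟨h, hh⟩ : ∃ h : F₂ ⟶ F₁, ∀ i, k₂ i ≫ h = k₁ i :=
    ⟨Scheme.Cover.glueMorphisms 𝒰₂ k₁ fun i i' ↦ (hrel _ i i' _ _).mpr pullback.condition,
      fun i ↦ Scheme.Cover.ι_glueMorphisms 𝒰₂ k₁ _ i⟩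
  refine ⟨⟨g, h, hom_ext_of_family k₁ h₁ hsurj₁ fun i ↦ ?_,
    hom_ext_of_family k₂ h₂ hsurj₂ fun i ↦ ?_⟩, hom_ext_of_family k₁ h₁ hsurj₁ fun i ↦ ?_⟩
  · rw [reassoc_of% hg i, hh, Category.comp_id]
  · rw [reassoc_of% hh i, hg, Category.comp_id]
  · rw [reassoc_of% hg i, hb]

/-- Two `X`-schemes with the same truncated charts near a closed point `x` that represent the same
functor away from `x` are isomorphic. -/
theorem exists_iso_of_isTruncAtlas {C : CommRingCat.{u}} {J : Type u} {c : J → C} {𝔞 : Ideal C}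
    {j : ℕ} {F₁ F₂ X : Scheme.{u}} {b₁ : F₁ ⟶ X} {b₂ : F₂ ⟶ X} {w : Spec C ⟶ X} {k₁ k₂}
    (h₁ : IsTruncAtlas c 𝔞 j b₁ w k₁) (h₂ : IsTruncAtlas c 𝔞 j b₂ w k₂)
    {x : X} (hx : IsClosed {x}) (hxw : x ∈ Set.range w)
    (hu₁ : ∀ (T : Scheme.{u}) (α β : T ⟶ F₁), (∀ t, (α ≫ b₁) t ≠ x) → α ≫ b₁ = β ≫ b₁ → α = β)
    (hu₂ : ∀ (T : Scheme.{u}) (α β : T ⟶ F₂), (∀ t, (α ≫ b₂) t ≠ x) → α ≫ b₂ = β ≫ b₂ → α = β)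
    (he₂ : ∀ (T : Scheme.{u}) (α : T ⟶ F₁), (∀ t, (α ≫ b₁) t ≠ x) →
      ∃ β : T ⟶ F₂, β ≫ b₂ = α ≫ b₁)
    (he₁ : ∀ (T : Scheme.{u}) (α : T ⟶ F₂), (∀ t, (α ≫ b₂) t ≠ x) →
      ∃ β : T ⟶ F₁, β ≫ b₁ = α ≫ b₂) :
    ∃ E : F₁ ≅ F₂, E.hom ≫ b₂ = b₁ := by
  let U : X.Opens := ⟨{x}ᶜ, hx.isOpen_compl⟩
  let O₁ : F₁.Opens := b₁ ⁻¹ᵁ U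
  let O₂ : F₂.Opens := b₂ ⁻¹ᵁ U
  have hO₁ (t : O₁.toScheme) : (O₁.ι ≫ b₁) t ≠ x := t.2
  have hO₂ (t : O₂.toScheme) : (O₂.ι ≫ b₂) t ≠ x := t.2
  obtain ⟨g, hg⟩ := he₂ _ O₁.ι hO₁
  obtain ⟨h, hh⟩ := he₁ _ O₂.ι hO₂
  have hgO : Set.range g ⊆ Set.range O₂.ι := by
    rintro _ ⟨t, rfl⟩
    rw [Scheme.Opens.range_ι]
    change b₂ (g t) ≠ x
    rw [← Scheme.Hom.comp_apply, hg]
    exact hO₁ t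
  have hhO : Set.range h ⊆ Set.range O₁.ι := by
    rintro _ ⟨t, rfl⟩
    rw [Scheme.Opens.range_ι]
    change b₁ (h t) ≠ x
    rw [← Scheme.Hom.comp_apply, hh]
    exact hO₂ t
  let g' := IsOpenImmersion.lift O₂.ι g hgO
  let h' := IsOpenImmersion.lift O₁.ι h hhO
  have hg' : g' ≫ O₂.ι = g := IsOpenImmersion.lift_fac _ _ _
  have hh' : h' ≫ O₁.ι = h := IsOpenImmersion.lift_fac _ _ _
  -- Away from `x` both schemes represent the same functor over `X`, so the parts lying there are
  -- isomorphic.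
  have hgh : g' ≫ h' = 𝟙 _ := by
    rw [← cancel_mono O₁.ι, Category.assoc, hh', Category.id_comp]
    refine (hu₁ _ _ _ hO₁ ?_).symm
    rw [Category.assoc, hh, reassoc_of% hg', hg]
  have hhg : h' ≫ g' = 𝟙 _ := by
    rw [← cancel_mono O₂.ι, Category.assoc, hg', Category.id_comp]
    refine (hu₂ _ _ _ hO₂ ?_).symm
    rw [Category.assoc, hg, reassoc_of% hh', hh]
  have hiso : IsIso g' := ⟨h', hgh, hhg⟩
  have hgopen : IsOpenImmersion g := hg' ▸ inferInstance
  have hb (i : J) : k₁ i ≫ b₁ = k₂ i ≫ b₂ := by rw [h₁.comp_eq, h₂.comp_eq]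
  have hrel {T : Scheme.{u}} (i : J) (α : T ⟶ O₁.toScheme) (β : T ⟶ _) :
      α ≫ O₁.ι = β ≫ k₁ i ↔ α ≫ g = β ≫ k₂ i := by
    have hα (t : T) : (α ≫ O₁.ι ≫ b₁) t ≠ x := by
      rw [Scheme.Hom.comp_apply]
      exact hO₁ _
    constructor
    · intro H
      refine hu₂ _ _ _ (by rw [Category.assoc, hg]; exact hα) ?_
      rw [Category.assoc, hg, reassoc_of% H, hb, Category.assoc]
    · intro H
      refine hu₁ _ _ _ (by rw [Category.assoc]; exact hα) ?_
      rw [Category.assoc, ← hg, reassoc_of% H, ← hb, Category.assoc]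
  -- The index `none` carries the part away from `x`, and `some i` the truncated charts.
  let S : Option J → Scheme.{u}
    | none => O₁.toScheme
    | some i => Spec (truncChartRing C c 𝔞 j i)
  let K₁ : ∀ i, S i ⟶ F₁
    | none => O₁.ι
    | some i => k₁ i
  let K₂ : ∀ i, S i ⟶ F₂
    | none => g
    | some i => k₂ i
  refine exists_iso_of_families (S := S) K₁ K₂ ?_ ?_ ?_ ?_ ?_ b₁ b₂ ?_
  · rintro (_ | i)
    exacts [inferInstanceAs (IsOpenImmersion O₁.ι), h₁.isOpenImmersion i]
  · rintro (_ | i)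
    exacts [hgopen, h₂.isOpenImmersion i]
  · intro y
    by_cases hy : b₁ y = x
    · obtain ⟨i, hi⟩ := h₁.exists_mem_range y (hy ▸ hxw)
      exact ⟨some i, hi⟩
    · exact ⟨none, ⟨y, hy⟩, rfl⟩
  · intro y
    by_cases hy : b₂ y = x
    · obtain ⟨i, hi⟩ := h₂.exists_mem_range y (hy ▸ hxw)
      exact ⟨some i, hi⟩
    · have hι : h' ≫ g = O₂.ι := by rw [← hg', reassoc_of% hhg]
      have hy' : y ∈ O₂ := hy
      exact ⟨none, h' ⟨y, hy'⟩,
        (Scheme.Hom.comp_apply h' g _).symm.trans (congrArg (· ⟨y, hy'⟩) hι)⟩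
  · rintro T (_ | i) (_ | i') α β
    · change α ≫ O₁.ι = β ≫ O₁.ι ↔ α ≫ g = β ≫ g
      rw [cancel_mono, cancel_mono]
    · exact hrel i' α β
    · exact eq_comm.trans ((hrel i β α).trans eq_comm)
    · exact (h₁.comp_eq_comp_iff T i i' α β).trans (h₂.comp_eq_comp_iff T i i' α β).symm
  · rintro (_ | i)
    exacts [hg.symm, hb i]

/-! ### Multiplicities computed from a local equation. -/

section Multiplicity

variable {X : Scheme.{u}} (I : X.IdealSheafData) (x : X) (V : X.affineOpens) (hx : x ∈ V.1)
  {s : Γ(X, V.1)} (hI : I.ideal V = Ideal.span {s})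

include hI in
-- A section on another affine open becomes a multiple of `s` on a smaller basic open containing
-- `x`, so one local generator suffices.
lemma germ_mem_pow_iff (n : ℕ) :
    (∀ (W : X.affineOpens) (hx : x ∈ W.1), ∀ t ∈ I.ideal W,
      X.presheaf.germ W.1 x hx t ∈ maximalIdeal (X.presheaf.stalk x) ^ n) ↔
    X.presheaf.germ V.1 x hx s ∈ maximalIdeal (X.presheaf.stalk x) ^ n := by
  refine ⟨fun h ↦ h V hx s (hI ▸ Ideal.mem_span_singleton_self s), fun h W hxW t ht ↦ ?_⟩
  obtain ⟨r, hr, hxr⟩ := W.2.exists_basicOpen_le (V := V.1) ⟨x, hx⟩ hxW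
  have hle : X.basicOpen r ≤ W.1 := X.basicOpen_le r
  have h1 : X.presheaf.map (homOfLE hle).op t ∈ I.ideal ⟨_, W.2.basicOpen r⟩ := by
    rw [← I.map_ideal (U := ⟨_, W.2.basicOpen r⟩) (V := W) hle]
    exact Ideal.mem_map_of_mem _ ht
  rw [← I.map_ideal (U := ⟨_, W.2.basicOpen r⟩) (V := V) hr, hI, Ideal.map_span,
    Set.image_singleton] at h1
  obtain ⟨d, hd⟩ := Ideal.mem_span_singleton.mp h1
  have h2 := congrArg (X.presheaf.germ _ x hxr).hom hd
  rw [map_mul] at h2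
  have h3 : (X.presheaf.germ (X.basicOpen r) x hxr).hom (X.presheaf.map (homOfLE hle).op t) =
      X.presheaf.germ W.1 x hxW t := X.presheaf.germ_res_apply _ _ _ _
  have h4 : (X.presheaf.germ (X.basicOpen r) x hxr).hom ((X.presheaf.map (homOfLE hr).op).hom s) =
      X.presheaf.germ V.1 x hx s := X.presheaf.germ_res_apply (homOfLE hr) _ _ _
  rw [← h3]
  refine h2 ▸ Ideal.mul_mem_right _ _ ?_
  exact h4 ▸ h

include hI in
-- By Krull's intersection theorem a nonzero germ has finite order, so the `sSup` is an attained
-- maximum and not the default value of an unbounded set.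
lemma germ_mem_pow_multiplicityAt [IsNoetherianRing (X.presheaf.stalk x)]
    (hs : X.presheaf.germ V.1 x hx s ≠ 0) :
    X.presheaf.germ V.1 x hx s ∈ maximalIdeal (X.presheaf.stalk x) ^ multiplicityAt I x ∧
      X.presheaf.germ V.1 x hx s ∉
        maximalIdeal (X.presheaf.stalk x) ^ (multiplicityAt I x + 1) := by
  have hset : multiplicityAt I x = sSup {n | X.presheaf.germ V.1 x hx s ∈
      maximalIdeal (X.presheaf.stalk x) ^ n} :=
    congrArg sSup (Set.ext fun n ↦ germ_mem_pow_iff I x V hx hI n)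
  obtain ⟨n, hn⟩ : ∃ n, X.presheaf.germ V.1 x hx s ∉ maximalIdeal (X.presheaf.stalk x) ^ n := by
    by_contra! h
    refine hs ?_
    rw [← Ideal.mem_bot, ← Ideal.iInf_pow_eq_bot_of_isLocalRing _
      (maximalIdeal.isMaximal (X.presheaf.stalk x)).ne_top]
    exact Ideal.mem_iInf.mpr h
  have hbdd : BddAbove {n | X.presheaf.germ V.1 x hx s ∈
      maximalIdeal (X.presheaf.stalk x) ^ n} := by
    refine ⟨n, fun k hk ↦ ?_⟩
    by_contra! hkn
    exact hn (Ideal.pow_le_pow_right hkn.le hk)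
  rw [hset]
  refine ⟨Nat.sSup_mem ⟨0, by simp⟩ hbdd, fun h ↦ ?_⟩
  have h' := le_csSup hbdd (Set.mem_ofPred.mpr h)
  exact absurd h' (Nat.not_succ_le_self _)

end Multiplicity

/-! ### Structure maps on sections and stalks; kernels of closed immersions. -/

section StalkStructure

variable {R : Type u} [CommRing R] {Y Z : Scheme.{u}}

/-- The structure homomorphism of the ring of sections over an open subset. -/
def sectionStr (s : Y ⟶ Spec (CommRingCat.of R)) (V : Y.Opens) : CommRingCat.of R ⟶ Γ(Y, V) :=
  (Scheme.ΓSpecIso _).inv ≫ s.appTop ≫ Y.presheaf.map (homOfLE le_top).op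

/-- The structure homomorphism of a local ring. -/
def stalkStr (s : Y ⟶ Spec (CommRingCat.of R)) (y : Y) : CommRingCat.of R ⟶ Y.presheaf.stalk y :=
  (Scheme.ΓSpecIso _).inv ≫ s.appTop ≫ Y.presheaf.germ ⊤ y (Opens.mem_top y)

lemma sectionStr_germ (s : Y ⟶ Spec (CommRingCat.of R)) (V : Y.Opens) (y : Y) (hy : y ∈ V) :
    sectionStr s V ≫ Y.presheaf.germ V y hy = stalkStr s y := by
  rw [stalkStr, sectionStr, Category.assoc, Category.assoc]
  exact congrArg _ (congrArg _ (TopCat.Presheaf.germ_res _ _ _ _))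

lemma sectionStr_eq (s : Y ⟶ Spec (CommRingCat.of R)) (V : Y.Opens) (h : V ≤ s ⁻¹ᵁ ⊤) :
    sectionStr s V = (Scheme.ΓSpecIso _).inv ≫ s.appLE ⊤ V h := rfl

lemma SpecMap_sectionStr (s : Y ⟶ Spec (CommRingCat.of R)) {V : Y.Opens} (hV : IsAffineOpen V) :
    Spec.map (sectionStr s V) = hV.fromSpec ≫ s := by
  have h : V ≤ s ⁻¹ᵁ ⊤ := le_top (a := V)
  rw [sectionStr_eq s V h, Spec.map_comp, ← IsAffineOpen.SpecMap_appLE_fromSpec s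
    (isAffineOpen_top (Spec (CommRingCat.of R))) hV h, IsAffineOpen.fromSpec_top,
    Scheme.isoSpec_Spec_inv]

lemma stalkStr_comp (h : Z ⟶ Y) (s : Y ⟶ Spec (CommRingCat.of R)) (z : Z) :
    stalkStr (h ≫ s) z = stalkStr s (h z) ≫ h.stalkMap z := by
  rw [stalkStr, stalkStr, Category.assoc, Category.assoc, Scheme.Hom.comp_appTop, Category.assoc]
  exact congrArg _ (congrArg _ (Scheme.Hom.germ_stalkMap h ⊤ z (Opens.mem_top _)).symm)

lemma stalkStr_mem_maximalIdeal [IsLocalRing R] (s : Y ⟶ Spec (CommRingCat.of R)) {y : Y}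
    (hy : s y = closedPoint R) {r : R} (hr : r ∈ maximalIdeal R) :
    (stalkStr s y).hom r ∈ maximalIdeal (Y.presheaf.stalk y) := by
  rw [mem_maximalIdeal, mem_nonunits_iff]
  intro hu
  have h1 : y ∈ Y.basicOpen (s.appTop ((Scheme.ΓSpecIso (CommRingCat.of R)).inv r)) :=
    (Scheme.mem_basicOpen _ _ _ (Opens.mem_top y)).mpr hu
  rw [← Scheme.preimage_basicOpen_top, basicOpen_eq_of_affine] at h1
  have h2 : s y ∈ PrimeSpectrum.basicOpen r := h1
  rw [hy] at h2
  exact h2 hr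

lemma germ_mem_nonZeroDivisors {V : Y.Opens} (hV : IsAffineOpen V) {y : Y} (hy : y ∈ V)
    {a : Γ(Y, V)} (ha : a ∈ nonZeroDivisors Γ(Y, V)) :
    (Y.presheaf.germ V y hy).hom a ∈ nonZeroDivisors (Y.presheaf.stalk y) := by
  let _ := Y.presheaf.algebra_section_stalk ⟨y, hy⟩
  have := hV.isLocalization_stalk ⟨y, hy⟩
  exact IsLocalization.map_nonZeroDivisors_le (hV.primeIdealOf ⟨y, hy⟩).asIdeal.primeCompl
    (Y.presheaf.stalk y) ⟨a, ha, rfl⟩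

lemma stalkStr_mem_nonZeroDivisors (s : Y ⟶ Spec (CommRingCat.of R)) [Flat s] (y : Y) {r : R}
    (hr : r ∈ nonZeroDivisors R) :
    (stalkStr s y).hom r ∈ nonZeroDivisors (Y.presheaf.stalk y) := by
  obtain ⟨V, hV, hyV, -⟩ := exists_isAffineOpen_mem_and_subset (x := y) (U := ⊤) trivial
  rw [← sectionStr_germ s V y hyV]
  refine germ_mem_nonZeroDivisors hV hyV ?_
  have hfl : Flat (Spec.map (sectionStr s V)) := by
    rw [SpecMap_sectionStr s hV]
    infer_instance
  exact (Flat.SpecMap_iff.mp hfl).map_mem_nonZeroDivisors hr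

end StalkStructure

lemma fiberι_ker_ideal {R : Type u} [CommRing R] [IsLocalRing R] {π : R}
    (hπ : maximalIdeal R = Ideal.span {π}) {Z : Scheme.{u}} (g : Z ⟶ Spec (CommRingCat.of R))
    (V : Z.affineOpens) : (fiberι g 0).ker.ideal V = Ideal.span {(sectionStr g V.1).hom π} := by
  rw [Scheme.IdealSheafData.ker_fst_of_isClosedImmersion]
  have h : V.1 ≤ g ⁻¹ᵁ ⊤ := le_top (a := V.1)
  have h1 : RingHom.ker ((Spec.map (CommRingCat.ofHom
      (Ideal.Quotient.mk (maximalIdeal R ^ (0 + 1))))).app ⊤).hom =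
      Ideal.span {(Scheme.ΓSpecIso (CommRingCat.of R)).inv.hom π} := by
    have h2 : RingHom.ker (Ideal.Quotient.mk (maximalIdeal R ^ (0 + 1))) = Ideal.span {π} := by
      rw [Ideal.mk_ker, zero_add, pow_one, hπ]
    ext z
    let e := (Scheme.ΓSpecIso (CommRingCat.of R)).symm.commRingCatIsoToRingEquiv
    let e' := (Scheme.ΓSpecIso (CommRingCat.of (R ⧸ maximalIdeal R ^ (0 + 1)))
      ).symm.commRingCatIsoToRingEquiv
    obtain ⟨z, rfl⟩ := e.surjective z
    have h3 := congr($(Scheme.ΓSpecIso_inv_naturality (CommRingCat.ofHom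
      (Ideal.Quotient.mk (maximalIdeal R ^ (0 + 1))))).hom z)
    change e' (Ideal.Quotient.mk _ z) = ((Spec.map (CommRingCat.ofHom
      (Ideal.Quotient.mk (maximalIdeal R ^ (0 + 1))))).app ⊤).hom (e z) at h3
    change _ ↔ e z ∈ Ideal.span {e π}
    rw [RingHom.mem_ker, ← h3]
    refine (map_eq_zero_iff e' e'.injective).trans ?_
    rw [Ideal.mem_span_singleton, map_dvd_iff, ← Ideal.mem_span_singleton]
    exact h2 ▸ Iff.rfl
  rw [ideal_comap _ g ⟨⊤, isAffineOpen_top _⟩ V h, Scheme.Hom.ker_apply, h1, Ideal.map_span,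
    Set.image_singleton]
  rfl

lemma germ_eq_mul_inv {Z : Scheme.{u}} {V : Z.Opens} (hV : IsAffineOpen V) {z : Z} (hz : z ∈ V)
    (b : Z.presheaf.stalk z) : ∃ a t : Γ(Z, V), IsUnit (Z.presheaf.germ V z hz t) ∧
      b * Z.presheaf.germ V z hz t = Z.presheaf.germ V z hz a := by
  let _ := Z.presheaf.algebra_section_stalk ⟨z, hz⟩
  have := hV.isLocalization_stalk ⟨z, hz⟩
  obtain ⟨⟨a, t⟩, h⟩ := IsLocalization.surj (hV.primeIdealOf ⟨z, hz⟩).asIdeal.primeCompl b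
  exact ⟨a, t, IsLocalization.map_units (Z.presheaf.stalk z) t, h⟩

lemma exists_mul_eq_zero_of_germ_eq_zero {Z : Scheme.{u}} {V : Z.Opens} (hV : IsAffineOpen V)
    {z : Z} (hz : z ∈ V) {a : Γ(Z, V)} (ha : Z.presheaf.germ V z hz a = 0) :
    ∃ t : Γ(Z, V), IsUnit (Z.presheaf.germ V z hz t) ∧ t * a = 0 := by
  let _ := Z.presheaf.algebra_section_stalk ⟨z, hz⟩
  have := hV.isLocalization_stalk ⟨z, hz⟩
  obtain ⟨t, ht⟩ := (IsLocalization.map_eq_zero_iff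
    (hV.primeIdealOf ⟨z, hz⟩).asIdeal.primeCompl (Z.presheaf.stalk z) a).mp ha
  exact ⟨t, IsLocalization.map_units (Z.presheaf.stalk z) t, ht⟩

/-- A germ in the kernel is a fraction whose numerator is killed by a denominator on `U`. That
denominator lifts to `V` because `i` is closed, and its lift is a unit at `i y` because the stalk
map is local. -/
lemma ker_stalkMap {U Z : Scheme.{u}} (i : U ⟶ Z) [IsClosedImmersion i] (y : U)
    (V : Z.affineOpens) (hy : i y ∈ V.1) :
    RingHom.ker (i.stalkMap y).hom = (i.ker.ideal V).map (Z.presheaf.germ V.1 (i y) hy).hom := by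
  apply le_antisymm
  · intro b hb
    obtain ⟨a, t, ht, hbt⟩ := germ_eq_mul_inv V.2 hy b
    have h1 : U.presheaf.germ (i ⁻¹ᵁ V.1) y hy (i.app V.1 a) = 0 := by
      rw [← Scheme.Hom.germ_stalkMap_apply, ← hbt, map_mul]
      exact mul_eq_zero_of_left (RingHom.mem_ker.mp hb) _
    obtain ⟨d, hd, hda⟩ := exists_mul_eq_zero_of_germ_eq_zero (V.2.preimage i) hy h1
    obtain ⟨d, rfl⟩ := i.app_surjective V.1 V.2 d
    have h2 : d * a ∈ i.ker.ideal V := by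
      rw [Scheme.Hom.ker_apply, RingHom.mem_ker, map_mul]
      exact hda
    have h3 : IsUnit (Z.presheaf.germ V.1 (i y) hy d) := by
      rw [← Scheme.Hom.germ_stalkMap_apply] at hd
      exact (isUnit_map_iff (i.stalkMap y).hom _).mp hd
    have h4 := Ideal.mem_map_of_mem (Z.presheaf.germ V.1 (i y) hy).hom h2
    rw [map_mul] at h4
    have h5 := (Ideal.unit_mul_mem_iff_mem _ h3).mp h4
    rw [← Ideal.mul_unit_mem_iff_mem _ ht, hbt]
    exact h5
  · rw [Ideal.map_le_iff_le_comap]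
    intro a ha
    rw [Scheme.Hom.ker_apply, RingHom.mem_ker] at ha
    rw [Ideal.mem_comap, RingHom.mem_ker]
    refine (Scheme.Hom.germ_stalkMap_apply i V.1 y hy a).trans ?_
    refine (congrArg _ ha).trans (map_zero _)

/-! ### Local consequences of a hypersurface presentation. -/

namespace HypersurfaceAt

variable {R : Type u} [CommRing R] {Y : Scheme.{u}}
  {f : Y ⟶ Spec (CommRingCat.of R)} {q : Y} (H : HypersurfaceAt f q)

/-- The homomorphism of local rings given by the embedding into the ambient scheme. -/
def stalkHom : H.Z.presheaf.stalk H.point ⟶ Y.presheaf.stalk q :=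
  H.i.stalkMap ⟨q, H.mem⟩ ≫ (H.U.stalkIso ⟨q, H.mem⟩).hom

lemma stalkHom_surjective : Function.Surjective H.stalkHom.hom := by
  have := H.isClosedImmersion
  exact (H.U.stalkIso ⟨q, H.mem⟩).commRingCatIsoToRingEquiv.surjective.comp
    (H.i.stalkMap_surjective ⟨q, H.mem⟩)

lemma ker_stalkHom (V : H.Z.affineOpens) (hV : H.point ∈ V.1) :
    RingHom.ker H.stalkHom.hom =
      (H.i.ker.ideal V).map (H.Z.presheaf.germ V.1 H.point hV).hom := by
  have := H.isClosedImmersion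
  refine Eq.trans ?_ (ker_stalkMap H.i ⟨q, H.mem⟩ V hV)
  exact RingHom.ker_comp_of_injective _
    (H.U.stalkIso ⟨q, H.mem⟩).commRingCatIsoToRingEquiv.injective

lemma stalkStr_stalkHom : stalkStr H.g H.point ≫ H.stalkHom = stalkStr f q := by
  have h (y : H.U.toScheme) :
      stalkStr H.g (H.i y) ≫ H.i.stalkMap y ≫ (H.U.stalkIso y).hom = stalkStr f (H.U.ι y) := by
    have h2 : H.U.ι.stalkMap y ≫ (H.U.stalkIso y).hom = 𝟙 _ :=
      (congrArg (· ≫ (H.U.stalkIso y).hom) (H.U.stalkIso_inv y).symm).trans (Iso.inv_hom_id _)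
    rw [← Category.assoc, ← stalkStr_comp, H.comp_eq, stalkStr_comp, Category.assoc]
    exact (congrArg _ h2).trans (Category.comp_id _)
  exact h ⟨q, H.mem⟩

/-- The local equation is a nonzerodivisor, so its order is finite; the order is positive, since a
unit equation would make the stalk of `Y` at `q` zero. -/
lemma isHypersurfaceOfOrder : IsHypersurfaceOfOrder (Y.presheaf.stalk q) H.mu := by
  have := H.regular H.point
  obtain ⟨V, hV, s, hs, hI⟩ := H.isEffectiveCartier H.point
  have hker : RingHom.ker H.stalkHom.hom =
      Ideal.span {(H.Z.presheaf.germ V.1 H.point hV).hom s} := by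
    rw [H.ker_stalkHom V hV, hI, Ideal.map_span, Set.image_singleton]
  have hnz := germ_mem_nonZeroDivisors V.2 hV hs
  obtain ⟨h1, h2⟩ := germ_mem_pow_multiplicityAt H.i.ker H.point V hV hI
    (nonZeroDivisors.ne_zero hnz)
  refine ⟨fun h0 ↦ h2 ?_, _, _, this, H.stalkHom.hom, _, H.stalkHom_surjective, hker, h1, h2⟩
  have h0' : multiplicityAt H.i.ker H.point = 0 := h0
  rw [h0', zero_add, pow_one, mem_maximalIdeal, mem_nonunits_iff]
  intro hu
  have h3 : H.stalkHom.hom ((H.Z.presheaf.germ V.1 H.point hV).hom s) = 0 :=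
    RingHom.mem_ker.mp (hker ▸ Ideal.mem_span_singleton_self _)
  exact (hu.map H.stalkHom.hom).ne_zero h3

variable [IsDomain R] [IsDiscreteValuationRing R]

/-- Flatness of `Y` makes `π` nonzero in its local ring, hence already in that of `Z`, so `r_E` is a
true order. It is positive because `q` lies on the closed fiber. -/
lemma stalkStr_mem_pow_rE [Flat f] (hfq : f q = closedPoint R) {π : R}
    (hπ : maximalIdeal R = Ideal.span {π}) (hπ0 : π ≠ 0) :
    (stalkStr f q).hom π ∈ maximalIdeal (Y.presheaf.stalk q) ^ H.rE ∧ H.rE ≠ 0 := by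
  have := H.regular H.point
  obtain ⟨V, hV, -⟩ := H.isEffectiveCartier H.point
  have hgerm : H.Z.presheaf.germ V.1 H.point hV ((sectionStr H.g V.1).hom π) =
      (stalkStr H.g H.point).hom π :=
    congrArg (fun φ ↦ φ.hom π) (sectionStr_germ H.g V.1 H.point hV)
  have hmap : H.stalkHom.hom ((stalkStr H.g H.point).hom π) = (stalkStr f q).hom π :=
    congrArg (fun φ ↦ φ.hom π) H.stalkStr_stalkHom
  have hne : (stalkStr H.g H.point).hom π ≠ 0 := by
    intro h0
    rw [h0, map_zero] at hmap
    exact nonZeroDivisors.ne_zero (stalkStr_mem_nonZeroDivisors f q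
      (mem_nonZeroDivisors_of_ne_zero hπ0)) hmap.symm
  obtain ⟨h1, h2⟩ := germ_mem_pow_multiplicityAt (fiberι H.g 0).ker H.point V hV
    (fiberι_ker_ideal hπ H.g V) (hgerm ▸ hne)
  rw [hgerm] at h1 h2
  constructor
  · rw [← hmap]
    have := Ideal.mem_map_of_mem H.stalkHom.hom h1
    rw [Ideal.map_pow] at this
    refine Ideal.pow_right_mono ?_ _ this
    have : IsLocalHom H.stalkHom.hom := H.stalkHom_surjective.isLocalHom
    exact map_maximalIdeal_le _
  · intro h0
    have h0' : multiplicityAt (fiberι H.g 0).ker H.point = 0 := h0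
    refine h2 ?_
    rw [h0', zero_add, pow_one]
    refine stalkStr_mem_maximalIdeal H.g ?_ (hπ ▸ Ideal.mem_span_singleton_self π)
    have h3 := congrArg (fun φ ↦ φ ⟨q, H.mem⟩) H.comp_eq
    exact h3.trans hfq

lemma mu_le {l : ℕ} (hc : H.c ≤ l) (hr : H.rE ≠ 0) : H.mu ≤ l * H.rE := by
  have h1 := Nat.ceil_le.mp hc
  rw [div_le_iff₀ (by positivity)] at h1
  exact_mod_cast h1

end HypersurfaceAt

lemma vanishingIdeal_singleton_ideal {Y : Scheme.{u}} {q : Y} (hq : IsClosed ({q} : Set Y))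
    {V : Y.Opens} (hV : IsAffineOpen V) (hqV : q ∈ V) :
    (Scheme.IdealSheafData.vanishingIdeal ⟨{q}, hq⟩).ideal ⟨V, hV⟩ =
      (hV.primeIdealOf ⟨q, hqV⟩).asIdeal := by
  rw [Scheme.IdealSheafData.vanishingIdeal_ideal, ← PrimeSpectrum.vanishingIdeal_singleton]
  congr 1
  ext y
  have h := hV.fromSpec.injective.eq_iff (a := y) (b := hV.primeIdealOf ⟨q, hqV⟩)
  rw [hV.fromSpec_primeIdealOf] at h
  exact h

/-- The two inputs of the chart comparison, with `μ = H.mu`: `π ^ l` has order at least `l r_E ≥ μ`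
in the local ring, and this descends to `V` because powers of a maximal ideal are primary; `f ^ μ`
kills the torsion. -/
theorem HypersurfaceAt.exists_order {R : Type u} [CommRing R] [IsDomain R]
    [IsDiscreteValuationRing R] {Y : Scheme.{u}} {f : Y ⟶ Spec (CommRingCat.of R)} [Flat f] {q : Y}
    (H : HypersurfaceAt f q) (hq : IsClosed ({q} : Set Y)) (hfq : f q = closedPoint R) {π : R}
    (hπ : maximalIdeal R = Ideal.span {π}) (hπ0 : π ≠ 0) {l : ℕ} (hc : H.c ≤ l)
    {V : Y.Opens} (hV : IsAffineOpen V) (hqV : q ∈ V) {m : Ideal Γ(Y, V)}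
    (hm : m = (hV.primeIdealOf ⟨q, hqV⟩).asIdeal) :
    m.IsMaximal ∧ (sectionStr f V).hom π ∈ m ∧ ∃ μ, (sectionStr f V).hom π ^ l ∈ m ^ μ ∧
      ∀ (J : Type u) (x : J → Γ(Y, V)), Ideal.span (Set.range x) = m → ∀ a ∈ m,
        ∀ (F : MvPolynomial J Γ(Y, V)) (k : ℕ), .C a ^ k * F ∈ ratioIdeal x a →
          .C a ^ μ * F ∈ ratioIdeal x a := by
  subst hm
  set m := (hV.primeIdealOf ⟨q, hqV⟩).asIdeal
  have hmax : m.IsMaximal := hV.primeIdealOf_isMaximal_of_isClosed ⟨q, hqV⟩ hq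
  let _ : Algebra Γ(Y, V) (Y.presheaf.stalk q) := Y.presheaf.algebra_section_stalk ⟨q, hqV⟩
  have hloc : IsLocalization.AtPrime (Y.presheaf.stalk q) m := hV.isLocalization_stalk ⟨q, hqV⟩
  have hstr : algebraMap Γ(Y, V) (Y.presheaf.stalk q) ((sectionStr f V).hom π) =
      (stalkStr f q).hom π := congrArg (fun φ ↦ φ.hom π) (sectionStr_germ f V q hqV)
  obtain ⟨h1, h2⟩ := H.stalkStr_mem_pow_rE hfq hπ hπ0
  refine ⟨hmax, ?_, H.mu, ?_, fun J x hx a ha F k hF ↦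
    H.isHypersurfaceOfOrder.C_pow_mul_mem_ratioIdeal m (Y.presheaf.stalk q) x hx ha hF⟩
  · rw [← IsLocalization.AtPrime.to_map_mem_maximal_iff (Y.presheaf.stalk q) m, hstr]
    exact stalkStr_mem_maximalIdeal f hfq (hπ ▸ Ideal.mem_span_singleton_self π)
  · have h3 : algebraMap Γ(Y, V) (Y.presheaf.stalk q) ((sectionStr f V).hom π ^ l) ∈
        (m ^ H.mu).map (algebraMap Γ(Y, V) (Y.presheaf.stalk q)) := by
      rw [map_pow, hstr, Ideal.map_pow, IsLocalization.AtPrime.map_eq_maximalIdeal m]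
      refine Ideal.pow_le_pow_right (H.mu_le hc h2) ?_
      rw [mul_comm, pow_mul]
      exact Ideal.pow_mem_pow h1 l
    obtain ⟨s, hs, hs'⟩ := (IsLocalization.algebraMap_mem_map_algebraMap_iff m.primeCompl _ _ _).mp h3
    exact mem_pow_of_mul_mem_pow_of_isMaximal hs hs'

/-! ### A common affine chart of the two given fibers. -/

/-- Two affine opens of `X` share a basic open of both around `x`, and its two equations lift along
the closed immersions. -/
lemma exists_affine_neighborhoods {X Y Yo : Scheme.{u}} (a : X ⟶ Y) (ao : X ⟶ Yo)
    [IsClosedImmersion a] [IsClosedImmersion ao] (x : X) :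
    ∃ (V : Y.Opens) (Vo : Yo.Opens), IsAffineOpen V ∧ IsAffineOpen Vo ∧ a x ∈ V ∧
      a ⁻¹ᵁ V = ao ⁻¹ᵁ Vo := by
  obtain ⟨V, hV, hx, -⟩ := exists_isAffineOpen_mem_and_subset (x := a x) (U := ⊤) trivial
  obtain ⟨Vo, hVo, hxo, -⟩ := exists_isAffineOpen_mem_and_subset (x := ao x) (U := ⊤) trivial
  obtain ⟨g, go, hg, hxg⟩ := exists_basicOpen_le_affine_inter (hV.preimage a) (hVo.preimage ao) x
    ⟨hx, hxo⟩
  obtain ⟨g, rfl⟩ := a.app_surjective V hV g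
  obtain ⟨go, rfl⟩ := ao.app_surjective Vo hVo go
  rw [← Scheme.preimage_basicOpen] at hxg
  rw [← Scheme.preimage_basicOpen, ← Scheme.preimage_basicOpen] at hg
  exact ⟨_, _, hV.basicOpen g, hVo.basicOpen go, hxg, hg⟩

lemma exists_quotient_chart {R : Type u} [CommRing R] [IsLocalRing R] {Y : Scheme.{u}}
    (s : Y ⟶ Spec (CommRingCat.of R)) (n : ℕ) {V : Y.Opens} (hV : IsAffineOpen V) :
    ∃ (C : CommRingCat.{u}) (κ : Γ(Y, V) ⟶ C) (w : Spec C ⟶ fiber s n),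
      Function.Surjective κ.hom ∧
      RingHom.ker κ.hom = (maximalIdeal R ^ (n + 1)).map (sectionStr s V).hom ∧
      IsOpenImmersion w ∧ w ≫ fiberι s n = Spec.map κ ≫ hV.fromSpec ∧
      Set.range w = fiberι s n ⁻¹' V := by
  obtain ⟨w, hw⟩ := exists_isOpenImmersion_fiber s hV.fromSpec (sectionStr s V)
    (SpecMap_sectionStr s hV) (CommRingCat.ofHom
      (Ideal.Quotient.mk ((maximalIdeal R ^ (n + 1)).map (sectionStr s V).hom)))
    Ideal.Quotient.mk_surjective n Ideal.mk_ker
  refine ⟨_, _, w, Ideal.Quotient.mk_surjective, Ideal.mk_ker, ?_⟩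
  rwa [hV.range_fromSpec] at hw

/-- A common affine chart of two isomorphic infinitesimal fibers. -/
lemma exists_common_chart {R Ro : Type u} [CommRing R] [IsLocalRing R] [CommRing Ro]
    [IsLocalRing Ro] {Y Yo : Scheme.{u}} (s : Y ⟶ Spec (CommRingCat.of R))
    (so : Yo ⟶ Spec (CommRingCat.of Ro)) (n : ℕ) (e : fiber s n ≅ fiber so n) {V : Y.Opens}
    (hV : IsAffineOpen V) {Vo : Yo.Opens} (hVo : IsAffineOpen Vo)
    (h : fiberι s n ⁻¹ᵁ V = (e.hom ≫ fiberι so n) ⁻¹ᵁ Vo) :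
    ∃ (C : CommRingCat.{u}) (κ : Γ(Y, V) ⟶ C) (κo : Γ(Yo, Vo) ⟶ C) (w : Spec C ⟶ fiber s n),
      Function.Surjective κ.hom ∧ Function.Surjective κo.hom ∧
      RingHom.ker κ.hom = (maximalIdeal R ^ (n + 1)).map (sectionStr s V).hom ∧
      RingHom.ker κo.hom = (maximalIdeal Ro ^ (n + 1)).map (sectionStr so Vo).hom ∧
      w ≫ fiberι s n = Spec.map κ ≫ hV.fromSpec ∧
      w ≫ e.hom ≫ fiberι so n = Spec.map κo ≫ hVo.fromSpec ∧
      Set.range w = fiberι s n ⁻¹' V := by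
  obtain ⟨C, κ, w, hκ, hker, hwo, hw, hrange⟩ := exists_quotient_chart s n hV
  obtain ⟨Co, κo, wo, hκo, hkero, hwoo, hwo', hrangeo⟩ := exists_quotient_chart so n hVo
  have hr : Set.range (w ≫ e.hom) = Set.range wo := by
    rw [hrangeo]
    ext y
    have hy : e.inv y ∈ fiberι s n ⁻¹ᵁ V ↔ e.inv y ∈ (e.hom ≫ fiberι so n) ⁻¹ᵁ Vo := by rw [h]
    have hy2 : e.inv y ∈ (e.hom ≫ fiberι so n) ⁻¹ᵁ Vo ↔ y ∈ fiberι so n ⁻¹' Vo := by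
      change (e.hom ≫ fiberι so n) (e.inv y) ∈ Vo ↔ _
      rw [← Scheme.Hom.comp_apply, Iso.inv_hom_id_assoc]
      rfl
    rw [← hy2, ← hy]
    change _ ↔ e.inv y ∈ fiberι s n ⁻¹' V
    rw [← hrange]
    constructor
    · rintro ⟨t, rfl⟩
      exact ⟨t, by rw [← Scheme.Hom.comp_apply, Category.assoc, Iso.hom_inv_id, Category.comp_id]⟩
    · rintro ⟨t, ht⟩
      exact ⟨t, by rw [Scheme.Hom.comp_apply, ht, ← Scheme.Hom.comp_apply, Iso.inv_hom_id]; rfl⟩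
  let i := IsOpenImmersion.isoOfRangeEq (w ≫ e.hom) wo hr
  have hi : i.hom ≫ wo = w ≫ e.hom := IsOpenImmersion.isoOfRangeEq_hom_fac _ _ _
  have : IsIso (Spec.preimage i.hom) := by
    refine ⟨Spec.preimage i.inv, Spec.map_injective ?_, Spec.map_injective ?_⟩ <;>
      simp
  have hbij : Function.Bijective (Spec.preimage i.hom).hom :=
    ConcreteCategory.bijective_of_isIso (Spec.preimage i.hom)
  refine ⟨C, κ, κo ≫ Spec.preimage i.hom, w, hκ, ?_, hker, ?_, hw, ?_, hrange⟩
  · rw [CommRingCat.hom_comp, RingHom.coe_comp]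
    exact hbij.2.comp hκo
  · rw [CommRingCat.hom_comp, RingHom.ker_comp_of_injective _ hbij.1, hkero]
  · rw [Spec.map_comp, Spec.map_preimage, Category.assoc, ← hwo', ← reassoc_of% hi]

/-! ### Isomorphisms of truncated base rings. -/

section Trunc

variable {R Ro : Type u} [CommRing R] [IsLocalRing R] [CommRing Ro] [IsLocalRing Ro]

instance (n : ℕ) : Nontrivial (Trunc R n) :=
  Ideal.Quotient.nontrivial_iff.mpr fun h ↦ (maximalIdeal.isMaximal R).ne_top
    (top_le_iff.mp (h ▸ Ideal.pow_le_self n.succ_ne_zero))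

lemma Trunc.map_map_equiv {n : ℕ} (φ : Trunc R n ≃+* Trunc Ro n) (k : ℕ) :
    ((maximalIdeal R ^ k).map (Ideal.Quotient.mk (maximalIdeal R ^ (n + 1)))).map φ.toRingHom =
      (maximalIdeal Ro ^ k).map (Ideal.Quotient.mk (maximalIdeal Ro ^ (n + 1))) := by
  have : IsLocalRing (Trunc R n) := .of_surjective' _ Ideal.Quotient.mk_surjective
  have : IsLocalRing (Trunc Ro n) := .of_surjective' _ Ideal.Quotient.mk_surjective
  rw [Ideal.map_pow, Ideal.map_pow, Ideal.map_pow,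
    map_maximalIdeal_of_surjective _ Ideal.Quotient.mk_surjective,
    map_maximalIdeal_of_surjective _ Ideal.Quotient.mk_surjective,
    map_maximalIdeal_of_surjective _ φ.surjective]

lemma Trunc.proj_surjective {n m : ℕ} (h : n ≤ m) : Function.Surjective (Trunc.proj R h) :=
  Ideal.Quotient.factor_surjective _

lemma Trunc.ker_proj {n m : ℕ} (h : n ≤ m) : RingHom.ker (Trunc.proj R h) =
    (maximalIdeal R ^ (n + 1)).map (Ideal.Quotient.mk (maximalIdeal R ^ (m + 1))) :=
  Ideal.Quotient.factor_ker _

/-- The isomorphism induced on smaller truncations. -/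
lemma Trunc.exists_induced {n m : ℕ} (h : n ≤ m) (φ : Trunc R m ≃+* Trunc Ro m) :
    ∃ ψ : Trunc R n ≃+* Trunc Ro n, ∀ x, ψ (Trunc.proj R h x) = Trunc.proj Ro h (φ x) := by
  have hmap : RingHom.ker (Trunc.proj Ro h) = (RingHom.ker (Trunc.proj R h)).map φ.toRingHom := by
    rw [Trunc.ker_proj, Trunc.ker_proj, Trunc.map_map_equiv]
  refine ⟨(RingHom.quotientKerEquivOfSurjective (Trunc.proj_surjective h)).symm.trans
    ((Ideal.quotientEquiv _ _ φ hmap).trans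
      (RingHom.quotientKerEquivOfSurjective (Trunc.proj_surjective h))), fun x ↦ ?_⟩
  have hx : (RingHom.quotientKerEquivOfSurjective (Trunc.proj_surjective h)).symm
      (Trunc.proj R h x) = Ideal.Quotient.mk _ x := by
    rw [RingEquiv.symm_apply_eq]
    rfl
  rw [RingEquiv.trans_apply, hx]
  rfl

end Trunc

/-! ### The fiber of the blowing-up away from the center. -/

section AwayFromCenter

variable {R : Type u} [CommRing R] [IsLocalRing R] {X Y Y' : Scheme.{u}}
  {s : Y ⟶ Spec (CommRingCat.of R)} {p : Y' ⟶ Y} {q : Y} {hq : IsClosed ({q} : Set Y)}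
  (hp : IsBlowUpAt p q hq) {N : ℕ} {a : X ⟶ Y} {b : fiber (p ≫ s) N ⟶ X}
  (hb : b ≫ a = fiberι (p ≫ s) N ≫ p) (ha : Function.Injective a) {x : X} (hx : a x = q)

include hx ha in
-- A morphism avoiding the center pulls its ideal back to the unit ideal, which is Cartier on any
-- scheme, even one over a truncation. The universal property therefore applies to such `T`.
lemma isEffectiveCartier_comap_of_ne {T : Scheme.{u}} {t : T ⟶ X} (ht : ∀ y, t y ≠ x) :
    IsEffectiveCartier
      ((Scheme.IdealSheafData.vanishingIdeal ⟨{q}, hq⟩).comap (t ≫ a)) := by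
  rw [comap_eq_top]
  · exact isEffectiveCartier_top
  · intro y hy
    rw [← SetLike.mem_coe, Scheme.IdealSheafData.coe_support_vanishingIdeal] at hy
    refine ht y (ha ?_)
    rw [hx, ← Scheme.Hom.comp_apply]
    exact hy

include hp hb ha hx in
lemma fiber_hom_ext_of_ne {T : Scheme.{u}} (α β : T ⟶ fiber (p ≫ s) N)
    (hα : ∀ t, (α ≫ b) t ≠ x) (h : α ≫ b = β ≫ b) : α = β := by
  rw [← cancel_mono (fiberι (p ≫ s) N)]
  refine (hp.existsUnique_lift T _ (isEffectiveCartier_comap_of_ne ha hx hα)).unique ?_ ?_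
  · rw [Category.assoc, Category.assoc, hb]
  · rw [h, Category.assoc, Category.assoc, hb]

include hp hb ha hx in
lemma exists_fiber_hom_of_ne [Mono a] {T : Scheme.{u}} (t : T ⟶ X) (ht : ∀ y, t y ≠ x)
    (r : T ⟶ Spec (CommRingCat.of (Trunc R N)))
    (hr : t ≫ a ≫ s = r ≫ Spec.map (CommRingCat.ofHom (Ideal.Quotient.mk _))) :
    ∃ β : T ⟶ fiber (p ≫ s) N, β ≫ b = t := by
  obtain ⟨t', ht'⟩ := (hp.existsUnique_lift T _ (isEffectiveCartier_comap_of_ne ha hx ht)).exists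
  refine ⟨pullback.lift t' r (by rw [reassoc_of% ht', hr]), ?_⟩
  rw [← cancel_mono a, Category.assoc, hb, pullback.lift_fst_assoc, ht']

end AwayFromCenter

/-- Truncation loses only multiples of `ϖ ^ (n + 1 + l)`, so `(1 - ϖ ^ (n + 1) t) ϖ ^ l ∈ m ^ μ` for
some `t`, and the first factor is a unit modulo `m ^ μ`. -/
lemma pow_mem_of_map_mem {A C : Type*} [CommRing A] [CommRing C] {κ : A →+* C}
    (hκ : Function.Surjective κ) {m : Ideal A} [m.IsMaximal] {ϖ : A} (hϖ : ϖ ∈ m) {n l μ : ℕ}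
    (hker : RingHom.ker κ = Ideal.span {ϖ ^ (n + 1 + l)}) (h : κ (ϖ ^ l) ∈ (m ^ μ).map κ) :
    ϖ ^ l ∈ m ^ μ := by
  obtain ⟨y, hy, hyκ⟩ := (Ideal.mem_map_iff_of_surjective κ hκ).mp h
  obtain ⟨t, ht⟩ : ϖ ^ (n + 1 + l) ∣ ϖ ^ l - y := by
    rw [← Ideal.mem_span_singleton, ← hker, RingHom.mem_ker, map_sub, hyκ, sub_self]
  refine mem_pow_of_mul_mem_pow_of_isMaximal (s := 1 - ϖ ^ (n + 1) * t) (fun h1 ↦ ?_) ?_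
  · refine ‹m.IsMaximal›.ne_top ((Ideal.eq_top_iff_one m).mpr ?_)
    have : ϖ ^ (n + 1) * t ∈ m := Ideal.mul_mem_right _ _ (Ideal.pow_mem_of_mem m hϖ _ n.succ_pos)
    simpa using add_mem h1 this
  · have : (1 - ϖ ^ (n + 1) * t) * ϖ ^ l = y := by linear_combination ht
    exact this ▸ hy

/-- The morphism from an infinitesimal fiber of `Y'` to a thicker one of `Y`. -/
def fiberMap {R : Type u} [CommRing R] [IsLocalRing R] {Y Y' : Scheme.{u}}
    (s : Y ⟶ Spec (CommRingCat.of R)) (p : Y' ⟶ Y) {N M : ℕ} (h : N ≤ M) :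
    fiber (p ≫ s) N ⟶ fiber s M :=
  pullback.lift (fiberι (p ≫ s) N ≫ p)
    (fiberStr (p ≫ s) N ≫ Spec.map (CommRingCat.ofHom (Trunc.proj R h))) (by
      rw [Category.assoc, Category.assoc, pullback.condition, ← Spec.map_comp]
      rfl)

lemma fiberMap_fiberι {R : Type u} [CommRing R] [IsLocalRing R] {Y Y' : Scheme.{u}}
    (s : Y ⟶ Spec (CommRingCat.of R)) (p : Y' ⟶ Y) {N M : ℕ} (h : N ≤ M) :
    fiberMap s p h ≫ fiberι s M = fiberι (p ≫ s) N ≫ p := pullback.lift_fst _ _ _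

lemma fiberMap_fiberStr {R : Type u} [CommRing R] [IsLocalRing R] {Y Y' : Scheme.{u}}
    (s : Y ⟶ Spec (CommRingCat.of R)) (p : Y' ⟶ Y) {N M : ℕ} (h : N ≤ M) :
    fiberMap s p h ≫ fiberStr s M =
      fiberStr (p ≫ s) N ≫ Spec.map (CommRingCat.ofHom (Trunc.proj R h)) := pullback.lift_snd _ _ _

/-- If a chart `w` of a fiber is given by `κ`, then `κ` is compatible with the structure
homomorphisms. -/
lemma mk_comp_preimage {R : Type u} [CommRing R] [IsLocalRing R] {X Y : Scheme.{u}}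
    {s : Y ⟶ Spec (CommRingCat.of R)} {n : ℕ} {a : X ⟶ Y} {σ : X ⟶ Spec (CommRingCat.of (Trunc R n))}
    (h : a ≫ s = σ ≫ Spec.map (CommRingCat.ofHom (Ideal.Quotient.mk _)))
    {V : Y.Opens} (hV : IsAffineOpen V) {C : CommRingCat.{u}} {κ : Γ(Y, V) ⟶ C} {w : Spec C ⟶ X}
    (hw : w ≫ a = Spec.map κ ≫ hV.fromSpec) :
    CommRingCat.ofHom (Ideal.Quotient.mk _) ≫ Spec.preimage (w ≫ σ) = sectionStr s V ≫ κ := by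
  apply Spec.map_injective
  rw [Spec.map_comp, Spec.map_comp, Spec.map_preimage, SpecMap_sectionStr s hV, Category.assoc, ← h,
    reassoc_of% hw]

lemma asIdeal_primeIdealOf_eq_comap {X Y : Scheme.{u}} {a : X ⟶ Y} {V : Y.Opens}
    (hV : IsAffineOpen V) {C : CommRingCat.{u}} {κ : Γ(Y, V) ⟶ C} {w : Spec C ⟶ X}
    (hw : w ≫ a = Spec.map κ ≫ hV.fromSpec) (y : Spec C) {q : Y} (hq : a (w y) = q) (hqV : q ∈ V) :
    (hV.primeIdealOf ⟨q, hqV⟩).asIdeal = y.asIdeal.comap κ.hom := by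
  have h : hV.primeIdealOf ⟨q, hqV⟩ = Spec.map κ y := by
    apply hV.fromSpec.injective
    rw [hV.fromSpec_primeIdealOf, ← Scheme.Hom.comp_apply, ← hw, Scheme.Hom.comp_apply, hq]
  rw [h]
  rfl

lemma span_eq_span_of_trunc {R Ro : Type u} [CommRing R] [IsLocalRing R] [CommRing Ro]
    [IsLocalRing Ro] {π : R} {πo : Ro} (hπ : maximalIdeal R = Ideal.span {π})
    (hπo : maximalIdeal Ro = Ideal.span {πo}) {n : ℕ} (φ : Trunc R n ≃+* Trunc Ro n)
    {C : CommRingCat.{u}} {ρ : CommRingCat.of R ⟶ C} {ρo : CommRingCat.of Ro ⟶ C}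
    {χ : CommRingCat.of (Trunc R n) ⟶ C} {χo : CommRingCat.of (Trunc Ro n) ⟶ C}
    (hχ : CommRingCat.ofHom (Ideal.Quotient.mk _) ≫ χ = ρ)
    (hχo : CommRingCat.ofHom (Ideal.Quotient.mk _) ≫ χo = ρo)
    (hφ : CommRingCat.ofHom φ.toRingHom ≫ χo = χ) (k : ℕ) :
    Ideal.span {ρ.hom π ^ k} = Ideal.span {ρo.hom πo ^ k} := by
  have h1 : (maximalIdeal R ^ k).map ρ.hom = Ideal.span {ρ.hom π ^ k} := by
    rw [hπ, Ideal.span_singleton_pow, Ideal.map_span, Set.image_singleton, map_pow]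
  have h2 : (maximalIdeal Ro ^ k).map ρo.hom = Ideal.span {ρo.hom πo ^ k} := by
    rw [hπo, Ideal.span_singleton_pow, Ideal.map_span, Set.image_singleton, map_pow]
  rw [← h1, ← h2, ← hχ, ← hχo, ← hφ, CommRingCat.hom_comp, CommRingCat.hom_comp,
    CommRingCat.hom_comp, ← Ideal.map_map, ← Ideal.map_map, ← Ideal.map_map, CommRingCat.hom_ofHom,
    CommRingCat.hom_ofHom, CommRingCat.hom_ofHom]
  exact congrArg _ (Trunc.map_map_equiv φ k)

/-- Transfers the order estimate from one side to the other through the common truncation. -/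
lemma pow_mem_pow_of_span_eq {A Ao C : Type*} [CommRing A] [CommRing Ao] [CommRing C] {κ : A →+* C}
    {κo : Ao →+* C} (hκ : Function.Surjective κ) (hκo : Function.Surjective κo) {I : Ideal C}
    {m : Ideal A} {mo : Ideal Ao} [m.IsMaximal] (hm : m = I.comap κ) (hmo : mo = I.comap κo)
    {ϖ : A} {ϖo : Ao} (hϖ : ϖ ∈ m) {n l μ : ℕ} (hker : RingHom.ker κ = Ideal.span {ϖ ^ (n + 1 + l)})
    (hspan : Ideal.span {κ (ϖ ^ l)} = Ideal.span {κo (ϖo ^ l)}) (hϖo : ϖo ^ l ∈ mo ^ μ) :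
    ϖ ^ l ∈ m ^ μ := by
  apply pow_mem_of_map_mem hκ hϖ hker
  have h1 : (m ^ μ).map κ = (mo ^ μ).map κo := by
    rw [Ideal.map_pow, Ideal.map_pow, hm, hmo, Ideal.map_comap_of_surjective _ hκ,
      Ideal.map_comap_of_surjective _ hκo]
  rw [h1, ← Ideal.span_singleton_le_iff_mem, hspan, Ideal.span_singleton_le_iff_mem]
  exact Ideal.mem_map_of_mem _ hϖo

lemma mem_ratioIdeal_of_le {J A : Type*} [CommRing A] {x : J → A} {f : A} {F : MvPolynomial J A}
    {μ j : ℕ} (h : μ ≤ j) (hF : .C f ^ μ * F ∈ ratioIdeal x f) : .C f ^ j * F ∈ ratioIdeal x f := by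
  rw [← Nat.sub_add_cancel h, pow_add, mul_assoc]
  exact Ideal.mul_mem_left _ _ hF

end InfinitesimalFiber

end

/-! ### The main theorem. -/

open InfinitesimalFiber in
theorem theorem5
    {R Ro : Type u} [CommRing R] [IsDomain R] [IsDiscreteValuationRing R]
    [CommRing Ro] [IsDomain Ro] [IsDiscreteValuationRing Ro]
    {Y Yo : Scheme.{u}} (f : Y ⟶ Spec (CommRingCat.of R)) (fo : Yo ⟶ Spec (CommRingCat.of Ro))
    [Flat f] [LocallyOfFiniteType f] [QuasiCompact f]
    [Flat fo] [LocallyOfFiniteType fo] [QuasiCompact fo]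
    -- closed points of the closed fibers
    (q : Y) (hq : IsClosed ({q} : Set Y)) (hfq : f q = closedPoint R)
    (qo : Yo) (hqo : IsClosed ({qo} : Set Yo)) (hfqo : fo qo = closedPoint Ro)
    -- local presentations as hypersurfaces in regular schemes
    (H : HypersurfaceAt f q) (Ho : HypersurfaceAt fo qo)
    -- the blowing-ups
    {Y' Yo' : Scheme.{u}} (p : Y' ⟶ Y) (po : Yo' ⟶ Yo)
    (hp : IsBlowUpAt p q hq) (hpo : IsBlowUpAt po qo hqo)
    (l : ℕ) (hc : H.c ≤ l) (hco : Ho.c ≤ l) (N : ℕ)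
    -- an isomorphism of the base rings and a compatible isomorphism of pointed fibers
    (φ : Trunc R (N + l) ≃+* Trunc Ro (N + l))
    (e : fiber f (N + l) ≅ fiber fo (N + l))
    (he : e.hom ≫ fiberStr fo (N + l) ≫ Spec.map (CommRingCat.ofHom φ.toRingHom) =
      fiberStr f (N + l))
    (heq : ∃ x : fiber f (N + l), fiberι f (N + l) x = q ∧ fiberι fo (N + l) (e.hom x) = qo) :
    -- `ψ` is the isomorphism induced by `φ`
    ∃ ψ : Trunc R N ≃+* Trunc Ro N,
      (∀ x, ψ (Trunc.proj R (Nat.le_add_right N l) x) =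
        Trunc.proj Ro (Nat.le_add_right N l) (φ x)) ∧
      ∃ e' : fiber (p ≫ f) N ≅ fiber (po ≫ fo) N,
        e'.hom ≫ fiberStr (po ≫ fo) N ≫ Spec.map (CommRingCat.ofHom ψ.toRingHom) =
          fiberStr (p ≫ f) N := by
  have hNl : N ≤ N + l := Nat.le_add_right N l
  obtain ⟨ψ, hψ⟩ := Trunc.exists_induced hNl φ
  refine ⟨ψ, hψ, ?_⟩
  have hψ' : CommRingCat.ofHom (Trunc.proj R hNl) ≫ CommRingCat.ofHom ψ.toRingHom =
      CommRingCat.ofHom φ.toRingHom ≫ CommRingCat.ofHom (Trunc.proj Ro hNl) :=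
    CommRingCat.hom_ext (RingHom.ext hψ)
  obtain ⟨x, hxq, hxqo⟩ := heq
  obtain ⟨π, hπirr⟩ := IsDiscreteValuationRing.exists_irreducible R
  obtain ⟨πo, hπoirr⟩ := IsDiscreteValuationRing.exists_irreducible Ro
  have hπ := hπirr.maximalIdeal_eq
  have hπo := hπoirr.maximalIdeal_eq
  let a := fiberι f (N + l)
  let ao := e.hom ≫ fiberι fo (N + l)
  have hxqo' : ao x = qo := (Scheme.Hom.comp_apply _ _ _).trans hxqo
  have ha : Function.Injective a := a.isClosedEmbedding.injective
  have hao : Function.Injective ao := ao.isClosedEmbedding.injective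
  have hσ : a ≫ f = fiberStr f (N + l) ≫ Spec.map (CommRingCat.ofHom (Ideal.Quotient.mk _)) :=
    pullback.condition
  have hσo : ao ≫ fo = (e.hom ≫ fiberStr fo (N + l)) ≫
      Spec.map (CommRingCat.ofHom (Ideal.Quotient.mk _)) := by
    rw [Category.assoc, Category.assoc, pullback.condition]
  let b := fiberMap f p hNl
  let bo := fiberMap fo po hNl ≫ e.inv
  have hb : b ≫ a = fiberι (p ≫ f) N ≫ p := fiberMap_fiberι _ _ _
  have hbo : bo ≫ ao = fiberι (po ≫ fo) N ≫ po := by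
    rw [Category.assoc, Iso.inv_hom_id_assoc, fiberMap_fiberι]
  have hbσ : b ≫ fiberStr f (N + l) = _ := fiberMap_fiberStr f p hNl
  have hboσ : bo ≫ e.hom ≫ fiberStr fo (N + l) =
      fiberStr (po ≫ fo) N ≫ Spec.map (CommRingCat.ofHom (Trunc.proj Ro hNl)) := by
    rw [Category.assoc, Iso.inv_hom_id_assoc, fiberMap_fiberStr]
  clear_value b bo
  suffices hE : ∃ E : fiber (p ≫ f) N ≅ fiber (po ≫ fo) N, E.hom ≫ bo = b by
    obtain ⟨E, hE⟩ := hE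
    refine ⟨E, ?_⟩
    have : IsClosedImmersion (Spec.map (CommRingCat.ofHom (Trunc.proj R hNl))) :=
      IsClosedImmersion.spec_of_surjective _ (Trunc.proj_surjective hNl)
    rw [← cancel_mono (Spec.map (CommRingCat.ofHom (Trunc.proj R hNl))), ← hbσ, ← hE, ← he,
      Category.assoc, Category.assoc, Category.assoc, ← Spec.map_comp, hψ', Spec.map_comp,
      ← reassoc_of% hboσ]
  -- a common affine chart at the centers
  obtain ⟨V, Vo, hV, hVo, hxV, hVVo⟩ := exists_affine_neighborhoods a ao x
  obtain ⟨C, κ, κo, w, hκ, hκo, hker, hkero, hw, hwo, hrange⟩ :=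
    exists_common_chart f fo (N + l) e hV hVo hVVo
  have hqV : q ∈ V := hxq ▸ hxV
  have hqVo : qo ∈ Vo := by
    have : x ∈ ao ⁻¹ᵁ Vo := hVVo ▸ hxV
    exact hxqo' ▸ this
  have hxw : x ∈ Set.range w := hrange ▸ hxV
  obtain ⟨y, hy⟩ := hxw
  let m := (Scheme.IdealSheafData.vanishingIdeal ⟨{q}, hq⟩).ideal ⟨V, hV⟩
  let mo := (Scheme.IdealSheafData.vanishingIdeal ⟨{qo}, hqo⟩).ideal ⟨Vo, hVo⟩
  have hm : m = (hV.primeIdealOf ⟨q, hqV⟩).asIdeal := vanishingIdeal_singleton_ideal hq hV hqV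
  have hmo : mo = (hVo.primeIdealOf ⟨qo, hqVo⟩).asIdeal :=
    vanishingIdeal_singleton_ideal hqo hVo hqVo
  have hmy : m = y.asIdeal.comap κ.hom :=
    hm.trans (asIdeal_primeIdealOf_eq_comap hV hw y (by rw [hy]; exact hxq) hqV)
  have hmoy : mo = y.asIdeal.comap κo.hom :=
    hmo.trans (asIdeal_primeIdealOf_eq_comap hVo hwo y (by rw [hy]; exact hxqo') hqVo)
  obtain ⟨hmax, hπm, μ, hπμ, htors⟩ := H.exists_order hq hfq hπ hπirr.ne_zero hc hV hqV hm
  obtain ⟨hmaxo, hπmo, μo, hπμo, htorso⟩ :=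
    Ho.exists_order hqo hfqo hπo hπoirr.ne_zero hco hVo hqVo hmo
  have hφχ : CommRingCat.ofHom φ.toRingHom ≫ Spec.preimage (w ≫ e.hom ≫ fiberStr fo (N + l)) =
      Spec.preimage (w ≫ fiberStr f (N + l)) := by
    apply Spec.map_injective
    rw [Spec.map_comp, Spec.map_preimage, Spec.map_preimage, Category.assoc, Category.assoc, he]
  -- The uniformizers need not correspond under `φ`; only the ideals generated by their powers agree
  -- in `C`.
  have hspan (k : ℕ) : Ideal.span {κ.hom ((sectionStr f V).hom π ^ k)} =
      Ideal.span {κo.hom ((sectionStr fo Vo).hom πo ^ k)} := by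
    rw [map_pow, map_pow]
    exact span_eq_span_of_trunc hπ hπo φ (mk_comp_preimage hσ hV hw) (mk_comp_preimage hσo hVo hwo)
      hφχ k
  have hpow : N + l + 1 = N + 1 + l := by ring
  have hker' : RingHom.ker κ.hom = Ideal.span {(sectionStr f V).hom π ^ (N + 1 + l)} := by
    rw [hker, hπ, Ideal.span_singleton_pow, Ideal.map_span, Set.image_singleton, map_pow, hpow]
  have hkero' : RingHom.ker κo.hom = Ideal.span {(sectionStr fo Vo).hom πo ^ (N + 1 + l)} := by
    rw [hkero, hπo, Ideal.span_singleton_pow, Ideal.map_span, Set.image_singleton, map_pow, hpow]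
  -- The multiplicities `μ` and `μo` are not compared. Instead both order estimates are carried
  -- across, so that `max μ μo` serves as a common exponent for the two atlases.
  have hlo : (sectionStr f V).hom π ^ l ∈ m ^ μo :=
    pow_mem_pow_of_span_eq hκ hκo hmy hmoy hπm hker' (hspan l) hπμo
  have hol : (sectionStr fo Vo).hom πo ^ l ∈ mo ^ μ :=
    pow_mem_pow_of_span_eq hκo hκ hmoy hmy hπmo hkero' (hspan l).symm hπμ
  have hj : (sectionStr f V).hom π ^ l ∈ m ^ max μ μo := by
    rcases max_choice μ μo with h | h <;> rw [h] <;> assumption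
  have hjo : (sectionStr fo Vo).hom πo ^ l ∈ mo ^ max μ μo := by
    rcases max_choice μ μo with h | h <;> rw [h] <;> assumption
  -- matching families of generators of the two centers
  let J := {z : Γ(Y, V) × Γ(Yo, Vo) // z.1 ∈ m ∧ z.2 ∈ mo ∧ κ.hom z.1 = κo.hom z.2}
  have hJ : Set.range (fun z : J ↦ z.1.1) = (m : Set Γ(Y, V)) := by
    refine Set.Subset.antisymm (Set.range_subset_iff.mpr fun z ↦ z.2.1) fun z hz ↦ ?_
    obtain ⟨zo, hzo⟩ := hκo (κ.hom z)
    refine ⟨⟨(z, zo), hz, ?_, hzo.symm⟩, rfl⟩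
    change zo ∈ mo
    rw [hmoy, Ideal.mem_comap, hzo, ← Ideal.mem_comap, ← hmy]
    exact hz
  have hJo : Set.range (fun z : J ↦ z.1.2) = (mo : Set Γ(Yo, Vo)) := by
    refine Set.Subset.antisymm (Set.range_subset_iff.mpr fun z ↦ z.2.2.1) fun zo hzo ↦ ?_
    obtain ⟨z, hz⟩ := hκ (κo.hom zo)
    refine ⟨⟨(z, zo), ?_, hzo, hz⟩, rfl⟩
    change z ∈ m
    rw [hmy, Ideal.mem_comap, hz, ← Ideal.mem_comap, ← hmoy]
    exact hzo
  obtain ⟨k, hk⟩ := exists_isTruncAtlas hπ f hp hV (sectionStr f V) (SpecMap_sectionStr f hV) κ hκ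
    hker' _ hJ hj
    (fun g hg F k h ↦ mem_ratioIdeal_of_le (le_max_left μ μo)
      (htors J _ (by rw [hJ, Ideal.span_eq]) g hg F k h))
    rfl (fun _ ↦ rfl) a b hb w hw
  obtain ⟨ko, hko⟩ := exists_isTruncAtlas hπo fo hpo hVo (sectionStr fo Vo)
    (SpecMap_sectionStr fo hVo) κo hκo hkero' _ hJo hjo
    (fun g hg F k h ↦ mem_ratioIdeal_of_le (le_max_right μ μo)
      (htorso J _ (by rw [hJo, Ideal.span_eq]) g hg F k h))
    (hspan (N + 1)) (fun z : J ↦ z.2.2.2.symm) ao bo hbo w hwo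
  have hx : IsClosed {x} := by
    have : {x} = a ⁻¹' {q} := by
      ext t
      exact ⟨fun h ↦ (congrArg a h).trans hxq, fun h ↦ ha (h.trans hxq.symm)⟩
    rw [this]
    exact hq.preimage a.continuous
  have hψs : CommRingCat.ofHom ψ.toRingHom ≫ CommRingCat.ofHom ψ.symm.toRingHom = 𝟙 _ :=
    CommRingCat.hom_ext (RingHom.ext ψ.symm_apply_apply)
  have hφs : CommRingCat.ofHom φ.symm.toRingHom ≫ CommRingCat.ofHom φ.toRingHom = 𝟙 _ :=
    CommRingCat.hom_ext (RingHom.ext φ.apply_symm_apply)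
  have hψφ : CommRingCat.ofHom φ.symm.toRingHom ≫ CommRingCat.ofHom (Trunc.proj R hNl) =
      CommRingCat.ofHom (Trunc.proj Ro hNl) ≫ CommRingCat.ofHom ψ.symm.toRingHom := by
    rw [← Category.comp_id (CommRingCat.ofHom (Trunc.proj R hNl)), ← hψs, reassoc_of% hψ',
      reassoc_of% hφs]
  have he' : fiberStr f (N + l) ≫ Spec.map (CommRingCat.ofHom φ.symm.toRingHom) =
      e.hom ≫ fiberStr fo (N + l) := by
    rw [← he, Category.assoc, Category.assoc, ← Spec.map_comp, hφs, Spec.map_id, Category.comp_id]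
  have hproj : CommRingCat.ofHom (Ideal.Quotient.mk _) ≫ CommRingCat.ofHom (Trunc.proj R hNl) =
      CommRingCat.ofHom (Ideal.Quotient.mk _) := rfl
  have hprojo : CommRingCat.ofHom (Ideal.Quotient.mk _) ≫ CommRingCat.ofHom (Trunc.proj Ro hNl) =
      CommRingCat.ofHom (Ideal.Quotient.mk _) := rfl
  refine exists_iso_of_isTruncAtlas hk hko hx ⟨y, hy⟩
    (fun T ↦ fiber_hom_ext_of_ne hp hb ha hxq) (fun T ↦ fiber_hom_ext_of_ne hpo hbo hao hxqo')
    (fun T α hα ↦ exists_fiber_hom_of_ne hpo hbo hao hxqo' (α ≫ b) hα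
      (α ≫ fiberStr (p ≫ f) N ≫ Spec.map (CommRingCat.ofHom ψ.symm.toRingHom)) ?_)
    (fun T α hα ↦ exists_fiber_hom_of_ne hp hb ha hxq (α ≫ bo) hα
      (α ≫ fiberStr (po ≫ fo) N ≫ Spec.map (CommRingCat.ofHom ψ.toRingHom)) ?_)
  · rw [hσo, ← he', ← hprojo]
    simp only [Category.assoc, reassoc_of% hbσ, ← Spec.map_comp, hψφ]
  · rw [hσ, ← he, ← hproj]
    simp only [Category.assoc, reassoc_of% hboσ, ← Spec.map_comp, hψ']
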